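/- Let $n\ge 1$. Write $e_{ij}$ for the elementary $(2n+1)\times(2n+1)$ matrices, $C_n=\sum_{i=1}^{2n+1}(-1)^{n+i-1}e_{i,2n+2-i}$, $o(n+1,n)=\{A\in \mathrm{gl}(2n+1,\mathbb R): A^tC_n+C_nA=0\}$, $b=\sum_{i=1}^{2n}e_{i+1,i}$, $\beta_i=e_{n+1-i,n+i}+e_{n+2-i,n+1+i}$, $V_n=\bigoplus_{i=1}^n\mathbb R\beta_i$, $V_n^t=\bigoplus_{i=1}^n\mathbb R\beta_i^t$, $\beta=\frac12(e_{1,2n}+e_{2,2n+1})$, $J_B=b+\lambda\beta$, and $\pi_0(Y)=\sum_{i=1}^n y_{n+i,n+1-i}\,\beta_i^t$ for $Y=(y_{ij})$. Let $S^1=\mathbb R/2\pi\mathbb Z$ and $\langle X,Y\rangle=\oint \mathrm{tr}(XY)\,dx$. The gradient $\nabla F(u)\in C^\infty(S^1,V_n^t)$ of a functional $F$ on $C^\infty(S^1,V_n)$ is defined by $\frac{d}{d\varepsilon}\big|_{0}F(u+\varepsilon v)=\langle v,\nabla F(u)\rangle$ for all $v\in C^\infty(S^1,V_n)$; functionals below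 are those having a gradient at every $u$. For $u\in C^\infty(S^1,V_n)$: * there is a unique formal series $P(u,\lambda)=\beta\lambda+\sum_{i\le 0}P_i(u)\lambda^i$ with coefficients in $C^\infty(S^1,o(n+1,n))$ that is conjugate to $J_B$ (over the Laurent series in $\lambda^{-1}$ with coefficients in $C^\infty(S^1)$) and satisfies $[\partial_x+J_B+u,P(u,\lambda)]=0$; write $P(u,\lambda)^{2j-1}=\sum_iP_{2j-1,i}(u)\lambda^i$; * for each $v\in C^\infty(S^1,V_n^t)$ there is a unique $P_u(v)\in C^\infty(S^1,o(n+1,n))$ with $[\partial_x+b+u,P_u(v)]\in C^\infty(S^1,V_n)$ and $\pi_0(P_u(v))=v$; * for each $j\ge1$ there is a unique strictly upper triangular $\eta_j(u)\in C^\infty(S^1,o(n+1,n))$ with $[\partial_x+b+u,P_{2j-1,0}(u)-\eta_j(u)]\in C^\infty(S^1,V_n)$. The $(2j-1)$-th $\hat B_n^{(1)}$-KdV flow ($j\ge1$) is $u_t=[\partial_x+b+u,\,P_{2j-1,0}(u)-\eta_j(u)]$. Define $$\{F,H\}_1(u)=\langle[P_u(\nabla F(u)),\beta],P_u(\nabla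 H(u))\rangle,\qquad \{F,H\}_2(u)=\langle[\partial_x+b+u,P_u(\nabla F(u))],P_u(\nabla H(u))\rangle ,$$ and call $X$ the Hamiltonian vector field of $F$ for $\{\,,\}$ if $\{F,H\}(u)=\langle X(u),\nabla H(u)\rangle$ for all functionals $H$ and all $u$. For $j\ge1$ put $$F_{2j-1}(u)=-\frac{2n}{2j-1}\oint \mathrm{tr}\big(P_{2j-1,-1}(u)\beta\big)\,dx .$$ **Theorem.** (i) For $j\ge 1$, $F_{2j-1}$ has a gradient at every $u$, and it is $\nabla F_{2j-1}(u)=\pi_0(P_{2j-1,0}(u))$. (ii) For $j\ge1$, the Hamiltonian vector field of $F_{2j-1}$ for $\{\,,\}_2$ exists, is unique, and is that of the $(2j-1)$-th $\hat B_n^{(1)}$-KdV flow. (iii) For $j\ge n+1$, the Hamiltonian vector field of $F_{2j-1}$ for $\{\,,\}_1$ exists, is unique, and is that of the $(2(j-n)-1)$-th $\hat B_n^{(1)}$-KdV flow. (iv) The $F_{2j-1}$, $j\ge1$, are conservation laws in involution: $\{F_{2i-1},F_{2j-1}\}_1=\{F_{2i-1},F_{2j-1}\}_2=0$ for all $i,j\ge1$.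 -/

import Mathlib

open scoped ContDiff

noncomputable section

namespace BKdV

/-! ### Smooth functions on the circle -/

/-- `C^∞(S¹, ℝ)`: the smooth `2π`-periodic functions on the line. -/
def circleSubalgebra : Subalgebra ℝ (ℝ → ℝ) where
  carrier := {f | ContDiff ℝ ∞ f ∧ Function.Periodic f (2 * Real.pi)}
  mul_mem' := fun ha hb => ⟨ha.1.mul hb.1, ha.2.mul hb.2⟩
  add_mem' := fun ha hb => ⟨ha.1.add hb.1, ha.2.add hb.2⟩
  algebraMap_mem' := fun _ => ⟨contDiff_const, fun _ => rfl⟩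

abbrev CircleFn : Type := circleSubalgebra

lemma CircleFn.differentiable (f : CircleFn) : Differentiable ℝ (f : ℝ → ℝ) :=
  f.2.1.differentiable (by simp)

lemma CircleFn.deriv_mem (f : CircleFn) : deriv (f : ℝ → ℝ) ∈ circleSubalgebra := by
  refine ⟨(contDiff_infty_iff_deriv.1 f.2.1).2, fun x => ?_⟩
  have h : (fun y => (f : ℝ → ℝ) (y + 2 * Real.pi)) = (f : ℝ → ℝ) := funext f.2.2
  calc deriv (f : ℝ → ℝ) (x + 2 * Real.pi)
      = deriv (fun y => (f : ℝ → ℝ) (y + 2 * Real.pi)) x :=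
        (deriv_comp_add_const (f : ℝ → ℝ) (2 * Real.pi) x).symm
    _ = deriv (f : ℝ → ℝ) x := by rw [h]

/-- The derivation `∂_x` on `C^∞(S¹, ℝ)`. -/
def circleD : Derivation ℝ CircleFn CircleFn :=
  Derivation.mk'
    { toFun := fun f => ⟨deriv (f : ℝ → ℝ), f.deriv_mem⟩
      map_add' := fun f g => by
        ext x
        exact deriv_add (f.differentiable x) (g.differentiable x)
      map_smul' := fun c f => by
        ext x
        exact deriv_const_smul c (f.differentiable x) }
    (fun f g => by
      ext x
      have h := deriv_mul (f.differentiable x) (g.differentiable x)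
      change deriv ((f : ℝ → ℝ) * (g : ℝ → ℝ)) x
        = (f : ℝ → ℝ) x * deriv (g : ℝ → ℝ) x + (g : ℝ → ℝ) x * deriv (f : ℝ → ℝ) x
      rw [h]
      ring)

/-- The integral over the circle. -/
def circleInt (f : CircleFn) : ℝ := ∫ x in (0 : ℝ)..(2 * Real.pi), (f : ℝ → ℝ) x

/-! ### Matrices -/

/-- `(2n+1) × (2n+1)` matrices with entries in `A`. -/
abbrev Mat (n : ℕ) (A : Type*) : Type _ := Matrix (Fin (2 * n + 1)) (Fin (2 * n + 1)) A

/-- The elementary matrix `e_{ij}`, with the indices `i, j` counted from `1`. -/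
def e (n : ℕ) (A : Type*) [CommRing A] (i j : ℕ) : Mat n A :=
  Matrix.of fun r s => if (r : ℕ) + 1 = i ∧ (s : ℕ) + 1 = j then 1 else 0

/-- `C_n = ∑_{i=1}^{2n+1} (-1)^{n+i-1} e_{i, 2n+2-i}`. -/
def formC (n : ℕ) (A : Type*) [CommRing A] : Mat n A :=
  ∑ i ∈ Finset.Icc 1 (2 * n + 1), (-1 : A) ^ (n + i - 1) • e n A i (2 * n + 2 - i)

/-- `X` takes values in `o(n+1, n)`: `Xᵗ C_n + C_n X = 0`. -/
def InSo {n : ℕ} {A : Type*} [CommRing A] (X : Mat n A) : Prop :=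
  X.transpose * formC n A + formC n A * X = 0

/-- `X` is strictly upper triangular. -/
def StrictUpper {n : ℕ} {A : Type*} [CommRing A] (X : Mat n A) : Prop :=
  ∀ r s, s ≤ r → X r s = 0

/-- `b = ∑_{i=1}^{2n} e_{i+1, i}`. -/
def b (n : ℕ) (A : Type*) [CommRing A] : Mat n A :=
  ∑ i ∈ Finset.Icc 1 (2 * n), e n A (i + 1) i

/-- `β_i = e_{n+1-i, n+i} + e_{n+2-i, n+1+i}`, `1 ≤ i ≤ n`. -/
def basisV (n : ℕ) (A : Type*) [CommRing A] (i : ℕ) : Mat n A :=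
  e n A (n + 1 - i) (n + i) + e n A (n + 2 - i) (n + 1 + i)

/-- The `V_n`-valued function `∑ u_i β_i` with components `u_i` (here `u i` is `u_{i+1}`). -/
def toV {n : ℕ} {A : Type*} [CommRing A] (u : Fin n → A) : Mat n A :=
  ∑ i, u i • basisV n A (i + 1)

/-- The `V_nᵗ`-valued function `∑ g_i β_iᵗ` with components `g_i`. -/
def toVt {n : ℕ} {A : Type*} [CommRing A] (g : Fin n → A) : Mat n A :=
  ∑ i, g i • (basisV n A (i + 1)).transpose

/-- The projection `π_0` onto `V_nᵗ`, in components: `π_0(Y) = ∑_i y_{n+i, n+1-i} β_iᵗ`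
(rows and columns counted from `1` in this formula, from `0` in the code). -/
def piZero {n : ℕ} {A : Type*} [CommRing A] (Y : Mat n A) : Fin n → A :=
  fun i => Y ⟨n + i, by omega⟩ ⟨n - 1 - i, by omega⟩

/-- `β = ½ (e_{1,2n} + e_{2,2n+1})`. -/
def beta (n : ℕ) (A : Type*) [CommRing A] [Algebra ℝ A] : Mat n A :=
  (1 / 2 : ℝ) • (e n A 1 (2 * n) + e n A 2 (2 * n + 1))

/-- `[∂_x + b + u, X]`. -/
def covD {n : ℕ} {A : Type*} [CommRing A] [Algebra ℝ A] (D : Derivation ℝ A A)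
    (u : Fin n → A) (X : Mat n A) : Mat n A :=
  X.map D + ((b n A + toV u) * X - X * (b n A + toV u))

/-! ### Loops

A formal series `∑_{i ≤ m} ξ_i λ^i` is a Laurent series in `λ⁻¹`: the exponent `k` of the
Laurent series stands for `λ^{-k}`. -/

/-- The coefficient matrix `ξ_i` of `λ^i` in `ξ(λ)`. -/
def lamCoeff {n : ℕ} {A : Type*} [CommRing A] (P : Mat n (LaurentSeries A)) (i : ℤ) : Mat n A :=
  P.map fun f => f.coeff (-i)

/-- A matrix that is constant in `λ`. -/
def constLoop {n : ℕ} {A : Type*} [CommRing A] (X : Mat n A) : Mat n (LaurentSeries A) :=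
  X.map HahnSeries.C

/-- `λ`. -/
def lam (A : Type*) [CommRing A] : LaurentSeries A := HahnSeries.single (-1) 1

/-- `J_B = b + β λ`. -/
def JB (n : ℕ) (A : Type*) [CommRing A] [Algebra ℝ A] : Mat n (LaurentSeries A) :=
  constLoop (b n A) + lam A • constLoop (beta n A)

/-- The derivation `D`, applied to every entry and every coefficient. -/
def loopD {n : ℕ} {A : Type*} [CommRing A] [Algebra ℝ A] (D : Derivation ℝ A A)
    (P : Mat n (LaurentSeries A)) : Mat n (LaurentSeries A) :=
  P.map fun f => f.map D

/-- `P = P(u, λ)`: a loop with coefficients in `o(n+1, n)` that is conjugate to `J_B`, has the form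
`P = β λ + P_0 + P_{-1} λ⁻¹ + ⋯`, and satisfies `[∂_x + J_B + u, P] = 0`.
(The leading term is prescribed because `-P` is also conjugate to `J_B`.) -/
structure IsResolvent {n : ℕ} {A : Type*} [CommRing A] [Algebra ℝ A] (D : Derivation ℝ A A)
    (u : Fin n → A) (P : Mat n (LaurentSeries A)) : Prop where
  mem_so : ∀ i : ℤ, InSo (lamCoeff P i)
  conj : IsConj (JB n A) P
  coeff_gt : ∀ i : ℤ, 1 < i → lamCoeff P i = 0
  coeff_one : lamCoeff P 1 = beta n A
  comm : loopD D P + ((JB n A + constLoop (toV u)) * P - P * (JB n A + constLoop (toV u))) = 0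

open Classical in
/-- `P(u, λ)` for `u ∈ C^∞(S¹, V_n)`. -/
def resolvent {n : ℕ} (u : Fin n → CircleFn) : Mat n (LaurentSeries CircleFn) :=
  if h : ∃ P, IsResolvent circleD u P then h.choose else 0

/-- `P_{k,i}(u)`, the coefficient of `λ^i` in `P(u, λ)^k`. -/
def Pcoeff {n : ℕ} (k : ℕ) (i : ℤ) (u : Fin n → CircleFn) : Mat n CircleFn :=
  lamCoeff (resolvent u ^ k) i

/-! ### The operator `P_u` and the flows -/

/-- `X ∈ C^∞(S¹, o(n+1, n))`, `[∂_x + b + u, X] ∈ V_n`, and `π_0(X) = v`. -/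
structure IsLift {n : ℕ} (u v : Fin n → CircleFn) (X : Mat n CircleFn) : Prop where
  mem_so : InSo X
  cov_mem : ∃ w : Fin n → CircleFn, covD circleD u X = toV w
  proj : piZero X = v

open Classical in
/-- `P_u(v)`, for `v ∈ C^∞(S¹, V_nᵗ)` given by its components. -/
def Pu {n : ℕ} (u v : Fin n → CircleFn) : Mat n CircleFn :=
  if h : ∃ X, IsLift u v X then h.choose else 0

/-- `η = η_j(u)`: strictly upper triangular in `o(n+1, n)`, with
`[∂_x + b + u, P_{2j-1,0}(u) - η] ∈ V_n`. -/
structure IsEta {n : ℕ} (j : ℕ) (u : Fin n → CircleFn) (η : Mat n CircleFn) : Prop where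
  mem_so : InSo η
  upper : StrictUpper η
  cov_mem : ∃ w : Fin n → CircleFn, covD circleD u (Pcoeff (2 * j - 1) 0 u - η) = toV w

open Classical in
/-- The vector field of the `(2j-1)`-th flow `u_t = [∂_x + b + u, P_{2j-1,0}(u) - η_j(u)]`,
in components. -/
def kdvField {n : ℕ} (j : ℕ) (u : Fin n → CircleFn) : Fin n → CircleFn :=
  if h : ∃ w, ∃ η, IsEta j u η ∧ covD circleD u (Pcoeff (2 * j - 1) 0 u - η) = toV w
  then h.choose else 0

/-! ### Functionals and the two brackets -/

/-- `⟨X, Y⟩ = ∮ tr(XY) dx`. -/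
def pairing {n : ℕ} (X Y : Mat n CircleFn) : ℝ := circleInt (X * Y).trace

/-- `∇F(u) = ∑ g_i β_iᵗ`: `dF_u(v) = ∮ tr(v ∇F(u)) dx` for all `v ∈ C^∞(S¹, V_n)`. -/
def HasGrad {n : ℕ} (F : (Fin n → CircleFn) → ℝ) (u g : Fin n → CircleFn) : Prop :=
  ∀ v : Fin n → CircleFn,
    HasDerivAt (fun ε : ℝ => F (u + ε • v)) (pairing (toV v) (toVt g)) 0

/-- The functionals considered: those that have a gradient everywhere. -/
def IsFunctional {n : ℕ} (F : (Fin n → CircleFn) → ℝ) : Prop :=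
  ∀ u, ∃ g, HasGrad F u g

open Classical in
/-- `∇F(u)`, in components. -/
def grad {n : ℕ} (F : (Fin n → CircleFn) → ℝ) (u : Fin n → CircleFn) : Fin n → CircleFn :=
  if h : ∃ g, HasGrad F u g then h.choose else 0

/-- `{F, H}_1(u) = ⟨[P_u(∇F(u)), β], P_u(∇H(u))⟩`. -/
def bracket₁ {n : ℕ} (F H : (Fin n → CircleFn) → ℝ) (u : Fin n → CircleFn) : ℝ :=
  pairing (Pu u (grad F u) * beta n CircleFn - beta n CircleFn * Pu u (grad F u))
    (Pu u (grad H u))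

/-- `{F, H}_2(u) = ⟨[∂_x + b + u, P_u(∇F(u))], P_u(∇H(u))⟩`. -/
def bracket₂ {n : ℕ} (F H : (Fin n → CircleFn) → ℝ) (u : Fin n → CircleFn) : ℝ :=
  pairing (covD circleD u (Pu u (grad F u))) (Pu u (grad H u))

/-- `X` is a Hamiltonian vector field of `F` for the bracket `br`:
`{F, H}(u) = ⟨X(u), ∇H(u)⟩` for all functionals `H`. -/
def IsHamiltonianField {n : ℕ}
    (br : ((Fin n → CircleFn) → ℝ) → ((Fin n → CircleFn) → ℝ) → (Fin n → CircleFn) → ℝ)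
    (F : (Fin n → CircleFn) → ℝ) (X : (Fin n → CircleFn) → (Fin n → CircleFn)) : Prop :=
  ∀ H, IsFunctional H → ∀ u, br F H u = pairing (toV (X u)) (toVt (grad H u))

/-- `F_{2j-1}(u) = -(2n/(2j-1)) ∮ tr(P_{2j-1,-1}(u) β) dx`. -/
def hamF (n j : ℕ) (u : Fin n → CircleFn) : ℝ :=
  -((2 * n : ℝ) / (2 * j - 1)) *
    circleInt (Pcoeff (2 * j - 1) (-1) u * beta n CircleFn).trace

end BKdV

end

/-! Everything algebraic is done over an arbitrary commutative `ℝ`-algebra with a derivation `D`.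

The resolvent. Put `λ = z^{2n}` and conjugate by `z^ρ` (`regrade`). Then `J_B` becomes `z L` with
the cyclic element `L = b + β`, and `u` contributes only negative powers of `z`. Since `gl = im (ad
L) ⊕ ker (ad L)` (`exists_split`), an invertible series `M` conjugates `∂ + J_B + u` into `∂ + Q`
with `Q` commuting with `J_B` (`exists_dressing_loop`), and `P = M J_B M⁻¹` is the resolvent. From
`L^{2n+1} = L` follows `P^{2n+1} = λ P`; this identity, the equation and the leading term determine
`P` (`resolvent_unique_aux`). The same uniqueness shows that `P` lies in `o(n+1, n)` and is natural
in the algebra.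

Lifts. `V_n` is a complement of `im (ad b)` in `o(n+1, n)`, so `P_u(v)` is found degree by degree
(`exists_lift`); it is unique because the equation is skew for the pairing (`eq_zero_of_covD_mem`).
The matrix `η_j` is the difference of `P_{2j-1,0}` and the lift of its projection; it commutes with
`β`.

Gradients. Let `h = tr(Q J_B^{k+1})`. Modulo total derivatives, a variation of `u` changes `h` by
`tr(δu P^{k+1})`, whereas `λ d/dλ` relates the `λ^0` coefficient of `h` to `tr(P_{k+1,-1} β)`
(`IsResolvent.variation`). Applied to `u + X v` over `CircleFn[X]` this is the derivative of
`F_{2j-1}`, since `P(u + ε v)` is coefficientwise polynomial in `ε`.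

Brackets. The equation for `P^k` says `[∂ + b + u, P_{k,i}] = [P_{k,i-1}, β]`. With the definition
of the lift this gives the second Hamiltonian field, with `P^{2n+1} = λ P` the first one, and
shifting indices against each other gives involution (`pairing_covD_Pcoeff`). -/

noncomputable section

open scoped Matrix

namespace BKdV

/-! ### The matrices `b`, `β`, `V_n` and the adjoint that cuts out `o(n+1, n)` -/

section

variable {n : ℕ} {A : Type*} [CommRing A]

/-! ### Entries of the matrices -/

lemma b_apply (r s : Fin (2 * n + 1)) : b n A r s = if (r : ℕ) = s + 1 then 1 else 0 := by
  simp only [b, Matrix.sum_apply, e, Matrix.of_apply]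
  split_ifs with h
  · rw [Finset.sum_eq_single ((s : ℕ) + 1)]
    · simp [h]
    · intro i _ hi
      rw [if_neg]
      omega
    · intro hs
      exact absurd (Finset.mem_Icc.2 ⟨by omega, by omega⟩) hs
  · refine Finset.sum_eq_zero fun i _ => ?_
    rw [if_neg]
    omega

lemma b_mul_zero (X : Mat n A) (s : Fin (2 * n + 1)) : (b n A * X) 0 s = 0 := by
  simp [Matrix.mul_apply, b_apply]

lemma b_mul_succ (X : Mat n A) (i : ℕ) (hi : i + 1 < 2 * n + 1) (s : Fin (2 * n + 1)) :
    (b n A * X) ⟨i + 1, hi⟩ s = X ⟨i, by omega⟩ s := by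
  rw [Matrix.mul_apply, Finset.sum_eq_single ⟨i, by omega⟩]
  · simp [b_apply]
  · intro k _ hk
    rw [b_apply, if_neg, zero_mul]
    intro h
    apply hk
    ext
    simp at h ⊢
    omega
  · simp

lemma mul_b_last (X : Mat n A) (r : Fin (2 * n + 1)) : (X * b n A) r (Fin.last _) = 0 := by
  rw [Matrix.mul_apply]
  refine Finset.sum_eq_zero fun k _ => ?_
  rw [b_apply, if_neg, mul_zero]
  simp only [Fin.val_last]
  omega

lemma mul_b_of_lt (X : Mat n A) (r : Fin (2 * n + 1)) (i : ℕ) (hi : i + 1 < 2 * n + 1) :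
    (X * b n A) r ⟨i, by omega⟩ = X r ⟨i + 1, hi⟩ := by
  rw [Matrix.mul_apply, Finset.sum_eq_single ⟨i + 1, hi⟩]
  · simp [b_apply]
  · intro k _ hk
    rw [b_apply, if_neg, mul_zero]
    intro h
    apply hk
    ext
    simp at h ⊢
    omega
  · simp

lemma b_pow_apply (m : ℕ) (r s : Fin (2 * n + 1)) :
    (b n A ^ m) r s = if (r : ℕ) = s + m then 1 else 0 := by
  induction m generalizing r with
  | zero => simp [Matrix.one_apply, Fin.ext_iff]
  | succ m ih =>
    rw [pow_succ']
    obtain ⟨r, hr⟩ := r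
    cases r with
    | zero => rw [if_neg (by simp)]; exact b_mul_zero _ _
    | succ i =>
      rw [b_mul_succ, ih]
      simp only [← add_assoc, Nat.add_right_cancel_iff]

lemma toV_apply (u : Fin n → A) (r s : Fin (2 * n + 1)) :
    toV u r s = ∑ i : Fin n, u i *
      ((if (r : ℕ) + i + 1 = n ∧ (s : ℕ) = n + i then 1 else 0) +
        (if (r : ℕ) + i = n ∧ (s : ℕ) = n + 1 + i then 1 else 0)) := by
  simp only [toV, Matrix.sum_apply, Matrix.smul_apply, basisV, e, Matrix.add_apply,
    Matrix.of_apply, smul_eq_mul]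
  refine Finset.sum_congr rfl fun i _ => ?_
  congr 3
  · apply propext; omega
  · apply propext; omega

lemma toV_apply_eq_zero (u : Fin n → A) (r s : Fin (2 * n + 1))
    (h : ∀ i : Fin n, (s : ℕ) = r + 2 * i + 1 → u i = 0) : toV u r s = 0 := by
  rw [toV_apply]
  refine Finset.sum_eq_zero fun i _ => ?_
  by_cases hi : (s : ℕ) = r + 2 * i + 1
  · rw [h i hi, zero_mul]
  · rw [if_neg (by omega), if_neg (by omega)]
    simp

lemma toV_strictUpper (u : Fin n → A) : StrictUpper (toV u) := fun r s hrs =>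
  toV_apply_eq_zero u r s fun i hi => by
    have : (s : ℕ) ≤ r := hrs
    omega

lemma toV_apply_self (u : Fin n → A) (i : Fin n) :
    toV u ⟨n - 1 - i, by omega⟩ ⟨n + i, by omega⟩ = u i := by
  rw [toV_apply, Finset.sum_eq_single i]
  · rw [if_pos (by simp; omega), if_neg (by simp), add_zero, mul_one]
  · intro j _ hj
    rw [if_neg, if_neg]
    · simp
    · have := Fin.val_ne_of_ne hj
      simp; omega
    · have := Fin.val_ne_of_ne hj
      simp; omega
  · simp

lemma toV_add (u v : Fin n → A) : toV (u + v) = toV u + toV v := by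
  simp [toV, add_smul, Finset.sum_add_distrib]

lemma toV_sub (u v : Fin n → A) : toV (u - v) = toV u - toV v := by
  simp [toV, sub_smul, Finset.sum_sub_distrib]

lemma toV_zero : toV (0 : Fin n → A) = 0 := by
  simp [toV]

lemma toV_map {B : Type*} [CommRing B] (f : A →+* B) (u : Fin n → A) :
    (toV u).map f = toV fun i => f (u i) := by
  ext r s
  simp only [Matrix.map_apply, toV_apply, map_sum, map_mul, map_add]
  refine Finset.sum_congr rfl fun i _ => ?_
  congr 2 <;> split_ifs <;> simp

lemma toV_map_derivation {R : Type*} [CommRing R] [Algebra R A] (D : Derivation R A A)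
    (u : Fin n → A) : (toV u).map D = toV fun i => D (u i) := by
  ext r s
  simp only [Matrix.map_apply, toV_apply, map_sum]
  refine Finset.sum_congr rfl fun i _ => ?_
  split_ifs <;> simp [mul_comm]

lemma trace_toV_mul (w : Fin n → A) (X : Mat n A) :
    (toV w * X).trace = ∑ i : Fin n, w i *
      (X ⟨n + i, by omega⟩ ⟨n - 1 - i, by omega⟩
        + X ⟨n + 1 + i, by omega⟩ ⟨n - i, by omega⟩) := by
  have h (p q : Fin (2 * n + 1)) (E : Mat n A)
      (hE : ∀ r s, E r s = if r = p ∧ s = q then 1 else 0) : (E * X).trace = X q p := by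
    rw [Matrix.trace, Finset.sum_eq_single p]
    · rw [Matrix.diag_apply, Matrix.mul_apply, Finset.sum_eq_single q]
      · simp [hE]
      · intro k _ hk; simp [hE, hk]
      · simp
    · intro k _ hk
      rw [Matrix.diag_apply, Matrix.mul_apply]
      exact Finset.sum_eq_zero fun l _ => by simp [hE, hk]
    · simp
  simp only [toV, Finset.sum_mul, Matrix.trace_sum, Matrix.smul_mul, Matrix.trace_smul, basisV,
    add_mul, Matrix.trace_add, smul_eq_mul]
  refine Finset.sum_congr rfl fun i _ => ?_
  congr 2
  · refine h _ _ _ fun r s => ?_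
    simp only [e, Matrix.of_apply, Fin.ext_iff]
    congr 1
    apply propext; omega
  · refine h _ _ _ fun r s => ?_
    simp only [e, Matrix.of_apply, Fin.ext_iff]
    congr 1
    apply propext; omega

lemma beta_apply [Algebra ℝ A] (r s : Fin (2 * n + 1)) :
    beta n A r s = if ((r : ℕ) = 0 ∧ (s : ℕ) + 1 = 2 * n) ∨ ((r : ℕ) = 1 ∧ (s : ℕ) = 2 * n)
      then algebraMap ℝ A (1 / 2) else 0 := by
  simp only [beta, Matrix.smul_apply, Matrix.add_apply, e, Matrix.of_apply]
  by_cases h1 : (r : ℕ) = 0 ∧ (s : ℕ) + 1 = 2 * n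
  · rw [if_pos (by omega), if_neg (by omega), if_pos (Or.inl h1), add_zero, Algebra.smul_def,
      mul_one]
  · by_cases h2 : (r : ℕ) = 1 ∧ (s : ℕ) = 2 * n
    · rw [if_neg (by omega), if_pos (by omega), if_pos (Or.inr h2), zero_add, Algebra.smul_def,
        mul_one]
    · rw [if_neg (by omega), if_neg (by omega), if_neg (by omega)]
      simp

lemma beta_map [Algebra ℝ A] {B : Type*} [CommRing B] [Algebra ℝ B] (f : A →ₐ[ℝ] B) :
    (beta n A).map f = beta n B := by
  ext r s
  simp only [Matrix.map_apply, beta_apply]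
  split_ifs <;> simp

lemma b_map {B : Type*} [CommRing B] (f : A →+* B) : (b n A).map f = b n B := by
  ext r s
  simp only [Matrix.map_apply, b_apply]
  split_ifs <;> simp

/-! ### The adjoint with respect to `C_n` -/

/-- The adjoint `C_n Xᵗ C_n`. -/
def soAdj (X : Mat n A) : Mat n A :=
  Matrix.of fun r s => (-1) ^ ((r : ℕ) + s) * X s.rev r.rev

lemma soAdj_apply (X : Mat n A) (r s : Fin (2 * n + 1)) :
    soAdj X r s = (-1) ^ ((r : ℕ) + s) * X s.rev r.rev := rfl

lemma neg_one_pow_congr {i j : ℕ} (h : i % 2 = j % 2) : (-1 : A) ^ i = (-1) ^ j := by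
  rw [neg_one_pow_eq_pow_mod_two, h, ← neg_one_pow_eq_pow_mod_two]

lemma neg_one_pow_mul_self (i : ℕ) : (-1 : A) ^ i * (-1) ^ i = 1 := by
  rw [← pow_add, ← two_mul, pow_mul]; simp

lemma soAdj_mul (X Y : Mat n A) : soAdj (X * Y) = soAdj Y * soAdj X := by
  ext r s
  simp only [soAdj_apply, Matrix.mul_apply, Finset.mul_sum]
  rw [← Equiv.sum_comp Fin.revPerm]
  refine Finset.sum_congr rfl fun k _ => ?_
  simp only [Fin.revPerm_apply]
  have h : (-1 : A) ^ ((r : ℕ) + s) = (-1) ^ ((r : ℕ) + k) * (-1) ^ ((k : ℕ) + s) := by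
    rw [← pow_add]; exact neg_one_pow_congr (by omega)
  rw [h]; ring

lemma soAdj_add (X Y : Mat n A) : soAdj (X + Y) = soAdj X + soAdj Y := by
  ext r s; simp [soAdj_apply, mul_add]

lemma soAdj_sub (X Y : Mat n A) : soAdj (X - Y) = soAdj X - soAdj Y := by
  ext r s; simp [soAdj_apply, mul_sub]

lemma soAdj_neg (X : Mat n A) : soAdj (-X) = -soAdj X := by
  ext r s; simp [soAdj_apply]

lemma soAdj_smul {R : Type*} [SMul R A] [SMulCommClass R A A] (c : R) (X : Mat n A) :
    soAdj (c • X) = c • soAdj X := by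
  ext r s; simp [soAdj_apply, mul_smul_comm]

lemma soAdj_one : soAdj (1 : Mat n A) = 1 := by
  ext r s
  simp only [soAdj_apply, Matrix.one_apply, Fin.rev_inj]
  by_cases h : r = s
  · subst h; simp [← two_mul, pow_mul]
  · rw [if_neg h, if_neg (Ne.symm h), mul_zero]

lemma soAdj_pow (X : Mat n A) (k : ℕ) : soAdj (X ^ k) = soAdj X ^ k := by
  induction k with
  | zero => simp [soAdj_one]
  | succ k ih => rw [pow_succ, soAdj_mul, ih, ← pow_succ']

lemma soAdj_soAdj (X : Mat n A) : soAdj (soAdj X) = X := by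
  ext r s
  simp only [soAdj_apply, Fin.rev_rev, ← mul_assoc, ← pow_add]
  rw [neg_one_pow_congr (j := 0), pow_zero, one_mul]
  simp only [Fin.val_rev]
  omega

lemma trace_soAdj (X : Mat n A) : (soAdj X).trace = X.trace := by
  simp only [Matrix.trace, Matrix.diag_apply, soAdj_apply]
  rw [← Equiv.sum_comp Fin.revPerm]
  refine Finset.sum_congr rfl fun k _ => ?_
  simp [← two_mul, pow_mul]

lemma soAdj_map {B F : Type*} [CommRing B] [FunLike F A B] [AddMonoidHomClass F A B] (f : F)
    (X : Mat n A) : soAdj (X.map f) = (soAdj X).map f := by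
  ext r s
  simp only [soAdj_apply, Matrix.map_apply]
  rcases neg_one_pow_eq_or A ((r : ℕ) + s) with h | h <;>
    rcases neg_one_pow_eq_or B ((r : ℕ) + s) with h' | h' <;>
    rw [neg_one_pow_eq_pow_mod_two] at h h' <;> rw [neg_one_pow_eq_pow_mod_two,
      neg_one_pow_eq_pow_mod_two (R := A)] <;>
    rcases Nat.mod_two_eq_zero_or_one ((r : ℕ) + s) with h2 | h2 <;> simp [h2]

lemma formC_apply (r s : Fin (2 * n + 1)) :
    formC n A r s = if s = r.rev then (-1) ^ (n + r : ℕ) else 0 := by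
  simp only [formC, Matrix.sum_apply, Matrix.smul_apply, e, Matrix.of_apply]
  rw [Finset.sum_eq_single ((r : ℕ) + 1)]
  · simp only [Fin.ext_iff, Fin.val_rev, true_and]
    rw [smul_eq_mul, mul_ite, mul_one, mul_zero]
    by_cases h : (s : ℕ) = 2 * n + 1 - (r + 1)
    · rw [if_pos (by omega), if_pos h]
      congr 1
    · rw [if_neg (by omega), if_neg h]
  · intro i _ hi
    rw [if_neg (by omega), smul_zero]
  · intro h
    exact absurd (Finset.mem_Icc.2 ⟨by omega, by omega⟩) h

lemma formC_mul_self : formC n A * formC n A = 1 := by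
  ext r s
  simp only [Matrix.mul_apply, formC_apply, Matrix.one_apply]
  rw [Finset.sum_eq_single r.rev]
  · rw [if_pos rfl, Fin.rev_rev]
    by_cases h : r = s
    · rw [if_pos h, if_pos h.symm, ← pow_add, neg_one_pow_congr (j := 0), pow_zero]
      simp only [Fin.val_rev]; omega
    · rw [if_neg h, if_neg (Ne.symm h), mul_zero]
  · intro k _ hk
    rw [if_neg hk, zero_mul]
  · simp

lemma soAdj_eq (X : Mat n A) : soAdj X = formC n A * X.transpose * formC n A := by
  ext r s
  simp only [Matrix.mul_apply, formC_apply, Matrix.transpose_apply, soAdj_apply]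
  rw [Finset.sum_eq_single s.rev]
  · rw [Finset.sum_eq_single r.rev]
    · rw [if_pos rfl, Fin.rev_rev, if_pos rfl]
      have : (-1 : A) ^ ((r : ℕ) + s) = (-1) ^ (n + r : ℕ) * (-1) ^ (n + s.rev : ℕ) := by
        rw [← pow_add]
        apply neg_one_pow_congr
        simp only [Fin.val_rev]; omega
      rw [this]; ring
    · intro k _ hk
      rw [if_neg hk, zero_mul]
    · simp
  · intro k _ hk
    rw [if_neg, mul_zero]
    rintro rfl
    simp at hk
  · simp

/-- Multiply by `C_n`, which squares to the identity. In this form the algebra is the `-1`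
eigenspace of an anti-automorphism, so closure under brackets and odd powers is immediate. -/
lemma inSo_iff (X : Mat n A) : InSo X ↔ soAdj X = -X := by
  rw [InSo, soAdj_eq]
  have hC := formC_mul_self (n := n) (A := A)
  constructor
  · intro h
    rw [mul_assoc, eq_neg_of_add_eq_zero_left h, mul_neg, ← mul_assoc, hC, one_mul]
  · intro h
    have := congrArg (formC n A * ·) h
    simp only [← mul_assoc, hC, one_mul, mul_neg] at this
    rw [this, neg_add_cancel]

lemma InSo.add {X Y : Mat n A} (hX : InSo X) (hY : InSo Y) : InSo (X + Y) := by
  rw [inSo_iff] at *; rw [soAdj_add, hX, hY]; abel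

lemma InSo.sub {X Y : Mat n A} (hX : InSo X) (hY : InSo Y) : InSo (X - Y) := by
  rw [inSo_iff] at *; rw [soAdj_sub, hX, hY]; abel

lemma InSo.smul {R : Type*} [Monoid R] [DistribMulAction R A] [SMulCommClass R A A] (c : R)
    {X : Mat n A} (hX : InSo X) : InSo (c • X) := by
  rw [inSo_iff] at *; rw [soAdj_smul, hX, smul_neg]

lemma inSo_zero : InSo (0 : Mat n A) := by
  simp [InSo]

lemma InSo.sum {ι : Type*} (s : Finset ι) {X : ι → Mat n A} (hX : ∀ i, InSo (X i)) :
    InSo (∑ i ∈ s, X i) := by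
  classical
  induction s using Finset.induction_on with
  | empty => simpa using inSo_zero
  | insert a s ha ih => rw [Finset.sum_insert ha]; exact (hX a).add ih

lemma InSo.lie {X Y : Mat n A} (hX : InSo X) (hY : InSo Y) : InSo (X * Y - Y * X) := by
  rw [inSo_iff] at *
  rw [soAdj_sub, soAdj_mul, soAdj_mul, hX, hY]
  noncomm_ring

lemma InSo.map {B F : Type*} [CommRing B] [FunLike F A B] [AddMonoidHomClass F A B] (f : F)
    {X : Mat n A} (hX : InSo X) : InSo (X.map f) := by
  rw [inSo_iff] at *
  rw [soAdj_map, hX]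
  ext r s
  simp

lemma InSo.pow_odd {X : Mat n A} (hX : soAdj X = -X) {k : ℕ} (hk : Odd k) :
    soAdj (X ^ k) = -X ^ k := by
  rw [soAdj_pow, hX, hk.neg_pow]

lemma InSo.apply {X : Mat n A} (hX : InSo X) (r s : Fin (2 * n + 1)) :
    X s.rev r.rev = -(-1) ^ ((r : ℕ) + s) * X r s := by
  rw [inSo_iff] at hX
  have h := congrFun (congrFun hX r) s
  rw [soAdj_apply, Matrix.neg_apply] at h
  have h1 := neg_one_pow_mul_self (A := A) ((r : ℕ) + s)
  calc X s.rev r.rev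
      = (-1) ^ ((r : ℕ) + s) * (-1) ^ ((r : ℕ) + s) * X s.rev r.rev := by rw [h1, one_mul]
    _ = (-1) ^ ((r : ℕ) + s) * ((-1) ^ ((r : ℕ) + s) * X s.rev r.rev) := by ring
    _ = _ := by rw [h]; ring

lemma inSo_b : InSo (b n A) := by
  rw [inSo_iff]
  ext r s
  simp only [soAdj_apply, Matrix.neg_apply, b_apply, Fin.val_rev]
  by_cases h : (r : ℕ) = s + 1
  · rw [if_pos h, if_pos (by omega), h, neg_one_pow_congr (j := 1) (by omega)]
    simp
  · rw [if_neg h, if_neg (by omega)]; simp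

lemma inSo_b_pow_odd {k : ℕ} (hk : Odd k) : InSo (b n A ^ k) :=
  (inSo_iff _).2 (InSo.pow_odd ((inSo_iff _).1 inSo_b) hk)

lemma inSo_beta [Algebra ℝ A] : InSo (beta n A) := by
  rw [inSo_iff]
  ext r s
  simp only [soAdj_apply, Matrix.neg_apply, beta_apply, Fin.val_rev]
  by_cases h : ((r : ℕ) = 0 ∧ (s : ℕ) + 1 = 2 * n) ∨ ((r : ℕ) = 1 ∧ (s : ℕ) = 2 * n)
  · rw [if_pos h, if_pos (by omega), neg_one_pow_congr (j := 1) (by omega)]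
    simp
  · rw [if_neg h, if_neg (by omega)]; simp

lemma inSo_toV (u : Fin n → A) : InSo (toV u) := by
  rw [inSo_iff]
  ext r s
  simp only [soAdj_apply, Matrix.neg_apply, toV_apply, Fin.val_rev, Finset.mul_sum]
  rw [← Finset.sum_neg_distrib]
  refine Finset.sum_congr rfl fun i _ => ?_
  rw [← mul_assoc, mul_comm _ (u i), mul_assoc, ← mul_neg]
  congr 1
  by_cases h1 : (r : ℕ) + i + 1 = n ∧ (s : ℕ) = n + i
  · rw [if_pos h1, if_neg (by omega), if_pos (by omega), if_neg (by omega),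
      neg_one_pow_congr (j := 1) (by omega)]
    simp
  · by_cases h2 : (r : ℕ) + i = n ∧ (s : ℕ) = n + 1 + i
    · rw [if_neg h1, if_pos h2, if_pos (by omega), if_neg (by omega),
        neg_one_pow_congr (j := 1) (by omega)]
      simp
    · rw [if_neg h1, if_neg h2, if_neg (by omega), if_neg (by omega)]
      simp

lemma InSo.transpose {X : Mat n A} (hX : InSo X) : InSo X.transpose := by
  rw [inSo_iff] at *
  ext r s
  have := congrFun (congrFun hX s) r
  simpa [soAdj_apply, add_comm] using this

lemma inSo_toVt (g : Fin n → A) : InSo (toVt g) := by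
  have : toVt g = (toV g).transpose := by
    simp [toV, toVt, Matrix.transpose_sum]
  rw [this]
  exact (inSo_toV g).transpose

lemma InSo.apply_eq_neg {X : Mat n A} (hX : InSo X) {r s : Fin (2 * n + 1)}
    (h : ((r : ℕ) + s) % 2 = 0) : X s.rev r.rev = -X r s := by
  rw [hX.apply, neg_one_pow_congr (j := 0) (by omega)]; simp

lemma InSo.apply_eq {X : Mat n A} (hX : InSo X) {r s : Fin (2 * n + 1)}
    (h : ((r : ℕ) + s) % 2 = 1) : X s.rev r.rev = X r s := by
  rw [hX.apply, neg_one_pow_congr (j := 1) (by omega)]; simp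

/-- Each `β_i` meets two entries of `X`, and reflection in the antidiagonal makes them equal; hence
the factor 2. Elements of `V_n` therefore see `X` only through `π_0`. -/
lemma trace_toV_mul_of_inSo (w : Fin n → A) {X : Mat n A} (hX : InSo X) :
    (toV w * X).trace = 2 * ∑ i : Fin n, w i * piZero X i := by
  rw [trace_toV_mul, Finset.mul_sum]
  refine Finset.sum_congr rfl fun i _ => ?_
  have h := hX.apply_eq (r := ⟨n + i, by omega⟩) (s := ⟨n - 1 - i, by omega⟩)
    (by simp only; omega)
  have e1 : (Fin.rev ⟨n - 1 - i, by omega⟩ : Fin (2 * n + 1)) = ⟨n + 1 + i, by omega⟩ := by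
    ext; simp only [Fin.val_rev]; omega
  have e2 : (Fin.rev ⟨n + i, by omega⟩ : Fin (2 * n + 1)) = ⟨n - i, by omega⟩ := by
    ext; simp only [Fin.val_rev]; omega
  rw [e1, e2] at h
  rw [h, piZero]
  ring

lemma piZero_toVt (g : Fin n → A) : piZero (toVt g) = g := by
  have : toVt g = (toV g).transpose := by
    simp [toV, toVt, Matrix.transpose_sum]
  ext i
  rw [piZero, this, Matrix.transpose_apply, toV_apply_self]

lemma piZero_eq_zero_of_strictUpper {X : Mat n A} (hX : StrictUpper X) : piZero X = 0 := by
  ext i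
  refine hX _ _ ?_
  rw [Fin.le_def]
  simp only
  omega

lemma piZero_sub (X Y : Mat n A) : piZero (X - Y) = piZero X - piZero Y := rfl

lemma piZero_add (X Y : Mat n A) : piZero (X + Y) = piZero X + piZero Y := rfl

/-- The odd powers of `b` serve as a basis dual to the `β_i` that commutes with `b`, so `π_0` can be
normalised without disturbing `[b, X]`. -/
lemma piZero_b_pow (i j : Fin n) : piZero (b n A ^ (2 * (i : ℕ) + 1)) j = if j = i then 1 else 0 := by
  rw [piZero, b_pow_apply]
  simp only [Fin.ext_iff]
  congr 1
  apply propext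
  omega

lemma StrictUpper.trace_mul {X Y : Mat n A} (hX : StrictUpper X) (hY : StrictUpper Y) :
    (X * Y).trace = 0 := by
  rw [Matrix.trace]
  refine Finset.sum_eq_zero fun r _ => ?_
  rw [Matrix.diag_apply, Matrix.mul_apply]
  refine Finset.sum_eq_zero fun k _ => ?_
  rcases le_total k r with h | h
  · rw [hX r k h, zero_mul]
  · rw [hY k r h, mul_zero]

end

/-! ### Solving `[∂ + b + u, X] + Y ∈ V_n` degree by degree -/

section

variable {n : ℕ} {A : Type*} [CommRing A]

/-! ### The graded equation `[b, X] + Y ∈ V_n` -/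

/-- All entries `X_{rs}` with `r - s > c` vanish. -/
def DegLE (c : ℤ) (X : Mat n A) : Prop :=
  ∀ r s : Fin (2 * n + 1), c < (r : ℤ) - s → X r s = 0

lemma DegLE.add {c : ℤ} {X Y : Mat n A} (hX : DegLE c X) (hY : DegLE c Y) : DegLE c (X + Y) :=
  fun r s h => by rw [Matrix.add_apply, hX r s h, hY r s h, add_zero]

lemma DegLE.sub {c : ℤ} {X Y : Mat n A} (hX : DegLE c X) (hY : DegLE c Y) : DegLE c (X - Y) :=
  fun r s h => by rw [Matrix.sub_apply, hX r s h, hY r s h, sub_zero]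

lemma DegLE.mul {c d : ℤ} {X Y : Mat n A} (hX : DegLE c X) (hY : DegLE d Y) :
    DegLE (c + d) (X * Y) := fun r s h => by
  rw [Matrix.mul_apply]
  refine Finset.sum_eq_zero fun k _ => ?_
  rcases lt_or_ge c ((r : ℤ) - k) with h1 | h1
  · rw [hX r k h1, zero_mul]
  · rw [hY k s (by omega), mul_zero]

lemma DegLE.mono {c d : ℤ} {X : Mat n A} (hX : DegLE c X) (h : c ≤ d) : DegLE d X :=
  fun r s hrs => hX r s (by omega)

lemma degLE_toV (w : Fin n → A) : DegLE (-1) (toV w) := fun r s h =>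
  toV_strictUpper w r s (by rw [Fin.le_def]; omega)

lemma trace_mul_b_pow (Z : Mat n A) (m : ℕ) :
    (Z * b n A ^ m).trace
      = ∑ r : Fin (2 * n + 1), if h : (r : ℕ) + m < 2 * n + 1 then Z r ⟨r + m, h⟩ else 0 := by
  rw [Matrix.trace]
  refine Finset.sum_congr rfl fun r _ => ?_
  rw [Matrix.diag_apply, Matrix.mul_apply]
  split_ifs with h
  · rw [Finset.sum_eq_single ⟨r + m, h⟩]
    · simp [b_pow_apply]
    · intro k _ hk
      rw [b_pow_apply, if_neg, mul_zero]
      intro hk'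
      exact hk (Fin.ext hk')
    · simp
  · refine Finset.sum_eq_zero fun k _ => ?_
    rw [b_pow_apply, if_neg (by omega), mul_zero]

/-- The solution of `x_{i-1,k} - x_{i,k+1} = -z_{ik}` with `x_{i0} = 0`. -/
def diagSum (z : ℕ → ℕ → A) : ℕ → ℕ → A
  | _, 0 => 0
  | 0, k + 1 => z 0 k
  | i + 1, k + 1 => z (i + 1) k + diagSum z i k

lemma diagSum_eq_sum (z : ℕ → ℕ → A) (i m : ℕ) :
    diagSum z i (i + 1 + m) = ∑ a ∈ Finset.range (i + 1), z a (a + m) := by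
  induction i with
  | zero => rw [show 0 + 1 + m = m + 1 by omega]; simp [diagSum]
  | succ i ih =>
    rw [show i + 1 + 1 + m = (i + 1 + m) + 1 by omega, diagSum, ih, Finset.sum_range_succ _ (i + 1),
      add_comm]

lemma diagSum_eq_zero (z : ℕ → ℕ → A) (c : ℤ) (hz : ∀ i k : ℕ, c < (i : ℤ) - k → z i k = 0)
    (i k : ℕ) (h : c - 1 < (i : ℤ) - k) : diagSum z i k = 0 := by
  induction k generalizing i with
  | zero => simp [diagSum]
  | succ k ih =>
    cases i with
    | zero => exact hz _ _ (by push_cast at h ⊢; omega)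
    | succ i =>
      rw [diagSum, hz _ _ (by push_cast at h ⊢; omega), ih i (by push_cast at h ⊢; omega), add_zero]

/-- The image of `ad b` is the trace-orthogonal complement of the powers of `b`. Entrywise the
equation is a recursion along diagonals, solved by partial sums; only the last column of `X b`,
which is zero, imposes a condition. -/
lemma exists_lie_b_eq_neg {c : ℤ} (Z : Mat n A) (hc : DegLE c Z)
    (hZ : ∀ m : ℕ, (Z * b n A ^ m).trace = 0) :
    ∃ X : Mat n A, DegLE (c - 1) X ∧ b n A * X - X * b n A = -Z := by
  set z : ℕ → ℕ → A := fun i k =>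
    if h : i < 2 * n + 1 ∧ k < 2 * n + 1 then Z ⟨i, h.1⟩ ⟨k, h.2⟩ else 0 with hz
  have hzZ (r s : Fin (2 * n + 1)) : z r s = Z r s := dif_pos ⟨r.2, s.2⟩
  -- Column `2n+1` lies outside the matrix and stands for the zero last column of `X b`. The partial
  -- sum there runs over the whole diagonal `s - r = 2n - i`, so it is the trace of `Z b^{2n-i}`.
  have hend (i : ℕ) (hi : i ≤ 2 * n) : diagSum z i (2 * n + 1) = 0 := by
    have h : ∑ r : Fin (2 * n + 1), z r (r + (2 * n - i)) = 0 := by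
      rw [← hZ (2 * n - i), trace_mul_b_pow]
      refine Finset.sum_congr rfl fun r _ => ?_
      split_ifs with hr
      · exact dif_pos ⟨r.2, hr⟩
      · exact dif_neg fun h' => hr h'.2
    rw [Fin.sum_univ_eq_sum_range (fun r => z r (r + (2 * n - i))),
      ← Finset.sum_subset (Finset.range_subset_range.2 (show i + 1 ≤ 2 * n + 1 by omega))] at h
    · rw [show 2 * n + 1 = i + 1 + (2 * n - i) by omega, diagSum_eq_sum, h]
    · intro r _ hr
      rw [Finset.mem_range] at hr
      exact dif_neg (by omega)
  refine ⟨Matrix.of fun r s => diagSum z r s, ?_, ?_⟩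
  · intro r s h
    refine diagSum_eq_zero z c (fun i k hik => ?_) r s h
    simp only [hz]
    split_ifs with h'
    · exact hc _ _ hik
    · rfl
  · ext ⟨i, hi⟩ ⟨k, hk⟩
    rw [Matrix.sub_apply, Matrix.neg_apply, ← hzZ]
    have hl : ((Matrix.of fun r s : Fin (2 * n + 1) => diagSum z r s) * b n A) ⟨i, hi⟩ ⟨k, hk⟩
        = diagSum z i (k + 1) := by
      by_cases h : k + 1 < 2 * n + 1
      · exact mul_b_of_lt _ _ k h
      · obtain rfl : k = 2 * n := by omega
        rw [hend i (by omega)]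
        exact mul_b_last _ _
    rw [hl]
    cases i with
    | zero => rw [show (⟨0, hi⟩ : Fin (2 * n + 1)) = 0 from rfl, b_mul_zero]; simp [diagSum]
    | succ i => rw [b_mul_succ]; simp [diagSum]

lemma DegLE.soAdj {c : ℤ} {X : Mat n A} (hX : DegLE c X) : DegLE c (soAdj X) := fun r s h => by
  rw [soAdj_apply, hX _ _ (by simp only [Fin.val_rev]; omega), mul_zero]

variable [Algebra ℝ A]

lemma eq_zero_of_eq_neg {x : A} (h : x = -x) : x = 0 := by
  have h2 : (2 : ℝ) • x = 0 := by
    rw [two_smul]; nth_rewrite 1 [h]; exact neg_add_cancel _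
  simpa using congrArg ((1 / 2 : ℝ) • ·) h2

lemma DegLE.smul {c : ℤ} (a : ℝ) {X : Mat n A} (hX : DegLE c X) : DegLE c (a • X) :=
  fun r s h => by rw [Matrix.smul_apply, hX r s h, smul_zero]

lemma trace_mul_b_pow_even {Z : Mat n A} (hZ : InSo Z) {m : ℕ} (hm : Even m) :
    (Z * b n A ^ m).trace = 0 := by
  have h := trace_soAdj (Z * b n A ^ m)
  rw [soAdj_mul, soAdj_pow, (inSo_iff _).1 inSo_b, (inSo_iff _).1 hZ, hm.neg_pow, mul_neg,
    Matrix.trace_neg, Matrix.trace_mul_comm] at h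
  exact eq_zero_of_eq_neg h.symm

/-- `V_n` complements the image of `ad b` in `o(n+1, n)`: traces against even powers of `b` vanish
by symmetry, and those against odd powers are removed by a unique element of `V_n`. -/
lemma exists_graded_lift {c : ℤ} (Y : Mat n A) (hY : InSo Y) (hc : DegLE c Y) :
    ∃ (X : Mat n A) (w : Fin n → A), InSo X ∧ DegLE (c - 1) X ∧ piZero X = 0 ∧
      b n A * X - X * b n A + Y = toV w := by
  -- The factor `1/2` cancels the 2 of `trace_toV_mul_of_inSo`.
  set w : Fin n → A := fun i => (1 / 2 : ℝ) • (Y * b n A ^ (2 * (i : ℕ) + 1)).trace with hw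
  set Z := Y - toV w with hZ
  have hZso : InSo Z := hY.sub (inSo_toV w)
  have hw0 : DegLE c (toV w) := by
    intro r s hrs
    refine toV_apply_eq_zero w r s fun i hi => ?_
    rw [hw]
    simp only
    rw [trace_mul_b_pow, Finset.sum_eq_zero, smul_zero]
    intro k _
    split_ifs with h
    · exact hc _ _ (by push_cast; omega)
    · rfl
  have hZtr (m : ℕ) : (Z * b n A ^ m).trace = 0 := by
    rcases Nat.even_or_odd m with hm | ⟨i, rfl⟩
    · exact trace_mul_b_pow_even hZso hm
    by_cases hi : i < n
    · rw [hZ, sub_mul, Matrix.trace_sub, trace_toV_mul_of_inSo _ (inSo_b_pow_odd ⟨i, rfl⟩)]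
      have := piZero_b_pow (A := A) (⟨i, hi⟩ : Fin n)
      simp only at this
      simp only [this, mul_ite, mul_one, mul_zero, Finset.sum_ite_eq', Finset.mem_univ, if_true, hw]
      generalize (Y * b n A ^ (2 * i + 1)).trace = t
      rw [two_mul (_ : A), ← add_smul]
      norm_num
    · rw [trace_mul_b_pow]
      refine Finset.sum_eq_zero fun k _ => ?_
      rw [dif_neg (by omega)]
  obtain ⟨X, hXc, hX⟩ := exists_lie_b_eq_neg Z (hc.sub hw0) hZtr
  -- Projection to `o(n+1, n)`; the equation survives because `b` and `Z` already lie there.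
  set X' := (1 / 2 : ℝ) • (X - soAdj X) with hX'
  have hX'so : InSo X' := by
    refine InSo.smul _ ((inSo_iff _).2 ?_)
    rw [soAdj_sub, soAdj_soAdj]; abel
  have hX'c : DegLE (c - 1) X' := (hXc.sub hXc.soAdj).smul _
  have hX'b : b n A * X' - X' * b n A = -Z := by
    have h := congrArg soAdj hX
    rw [soAdj_sub, soAdj_mul, soAdj_mul, soAdj_neg, (inSo_iff _).1 inSo_b,
      (inSo_iff _).1 hZso] at h
    have h2 : b n A * (X - soAdj X) - (X - soAdj X) * b n A = -Z + -Z := by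
      rw [neg_neg] at h
      nth_rewrite 1 [← hX]
      rw [← h]
      noncomm_ring
    rw [hX', mul_smul_comm, smul_mul_assoc, ← smul_sub, h2, ← two_smul ℝ, smul_smul]
    norm_num
  -- The subtracted powers commute with `b`. The degree bound survives too: the coefficient of a
  -- power that is too high is an entry of `X'` beyond its degree, hence zero.
  refine ⟨X' - ∑ i : Fin n, piZero X' i • b n A ^ (2 * (i : ℕ) + 1), w, ?_, ?_, ?_, ?_⟩
  · exact hX'so.sub (InSo.sum _ fun i => (inSo_b_pow_odd ⟨i, rfl⟩).smul _)
  · refine hX'c.sub fun r s hrs => ?_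
    rw [Matrix.sum_apply]
    refine Finset.sum_eq_zero fun i _ => ?_
    rw [Matrix.smul_apply, b_pow_apply]
    split_ifs with h
    · rw [piZero, hX'c _ _ (by push_cast; omega), zero_smul]
    · rw [smul_zero]
  · ext j
    rw [piZero_sub, Pi.sub_apply]
    have : piZero (∑ i : Fin n, piZero X' i • b n A ^ (2 * (i : ℕ) + 1)) j
        = ∑ i : Fin n, piZero X' i * piZero (b n A ^ (2 * (i : ℕ) + 1)) j := by
      simp [piZero, Matrix.sum_apply]
    rw [this]
    simp [piZero_b_pow]
  · have hcomm : b n A * (∑ i : Fin n, piZero X' i • b n A ^ (2 * (i : ℕ) + 1))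
        = (∑ i : Fin n, piZero X' i • b n A ^ (2 * (i : ℕ) + 1)) * b n A := by
      rw [Finset.mul_sum, Finset.sum_mul]
      refine Finset.sum_congr rfl fun i _ => ?_
      rw [mul_smul_comm, smul_mul_assoc, ← pow_succ, ← pow_succ']
    rw [mul_sub, sub_mul, hcomm, sub_sub_sub_cancel_right, hX'b, hZ]
    abel

/-! ### Lifts -/

variable (D : Derivation ℝ A A) (u : Fin n → A)

lemma matrix_map_mul (X Y : Mat n A) : (X * Y).map D = X.map D * Y + X * Y.map D := by
  ext r s
  simp only [Matrix.map_apply, Matrix.mul_apply, Matrix.add_apply, map_sum, Derivation.leibniz,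
    smul_eq_mul, Finset.sum_add_distrib]
  rw [add_comm]
  congr 1
  exact Finset.sum_congr rfl fun k _ => mul_comm _ _

lemma covD_add (X Y : Mat n A) : covD D u (X + Y) = covD D u X + covD D u Y := by
  rw [covD, covD, covD, Matrix.map_add _ (map_add D)]
  noncomm_ring

lemma covD_sub (X Y : Mat n A) : covD D u (X - Y) = covD D u X - covD D u Y := by
  rw [covD, covD, covD, Matrix.map_sub _ (map_sub D)]
  noncomm_ring

lemma covD_zero : covD D u (0 : Mat n A) = 0 := by
  simpa using covD_sub D u (0 : Mat n A) 0

lemma InSo.covD {X : Mat n A} (hX : InSo X) : InSo (covD D u X) :=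
  (hX.map D).add ((inSo_b.add (inSo_toV u)).lie hX)

lemma trace_covD_mul (X Y : Mat n A) :
    (covD D u X * Y).trace = D (X * Y).trace - (X * covD D u Y).trace := by
  have h : D (X * Y).trace = ((X * Y).map D).trace := by simp [Matrix.trace]
  rw [h, matrix_map_mul, covD, covD]
  simp only [add_mul, mul_add, sub_mul, mul_sub, Matrix.trace_add, Matrix.trace_sub]
  have h1 := Matrix.trace_mul_cycle X Y (b n A)
  have h2 := Matrix.trace_mul_cycle X Y (toV u)
  simp only [← mul_assoc] at *
  rw [h1, h2]
  ring

/-- Only `ad b` raises degree: `∂` preserves it and `ad u` lowers it. After a graded lift the error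
thus has one degree less, and in degree `≤ -(2n+1)` no entry is left. -/
lemma exists_lift_of_degLE (m : ℕ) : ∀ Y : Mat n A, InSo Y → DegLE ((m : ℤ) - (2 * n + 1)) Y →
    ∃ (X : Mat n A) (w : Fin n → A), InSo X ∧ piZero X = 0 ∧ covD D u X + Y = toV w := by
  induction m with
  | zero =>
    intro Y _ hc
    refine ⟨0, 0, inSo_zero, rfl, ?_⟩
    have : Y = 0 := by ext r s; exact hc r s (by push_cast; omega)
    rw [this, covD_zero, toV_zero, add_zero]
  | succ m ih =>
    intro Y hY hc
    obtain ⟨X₀, w₀, hso, hd, hpi, h₀⟩ := exists_graded_lift Y hY hc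
    obtain ⟨X₁, w₁, hso₁, hpi₁, h₁⟩ := ih (covD D u X₀ + Y - toV w₀)
      (((hso.covD D u).add hY).sub (inSo_toV w₀)) (by
        have : covD D u X₀ + Y - toV w₀ = X₀.map D + (toV u * X₀ - X₀ * toV u) := by
          rw [← h₀, covD]; noncomm_ring
        rw [this]
        have hd' : DegLE ((m : ℤ) - (2 * n + 1)) X₀ := hd.mono (by push_cast; omega)
        refine DegLE.add (fun r s h => ?_) (DegLE.sub ?_ ?_)
        · rw [Matrix.map_apply, hd' r s h, map_zero]
        · exact ((degLE_toV u).mul hd').mono (by omega)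
        · exact (hd'.mul (degLE_toV u)).mono (by omega))
    refine ⟨X₀ + X₁, w₀ + w₁, hso.add hso₁, ?_, ?_⟩
    · rw [piZero_add, hpi, hpi₁, add_zero]
    · rw [covD_add, toV_add, ← h₁]; abel

lemma exists_lift (v : Fin n → A) :
    ∃ (X : Mat n A) (w : Fin n → A), InSo X ∧ piZero X = v ∧ covD D u X = toV w := by
  -- With `4n+1` the bound is `2n`, the largest degree of any entry, so it is no restriction.
  obtain ⟨X, w, hX, hpi, h⟩ := exists_lift_of_degLE D u (4 * n + 1) (covD D u (toVt v))
    ((inSo_toVt v).covD D u) (fun r s h => absurd h (by push_cast; omega))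
  refine ⟨X + toVt v, w, hX.add (inSo_toVt v), ?_, ?_⟩
  · rw [piZero_add, hpi, piZero_toVt, zero_add]
  · rw [covD_add, h]

/-- For `Y` in `o(n+1, n)` there is `X` in `o(n+1, n)` with `π_0(X) = 0` and `[∂ + b + u, X] + Y`
in `V_n`. -/
lemma exists_lift_inhomogeneous (Y : Mat n A) (hY : InSo Y) :
    ∃ (X : Mat n A) (w : Fin n → A), InSo X ∧ piZero X = 0 ∧ covD D u X + Y = toV w :=
  exists_lift_of_degLE D u (4 * n + 1) Y hY (fun r s h => absurd h (by push_cast; omega))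

/-! ### Upper triangular solutions -/

/-- If `d ≥ 0` bounds the degree of `X`, the equation leaves nothing in degree `d + 1` of `[b, X]`,
so the `d`-th diagonal is constant. For `d` even the symmetry of `o(n+1, n)` makes it zero, for `d`
odd `π_0` does; then `d` drops by one. -/
lemma strictUpper_of_covD {X : Mat n A} (hX : InSo X) (hpi : piZero X = 0)
    (hcov : DegLE 0 (covD D u X)) : StrictUpper X := by
  have key (m : ℕ) : DegLE ((2 * n : ℤ) - m) X ∨ DegLE (-1) X := by
    induction m with
    | zero => exact Or.inl fun r s h => absurd h (by push_cast; omega)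
    | succ m ih =>
      rcases ih with ih | ih
      swap
      · exact Or.inr ih
      by_cases hm : (2 * n : ℤ) - m < 0
      · exact Or.inr (ih.mono (by omega))
      left
      obtain ⟨d, hd⟩ : ∃ d : ℕ, (2 * n : ℤ) - m = d := ⟨2 * n - m, by omega⟩
      rw [hd] at ih
      have hb : DegLE (d : ℤ) (b n A * X - X * b n A) := by
        have : b n A * X - X * b n A = covD D u X - X.map D - (toV u * X - X * toV u) := by
          rw [covD]; noncomm_ring
        rw [this]
        refine ((hcov.mono (by omega)).sub (fun r s h => ?_)).sub (DegLE.sub ?_ ?_)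
        · rw [Matrix.map_apply, ih r s h, map_zero]
        · exact ((degLE_toV u).mul ih).mono (by omega)
        · exact (ih.mul (degLE_toV u)).mono (by omega)
      have hstep (i : ℕ) (hi : i + 1 + d < 2 * n + 1) :
          X ⟨i + 1 + d, hi⟩ ⟨i + 1, by omega⟩ = X ⟨i + d, by omega⟩ ⟨i, by omega⟩ := by
        have h := hb ⟨(i + d) + 1, by omega⟩ ⟨i, by omega⟩ (by push_cast; omega)
        rw [Matrix.sub_apply, b_mul_succ, mul_b_of_lt _ _ i (by omega), sub_eq_zero] at h
        rw [h]
        congr 1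
        ext
        simp only
        omega
      have hconst (i : ℕ) (hi : i + d < 2 * n + 1) :
          X ⟨i + d, hi⟩ ⟨i, by omega⟩ = X ⟨d, by omega⟩ 0 := by
        induction i with
        | zero =>
          congr 1
          ext; simp
        | succ i ih' => rw [hstep, ih' (by omega)]
      have hzero : X ⟨d, by omega⟩ 0 = 0 := by
        rcases Nat.even_or_odd' d with ⟨i, hi | hi⟩
        · have h1 := hX.apply_eq_neg (r := ⟨d, by omega⟩) (s := 0) (by simp [hi])
          have e1 : Fin.rev (0 : Fin (2 * n + 1)) = ⟨(2 * n - d) + d, by omega⟩ := by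
            ext; simp only [Fin.val_rev, Fin.val_zero]; omega
          have e2 : (Fin.rev ⟨d, by omega⟩ : Fin (2 * n + 1)) = ⟨2 * n - d, by omega⟩ := by
            ext; simp only [Fin.val_rev]; omega
          rw [e1, e2, hconst] at h1
          exact eq_zero_of_eq_neg h1
        · have h1 := congrFun hpi ⟨i, by omega⟩
          rw [piZero, Pi.zero_apply] at h1
          rw [← hconst (n - 1 - i) (by omega), ← h1]
          congr 1
          ext; simp only; omega
      intro r s h
      by_cases hrs : (d : ℤ) < (r : ℤ) - s
      · exact ih r s hrs
      · have e1 : r = ⟨s + d, by omega⟩ := by ext; simp only; omega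
        rw [e1]
        exact (hconst s (by omega)).trans hzero
  intro r s hrs
  rw [Fin.le_def] at hrs
  rcases key (2 * n + 1) with h | h
  · exact h r s (by push_cast; omega)
  · exact h r s (by omega)

/-- `β` has degree `1 - 2n`, and the one entry of degree `2n`, the lower left corner, vanishes on
`o(n+1, n)`. -/
lemma degLE_zero_lie_beta {Y : Mat n A} (hY : InSo Y) :
    DegLE 0 (Y * beta n A - beta n A * Y) := by
  have h0 : Y (Fin.last _) 0 = 0 := by
    have h := hY.apply_eq_neg (r := Fin.last _) (s := 0) (by simp)
    rw [Fin.rev_last, Fin.rev_zero] at h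
    exact eq_zero_of_eq_neg h
  intro r s hrs
  rw [Matrix.sub_apply, Matrix.mul_apply, Matrix.mul_apply, Finset.sum_eq_zero, Finset.sum_eq_zero,
    sub_zero]
  · intro k _
    rw [beta_apply]
    split_ifs with h
    · have e1 : k = Fin.last _ := by ext; simp only [Fin.val_last]; omega
      have e2 : s = 0 := by ext; simp only [Fin.val_zero]; omega
      rw [e1, e2, h0, mul_zero]
    · rw [zero_mul]
  · intro k _
    rw [beta_apply]
    split_ifs with h
    · have e1 : k = 0 := by ext; simp only [Fin.val_zero]; omega
      have e2 : r = Fin.last _ := by ext; simp only [Fin.val_last]; omega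
      rw [e1, e2, h0, zero_mul]
    · rw [mul_zero]

/-- By degree only the upper right corner could survive, and that entry vanishes on `o(n+1, n)`.
This makes the correction `η_j` invisible to `β`. -/
lemma StrictUpper.lie_beta {η : Mat n A} (hη : InSo η) (hu : StrictUpper η) :
    η * beta n A - beta n A * η = 0 := by
  have hso := hη.lie (inSo_beta (n := n) (A := A))
  have hle (r s : Fin (2 * n + 1)) (h : ¬ ((r : ℕ) = 0 ∧ (s : ℕ) = 2 * n)) :
      (η * beta n A - beta n A * η) r s = 0 := by
    rw [Matrix.sub_apply, Matrix.mul_apply, Matrix.mul_apply, Finset.sum_eq_zero,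
      Finset.sum_eq_zero, sub_zero]
    · intro k _
      rw [beta_apply]
      split_ifs with h'
      · rw [hu k s (by rw [Fin.le_def]; omega), mul_zero]
      · rw [zero_mul]
    · intro k _
      rw [beta_apply]
      split_ifs with h'
      · rw [hu r k (by rw [Fin.le_def]; omega), zero_mul]
      · rw [mul_zero]
  ext r s
  by_cases h : (r : ℕ) = 0 ∧ (s : ℕ) = 2 * n
  · have e1 : r = 0 := Fin.ext h.1
    have e2 : s = Fin.last _ := Fin.ext h.2
    subst e1 e2
    have h := hso.apply_eq_neg (r := 0) (s := Fin.last _) (by simp)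
    rw [Fin.rev_last, Fin.rev_zero] at h
    exact eq_zero_of_eq_neg h
  · exact hle r s h

end

/-! ### Derivations of Laurent series and the variational formula -/

section

variable {n : ℕ} {A : Type*} [CommRing A]

/-! ### Derivations of Laurent series -/

/-- Serves both the coefficientwise derivation and the Euler derivation: `hτ` is the Leibniz rule on
monomials. Supports only shrink under `T`, so all three coefficients are sums over one finite
antidiagonal. -/
lemma laurent_leibniz (T : LaurentSeries A → LaurentSeries A) (τ : ℤ → A →+ A)
    (hT : ∀ f k, (T f).coeff k = τ k (f.coeff k))
    (hτ : ∀ i j x y, τ (i + j) (x * y) = x * τ j y + y * τ i x) (f g : LaurentSeries A) :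
    T (f * g) = f * T g + g * T f := by
  ext a
  have hf : (T f).support ⊆ f.support := fun k hk h => hk (by rw [hT, h, map_zero])
  have hg : (T g).support ⊆ g.support := fun k hk h => hk (by rw [hT, h, map_zero])
  rw [mul_comm g, hT, HahnSeries.coeff_add, HahnSeries.coeff_mul,
    HahnSeries.coeff_mul_left' f.isPWO_support hf, HahnSeries.coeff_mul_right' g.isPWO_support hg,
    map_sum, ← Finset.sum_add_distrib]
  refine Finset.sum_congr rfl fun ij hij => ?_
  rw [← (Finset.mem_antidiagonal.1 hij).2.2, hτ, hT, hT, mul_comm (g.coeff _)]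

/-! ### Coefficients -/

lemma lamCoeff_add (P Q : Mat n (LaurentSeries A)) (i : ℤ) :
    lamCoeff (P + Q) i = lamCoeff P i + lamCoeff Q i := by
  ext r s; simp [lamCoeff]

lemma lamCoeff_sub (P Q : Mat n (LaurentSeries A)) (i : ℤ) :
    lamCoeff (P - Q) i = lamCoeff P i - lamCoeff Q i := by
  ext r s; simp [lamCoeff]

lemma lamCoeff_lam_smul (P : Mat n (LaurentSeries A)) (i : ℤ) :
    lamCoeff (lam A • P) i = lamCoeff P (i - 1) := by
  ext r s
  simp only [lamCoeff, Matrix.map_apply, Matrix.smul_apply, smul_eq_mul, lam,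
    HahnSeries.coeff_single_mul, one_mul]
  congr 1; ring

lemma lamCoeff_constLoop_mul (X : Mat n A) (P : Mat n (LaurentSeries A)) (i : ℤ) :
    lamCoeff (constLoop X * P) i = X * lamCoeff P i := by
  ext r s
  simp [lamCoeff, Matrix.mul_apply, constLoop, HahnSeries.coeff_sum, HahnSeries.C_apply]

lemma lamCoeff_mul_constLoop (X : Mat n A) (P : Mat n (LaurentSeries A)) (i : ℤ) :
    lamCoeff (P * constLoop X) i = lamCoeff P i * X := by
  ext r s
  simp [lamCoeff, Matrix.mul_apply, constLoop, HahnSeries.coeff_sum, HahnSeries.C_apply]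

lemma constLoop_b : constLoop (b n A) = b n (LaurentSeries A) :=
  b_map (HahnSeries.C : A →+* LaurentSeries A)

lemma trace_lamCoeff (P : Mat n (LaurentSeries A)) (i : ℤ) :
    (lamCoeff P i).trace = P.trace.coeff (-i) := by
  simp [Matrix.trace, lamCoeff, HahnSeries.coeff_sum]

lemma exists_lamCoeff_eq_zero (P : Mat n (LaurentSeries A)) :
    ∃ B : ℕ, ∀ i : ℤ, B < i → lamCoeff P i = 0 := by
  have h (f : LaurentSeries A) : ∃ B : ℕ, ∀ i : ℤ, B < i → f.coeff (-i) = 0 := by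
    refine ⟨(-f.order).toNat, fun i hi => HahnSeries.coeff_eq_zero_of_lt_order ?_⟩
    omega
  choose B hB using fun r s => h (P r s)
  refine ⟨∑ r, ∑ s, B r s, fun i hi => ?_⟩
  ext r s
  refine hB r s i (lt_of_le_of_lt ?_ hi)
  exact_mod_cast (Finset.single_le_sum (f := fun s => B r s) (fun _ _ => Nat.zero_le _)
    (Finset.mem_univ s)).trans (Finset.single_le_sum (f := fun r => ∑ s, B r s)
      (fun _ _ => Nat.zero_le _) (Finset.mem_univ r))

variable [Algebra ℝ A]

/-- The coefficientwise structure, which has to be preferred to the one through power series. -/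
instance laurentAlgebra : Algebra ℝ (LaurentSeries A) := HahnSeries.instAlgebra

/-- A derivation, applied to every coefficient. -/
def laurentD (D : Derivation ℝ A A) : Derivation ℝ (LaurentSeries A) (LaurentSeries A) :=
  Derivation.mk'
    { toFun := fun f => f.map D
      map_add' := fun f g => by ext; simp
      map_smul' := fun c f => by ext; simp }
    (laurent_leibniz _ (fun _ => (D : A →ₗ[ℝ] A).toAddMonoidHom) (fun _ _ => rfl)
      fun _ _ x y => D.leibniz x y)

@[simp] lemma laurentD_coeff (D : Derivation ℝ A A) (f : LaurentSeries A) (k : ℤ) :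
    (laurentD D f).coeff k = D (f.coeff k) := rfl

/-- The Euler derivation `λ d/dλ`. -/
def eulerD : Derivation ℝ (LaurentSeries A) (LaurentSeries A) :=
  Derivation.mk'
    { toFun := fun f =>
        -- The sign appears because the exponent `k` stands for `λ^{-k}`.
        { coeff := fun k => -(k • f.coeff k)
          isPWO_support' := f.isPWO_support.mono fun k hk h => hk (by simp only; rw [h]; simp) }
      map_add' := fun f g => by ext k; simp [add_comm]
      map_smul' := fun c f => by ext k; simp }
    (laurent_leibniz _ (fun k => -(k • AddMonoidHom.id A)) (fun _ _ => rfl)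
      fun i j x y => by simp [add_mul]; ring)

lemma eulerD_coeff (f : LaurentSeries A) (k : ℤ) :
    (eulerD f).coeff k = -(k • f.coeff k) := rfl

lemma loopD_eq (D : Derivation ℝ A A) (P : Mat n (LaurentSeries A)) :
    loopD D P = P.map (laurentD D) := rfl

lemma eulerD_lam : eulerD (lam A) = lam A := by
  ext k
  rw [eulerD_coeff, lam, HahnSeries.coeff_single]
  split_ifs with h
  · rw [h]; simp
  · simp

lemma laurentD_lam (D : Derivation ℝ A A) : laurentD D (lam A) = 0 := by
  ext k
  rw [laurentD_coeff, lam, HahnSeries.coeff_single]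
  split_ifs <;> simp

lemma eulerD_C (a : A) : eulerD (HahnSeries.C a : LaurentSeries A) = 0 := by
  ext k
  rw [eulerD_coeff, HahnSeries.C_apply, HahnSeries.coeff_single]
  split_ifs with h
  · rw [h]; simp
  · simp

lemma laurentD_C (D : Derivation ℝ A A) (a : A) :
    laurentD D (HahnSeries.C a : LaurentSeries A) = HahnSeries.C (D a) := by
  ext k
  rw [laurentD_coeff, HahnSeries.C_apply, HahnSeries.C_apply, HahnSeries.coeff_single,
    HahnSeries.coeff_single]
  split_ifs <;> simp

lemma derivation_b {R : Type*} [CommRing R] [Algebra ℝ R] (D : Derivation ℝ R R) :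
    (b n R).map D = 0 := by
  ext r s
  simp only [Matrix.map_apply, b_apply, Matrix.zero_apply]
  split_ifs <;> simp

lemma derivation_beta {R : Type*} [CommRing R] [Algebra ℝ R] (D : Derivation ℝ R R) :
    (beta n R).map D = 0 := by
  ext r s
  simp only [Matrix.map_apply, beta_apply, Matrix.zero_apply]
  split_ifs <;> simp [-one_div]

lemma constLoop_beta : constLoop (beta n A) = beta n (LaurentSeries A) := by
  ext r s : 2
  simp only [constLoop, Matrix.map_apply, beta_apply]
  split_ifs
  · rfl
  · simp

lemma JB_eq : JB n A = b n (LaurentSeries A) + lam A • beta n (LaurentSeries A) := by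
  rw [JB, constLoop_b, constLoop_beta]

lemma derivation_smul {R : Type*} [CommRing R] [Algebra ℝ R] (D : Derivation ℝ R R) (c : R)
    (X : Mat n R) : (c • X).map D = D c • X + c • X.map D := by
  ext r s
  simp only [Matrix.map_apply, Matrix.smul_apply, Matrix.add_apply, smul_eq_mul,
    Derivation.leibniz]
  ring

lemma laurentD_JB (D : Derivation ℝ A A) : (JB n A).map (laurentD D) = 0 := by
  rw [JB_eq, Matrix.map_add _ (map_add _), derivation_smul, derivation_b, derivation_beta,
    laurentD_lam]
  simp

lemma eulerD_JB : (JB n A).map eulerD = lam A • beta n (LaurentSeries A) := by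
  rw [JB_eq, Matrix.map_add _ (map_add _), derivation_smul, derivation_b, derivation_beta,
    eulerD_lam]
  simp

lemma eulerD_constLoop (X : Mat n A) : (constLoop X).map eulerD = 0 := by
  exact Matrix.ext fun r s => eulerD_C (X r s)

lemma lamCoeff_loopD (D : Derivation ℝ A A) (P : Mat n (LaurentSeries A)) (i : ℤ) :
    lamCoeff (loopD D P) i = (lamCoeff P i).map D := rfl

/-! ### Variation of the dressed operator -/

section Variation

variable {K : Type*} [CommRing K] [Algebra ℝ K] (D d : Derivation ℝ K K)
  {J U M G P Q : Mat n K}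

/-- Conjugation by `M` carries `D + U` to `D + Q` and `P` to `J`, so `[D + U, P] = 0` becomes `D J +
[Q, J] = 0`, and `D J = 0`. -/
lemma dressed_commute (hGM : G * M = 1) (hP : P * M = M * J) (hJ : J.map D = 0)
    (hcomm : P.map D + (U * P - P * U) = 0) (hQ : M.map D + U * M = M * Q) : Q * J = J * Q := by
  have h := congrArg (fun X : Mat n K => X.map D) hP
  simp only [matrix_map_mul, hJ, mul_zero, add_zero] at h
  have h1 : M.map D = M * Q - U * M := by rw [← hQ]; abel
  have h2 : P.map D = P * U - U * P := by
    rw [← sub_eq_zero, ← hcomm]; abel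
  rw [h1, h2] at h
  have h3 : M * (Q * J) = M * (J * Q) := by
    calc M * (Q * J) = (M * Q - U * M) * J + U * (M * J) := by noncomm_ring
      _ = (P * U - U * P) * M + P * (M * Q - U * M) + U * (P * M) := by rw [h, hP]
      _ = P * M * Q := by noncomm_ring
      _ = M * (J * Q) := by rw [hP, mul_assoc]
  calc Q * J = G * M * (Q * J) := by rw [hGM, one_mul]
    _ = G * M * (J * Q) := by rw [mul_assoc, h3, mul_assoc]
    _ = J * Q := by rw [hGM, one_mul]

/-- With `X = M⁻¹ dM` one has `dQ = M⁻¹ (dU) M + [D + Q, X]`. Against `J^k`, which commutes with `D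
+ Q`, the last term leaves only the total derivative `D tr(X J^k)`. -/
lemma trace_variation (hDd : ∀ x, D (d x) = d (D x)) (hMG : M * G = 1) (hGM : G * M = 1)
    (hP : P * M = M * J) (hJ : J.map D = 0) (hQ : M.map D + U * M = M * Q) (hQJ : Q * J = J * Q)
    (k : ℕ) : ∃ r : K, (Q.map d * J ^ k).trace = (U.map d * P ^ k).trace + D r := by
  set X := G * M.map d with hX
  have hMX : M.map d = M * X := by rw [hX, ← mul_assoc, hMG, one_mul]
  have h := congrArg (fun X : Mat n K => X.map d) hQ
  simp only [matrix_map_mul, Matrix.map_add _ (map_add d)] at h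
  have hswap : (M.map D).map d = (M.map d).map D := by ext r s; simp [hDd]
  have h1 : M.map D = M * Q - U * M := by rw [← hQ]; abel
  rw [hswap, hMX, matrix_map_mul, h1] at h
  have h2 : Q.map d = Q * X - X * Q + X.map D + G * U.map d * M := by
    have : M * Q.map d = M * (Q * X - X * Q + X.map D + G * U.map d * M) := by
      calc M * Q.map d = M * X * Q + M * Q.map d - M * X * Q := by noncomm_ring
        _ = M * (Q * X - X * Q + X.map D) + 1 * U.map d * M := by rw [← h]; noncomm_ring
        _ = _ := by rw [← hMG]; noncomm_ring
    calc Q.map d = G * M * Q.map d := by rw [hGM, one_mul]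
      _ = _ := by rw [mul_assoc, this, ← mul_assoc, hGM, one_mul]
  have hPk : P ^ k * M = M * J ^ k := by
    have : SemiconjBy M J P := hP.symm
    exact (this.pow_right k).symm
  have hJk : (J ^ k).map D = 0 := by
    induction k with
    | zero =>
      ext r s
      simp only [pow_zero, Matrix.map_apply, Matrix.one_apply, Matrix.zero_apply]
      split_ifs <;> simp
    | succ k ih =>
      rw [pow_succ, matrix_map_mul, ih (by
        have : SemiconjBy M J P := hP.symm
        exact (this.pow_right k).symm), hJ]
      simp
  have hQJk : Q * J ^ k = J ^ k * Q := (show Commute Q J from hQJ).pow_right k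
  refine ⟨(X * J ^ k).trace, ?_⟩
  have hD : D (X * J ^ k).trace = (X.map D * J ^ k).trace := by
    have : D (X * J ^ k).trace = ((X * J ^ k).map D).trace := by simp [Matrix.trace]
    rw [this, matrix_map_mul, hJk, mul_zero, add_zero]
  have hz : ((Q * X - X * Q) * J ^ k).trace = 0 := by
    rw [sub_mul, Matrix.trace_sub, mul_assoc X, hQJk, Matrix.trace_mul_comm (Q * X),
      Matrix.trace_mul_comm X, mul_assoc, sub_self]
  have hG : (G * U.map d * M * J ^ k).trace = (U.map d * P ^ k).trace := by
    rw [mul_assoc, ← hPk, mul_assoc, Matrix.trace_mul_comm, mul_assoc, mul_assoc, hMG, mul_one]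
  rw [h2, add_mul, add_mul, Matrix.trace_add, Matrix.trace_add, hz, hD, hG]
  ring

/-- Cyclicity of the trace collects the terms of the product rule. The induction passes from `Q` to
`J Q`, which again commutes with `J`. -/
lemma trace_mul_derivation_pow (k : ℕ) (hQJ : Q * J = J * Q) :
    (Q * (J ^ (k + 1)).map d).trace = (k + 1) * (Q * J ^ k * J.map d).trace := by
  induction k generalizing Q with
  | zero => simp
  | succ k ih =>
    have h : (J * Q) * J = J * (J * Q) := by rw [mul_assoc, hQJ]
    have hc : Q * J ^ (k + 1) = J * Q * J ^ k := by
      rw [pow_succ', ← mul_assoc, hQJ]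
    rw [pow_succ _ (k + 1), matrix_map_mul, mul_add, Matrix.trace_add, ← mul_assoc,
      Matrix.trace_mul_comm _ J, ← mul_assoc, ih h, ← mul_assoc, hc]
    push_cast
    ring

/-- The principal grading operator. -/
def gradingMat (n : ℕ) (K : Type*) [CommRing K] : Mat n K := Matrix.diagonal fun r => -(r : K)

/-- `b` has principal degree 1 and `β` has degree `1 - 2n`. For `l = λ` this is the infinitesimal
form of the homogeneity of `J_B`: up to conjugation, `2n λ d/dλ` multiplies it by 1. -/
lemma lie_gradingMat (l : K) :
    (2 * n : K) • (l • beta n K) = (b n K + l • beta n K)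
      + (gradingMat n K * (b n K + l • beta n K) - (b n K + l • beta n K) * gradingMat n K) := by
  ext r s
  simp only [gradingMat, Matrix.add_apply, Matrix.sub_apply, Matrix.smul_apply,
    Matrix.diagonal_mul, Matrix.mul_diagonal, smul_eq_mul, b_apply, beta_apply]
  by_cases h : (r : ℕ) = s + 1
  · rw [if_pos h, if_neg (by omega), h]
    push_cast
    ring
  · rw [if_neg h]
    split_ifs with h'
    · have : (2 * n : K) = (s : ℕ) + 1 - (r : ℕ) := by
        have h2 : (2 * n : ℕ) + r = s + 1 := by omega
        have := congrArg (Nat.cast : ℕ → K) h2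
        push_cast at this
        rw [← this]; ring
      rw [this]
      ring
    · ring

/-- The commutator with the grading operator disappears under the trace, because `Q J^k` commutes
with `J`. -/
lemma trace_mul_pow_beta (l : K) (hJ : J = b n K + l • beta n K)
    (hQJ : Q * J = J * Q) (k : ℕ) :
    2 * n * (Q * J ^ k * (l • beta n K)).trace = (Q * J ^ (k + 1)).trace := by
  have h := congrArg (fun X => (Q * J ^ k * X).trace) (lie_gradingMat (n := n) l)
  simp only [← hJ, mul_add, mul_sub, Matrix.trace_add, Matrix.trace_sub] at h
  rw [mul_smul_comm, Matrix.trace_smul, smul_eq_mul] at h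
  have hc : Q * J ^ k * J = J * (Q * J ^ k) := by
    rw [mul_assoc, ← pow_succ, pow_succ', ← mul_assoc, hQJ, mul_assoc]
  have hz : (Q * J ^ k * (gradingMat n K * J)).trace = (Q * J ^ k * (J * gradingMat n K)).trace := by
    rw [← mul_assoc, Matrix.trace_mul_comm _ J, ← mul_assoc, ← hc, mul_assoc _ J]
  rw [h, hz, sub_self, add_zero, mul_assoc, ← pow_succ]

end Variation

/-! ### Resolvents -/

variable {D : Derivation ℝ A A} {u : Fin n → A} {P : Mat n (LaurentSeries A)}

lemma constLoop_toV_map (d : Derivation ℝ A A) (u : Fin n → A) :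
    (constLoop (toV u)).map (laurentD d) = constLoop (toV fun i => d (u i)) := by
  rw [← toV_map_derivation]
  exact Matrix.ext fun r s => laurentD_C d (toV u r s)

/-- The variation of `tr(β P_{k,-1})` along a derivation commuting with `D`, up to a total
derivative. -/
lemma IsResolvent.variation (hP : IsResolvent D u P) (δ : Derivation ℝ A A)
    (hδ : ∀ x, D (δ x) = δ (D x)) (k : ℕ) :
    ∃ r : A, (2 * n : A) * δ (lamCoeff (P ^ (k + 1)) (-1) * beta n A).trace
      + (k + 1 : A) * (toV (fun i => δ (u i)) * lamCoeff (P ^ (k + 1)) 0).trace = D r := by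
  obtain ⟨M, hM⟩ := hP.conj
  set G : Mat n (LaurentSeries A) := ↑M⁻¹ with hG
  have hMG : (M : Mat n (LaurentSeries A)) * G = 1 := M.mul_inv
  have hGM : G * (M : Mat n (LaurentSeries A)) = 1 := M.inv_mul
  have hPM : P * (M : Mat n (LaurentSeries A)) = M * JB n A := hM.symm
  set U := JB n A + constLoop (toV u) with hU
  set Q := G * ((M : Mat n (LaurentSeries A)).map (laurentD D) + U * M) with hQdef
  have hQ : (M : Mat n (LaurentSeries A)).map (laurentD D) + U * M = M * Q := by
    rw [hQdef, ← mul_assoc, hMG, one_mul]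
  have hQJ := dressed_commute (laurentD D) hGM hPM (laurentD_JB D) hP.comm hQ
  obtain ⟨r₁, h₁⟩ := trace_variation (laurentD D) (laurentD δ) (fun x => by ext; simp [hδ])
    hMG hGM hPM (laurentD_JB D) hQ hQJ (k + 1)
  obtain ⟨r₂, h₂⟩ := trace_variation (laurentD D) eulerD
    (fun x => by ext; simp [eulerD_coeff]) hMG hGM hPM (laurentD_JB D) hQ hQJ (k + 1)
  -- `h` is differentiated twice: by `δ`, which kills `J_B`, and by the Euler derivation, which
  -- turns `J_B` into `λ β`.
  set h := (Q * JB n A ^ (k + 1)).trace with hh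
  have hpow (d : Derivation ℝ (LaurentSeries A) (LaurentSeries A)) :
      d h = (Q.map d * JB n A ^ (k + 1)).trace
        + (k + 1) * (Q * JB n A ^ k * (JB n A).map d).trace := by
    have : d h = ((Q * JB n A ^ (k + 1)).map d).trace := by simp [Matrix.trace, hh]
    rw [this, matrix_map_mul, Matrix.trace_add, trace_mul_derivation_pow d k hQJ]
  have e₁ : laurentD δ h = (constLoop (toV fun i => δ (u i)) * P ^ (k + 1)).trace
      + laurentD D r₁ := by
    rw [hpow, h₁, laurentD_JB, hU, Matrix.map_add _ (map_add _), laurentD_JB, zero_add,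
      constLoop_toV_map]
    simp
  have e₂ : (2 * n) * eulerD h = 2 * n * (lam A * (P ^ (k + 1) * constLoop (beta n A)).trace)
      + (k + 1) * h + 2 * n * laurentD D r₂ := by
    have hb := trace_mul_pow_beta (lam A) JB_eq hQJ k
    rw [hpow, h₂, eulerD_JB, hU, Matrix.map_add _ (map_add _), eulerD_JB, eulerD_constLoop,
      add_zero, hh, ← hb, constLoop_beta, Matrix.trace_mul_comm (P ^ (k + 1)), smul_mul_assoc,
      Matrix.trace_smul, smul_eq_mul]
    ring
  have c₁ := congrArg (fun f : LaurentSeries A => f.coeff 0) e₁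
  have c₂ := congrArg (fun f : LaurentSeries A => f.coeff 0) e₂
  simp only [HahnSeries.coeff_add, laurentD_coeff] at c₁
  have t₀ : (constLoop (toV fun i => δ (u i)) * P ^ (k + 1)).trace.coeff 0
      = (toV (fun i => δ (u i)) * lamCoeff (P ^ (k + 1)) 0).trace := by
    rw [← lamCoeff_constLoop_mul, trace_lamCoeff, neg_zero]
  rw [t₀] at c₁
  have hnat (m : ℕ) (f : LaurentSeries A) : ((m : LaurentSeries A) * f).coeff 0 = m * f.coeff 0 := by
    rw [← nsmul_eq_mul, HahnSeries.coeff_nsmul, Pi.smul_apply, nsmul_eq_mul]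
  -- The `λ^0` coefficient of an Euler derivative is zero. Hence `(k + 1) h_0` equals `-2n
  -- tr(P_{k+1,-1} β)` up to a total derivative, and applying `δ` finishes the comparison.
  have c₂' : 0 = (2 * n : A) * (lamCoeff (P ^ (k + 1)) (-1) * beta n A).trace
      + (k + 1) * h.coeff 0 + 2 * n * D (r₂.coeff 0) := by
    have t1 : (lam A * (P ^ (k + 1) * constLoop (beta n A)).trace).coeff 0
        = (lamCoeff (P ^ (k + 1)) (-1) * beta n A).trace := by
      rw [← lamCoeff_mul_constLoop, trace_lamCoeff, lam, HahnSeries.coeff_single_mul, one_mul]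
      rfl
    have := hnat (2 * n)
    have h' := hnat (k + 1)
    push_cast at this h'
    simp only [HahnSeries.coeff_add, this, h', t1, eulerD_coeff, laurentD_coeff, zero_smul,
      neg_zero, mul_zero] at c₂
    exact c₂
  have c₃ := congrArg δ c₂'
  simp only [map_zero, map_add, Derivation.leibniz, Derivation.map_natCast, smul_eq_mul, mul_zero,
    add_zero, Derivation.map_one_eq_zero] at c₃
  refine ⟨-((k + 1) * r₁.coeff 0) - 2 * n * δ (r₂.coeff 0), ?_⟩
  simp only [map_sub, map_neg, map_add, Derivation.leibniz, Derivation.map_natCast, smul_eq_mul,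
    mul_zero, add_zero, Derivation.map_one_eq_zero, hδ]
  have h2 : δ (2 : A) = 0 := by exact_mod_cast δ.map_natCast 2
  have h2' : D (2 : A) = 0 := by exact_mod_cast D.map_natCast 2
  rw [h2] at c₃
  rw [h2', ← sub_eq_zero]
  rw [c₁] at c₃
  linear_combination -c₃

lemma comm_pow {R : Type*} [CommRing R] [Algebra ℝ R] (D : Derivation ℝ R R) {U P : Mat n R}
    (h : P.map D + (U * P - P * U) = 0) (k : ℕ) :
    (P ^ k).map D + (U * P ^ k - P ^ k * U) = 0 := by
  induction k with
  | zero =>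
    have : (1 : Mat n R).map D = 0 := by
      ext r s
      simp only [Matrix.map_apply, Matrix.one_apply, Matrix.zero_apply]
      split_ifs <;> simp
    simp [this]
  | succ k ih =>
    calc (P ^ (k + 1)).map D + (U * P ^ (k + 1) - P ^ (k + 1) * U)
        = ((P ^ k).map D + (U * P ^ k - P ^ k * U)) * P
          + P ^ k * (P.map D + (U * P - P * U)) := by
          rw [pow_succ, matrix_map_mul]; noncomm_ring
      _ = 0 := by rw [ih, h, zero_mul, mul_zero, add_zero]

/-- The `λ^i` coefficient of `[∂ + J_B + u, P^k] = 0`, where `λ β` alone shifts the index. This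
recursion links the two brackets. -/
lemma IsResolvent.covD_lamCoeff (hP : IsResolvent D u P) (k : ℕ) (i : ℤ) :
    covD D u (lamCoeff (P ^ k) i)
      = lamCoeff (P ^ k) (i - 1) * beta n A - beta n A * lamCoeff (P ^ k) (i - 1) := by
  have h := congrArg (fun X => lamCoeff X i) (comm_pow (laurentD D) hP.comm k)
  have hU : JB n A + constLoop (toV u)
      = constLoop (b n A + toV u) + lam A • constLoop (beta n A) := by
    have : constLoop (b n A + toV u) = constLoop (b n A) + constLoop (toV u) := by
      ext r s : 2; simp [constLoop]
    rw [JB, this]; abel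
  rw [hU] at h
  simp only [add_mul, mul_add, smul_mul_assoc, mul_smul_comm, lamCoeff_add, lamCoeff_sub,
    lamCoeff_lam_smul, lamCoeff_constLoop_mul, lamCoeff_mul_constLoop] at h
  have h0 : lamCoeff (0 : Mat n (LaurentSeries A)) i = 0 := by ext; simp [lamCoeff]
  rw [h0] at h
  rw [covD, ← sub_eq_zero, ← h, ← loopD_eq, lamCoeff_loopD]
  noncomm_ring

lemma IsResolvent.inSo_lamCoeff (hP : IsResolvent D u P) {k : ℕ} (hk : Odd k) (i : ℤ) :
    InSo (lamCoeff (P ^ k) i) := by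
  have h1 : soAdj P = -P := by
    ext r s j
    have h := congrFun (congrFun ((inSo_iff _).1 (hP.mem_so (-j))) r) s
    simp only [soAdj_apply, lamCoeff, Matrix.map_apply, neg_neg, Matrix.neg_apply] at h
    rw [soAdj_apply, Matrix.neg_apply, HahnSeries.coeff_neg, ← h]
    rcases neg_one_pow_eq_or (LaurentSeries A) ((r : ℕ) + s) with h' | h' <;>
    rcases Nat.even_or_odd ((r : ℕ) + s) with h2 | h2 <;> simp [h2.neg_one_pow]
  rw [inSo_iff]
  have h2 := InSo.pow_odd h1 hk
  have h3 := congrArg (fun X => lamCoeff X i) h2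
  ext r s
  have h4 := congrFun (congrFun h3 r) s
  simp only [soAdj_apply, lamCoeff, Matrix.map_apply, Matrix.neg_apply,
    HahnSeries.coeff_neg] at h4 ⊢
  rw [← h4]
  rcases Nat.even_or_odd ((r : ℕ) + s) with h2 | h2 <;> simp [h2.neg_one_pow]

end

/-! ### The cyclic element and the dressing recursion -/

section

variable {n : ℕ} {A : Type*} [CommRing A] [Algebra ℝ A]

/-! ### The cyclic element -/

/-- The cyclic element `b + β`. -/
def cyc (n : ℕ) (A : Type*) [CommRing A] [Algebra ℝ A] : Mat n A := b n A + beta n A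

lemma cyc_mulVec_of_lt (j : ℕ) (hj : j + 1 < 2 * n) :
    cyc n A *ᵥ Pi.single ⟨j, by omega⟩ 1 = Pi.single ⟨j + 1, by omega⟩ 1 := by
  ext r
  have hβ : beta n A r ⟨j, by omega⟩ = 0 := by
    rw [beta_apply, if_neg]
    simp only
    omega
  rw [Matrix.mulVec_single_one, Matrix.col_apply, cyc, Matrix.add_apply, b_apply, hβ, add_zero,
    Pi.single_apply]
  simp only [Fin.ext_iff]

lemma cyc_mulVec_penultimate (hn : 1 ≤ n) :
    cyc n A *ᵥ Pi.single ⟨2 * n - 1, by omega⟩ 1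
      = Pi.single (⟨2 * n, by omega⟩ : Fin (2 * n + 1)) 1 + (1 / 2 : ℝ) • (Pi.single 0 1 : Fin (2 * n + 1) → A) := by
  ext r
  rw [Matrix.mulVec_single_one, Matrix.col_apply, cyc, Matrix.add_apply, b_apply, beta_apply,
    Pi.add_apply, Pi.smul_apply, Pi.single_apply, Pi.single_apply, Algebra.smul_def, mul_ite,
    mul_one, mul_zero]
  simp only [Fin.ext_iff, Fin.val_zero]
  congr 2
  · apply propext; omega
  · apply propext; omega

lemma cyc_mulVec_last (hn : 1 ≤ n) :
    cyc n A *ᵥ Pi.single ⟨2 * n, by omega⟩ 1 = (1 / 2 : ℝ) • (Pi.single ⟨1, by omega⟩ 1 : Fin (2 * n + 1) → A) := by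
  ext r
  have hb : b n A r ⟨2 * n, by omega⟩ = 0 := by
    rw [b_apply, if_neg]
    simp only
    omega
  rw [Matrix.mulVec_single_one, Matrix.col_apply, cyc, Matrix.add_apply, hb, beta_apply,
    Pi.smul_apply, Pi.single_apply, Algebra.smul_def, mul_ite, mul_one, mul_zero, zero_add]
  simp only [Fin.ext_iff]
  congr 1
  apply propext
  rw [and_true]
  omega

lemma cyc_pow_mulVec (j : ℕ) (hj : j < 2 * n) :
    cyc n A ^ j *ᵥ Pi.single 0 1 = Pi.single ⟨j, by omega⟩ 1 := by
  induction j with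
  | zero => rw [pow_zero, Matrix.one_mulVec]; rfl
  | succ j ih =>
    rw [pow_succ', ← Matrix.mulVec_mulVec, ih (by omega), cyc_mulVec_of_lt j hj]

lemma cyc_pow_two_mul_mulVec (hn : 1 ≤ n) : cyc n A ^ (2 * n) *ᵥ Pi.single 0 1
    = Pi.single (⟨2 * n, by omega⟩ : Fin (2 * n + 1)) 1 + (1 / 2 : ℝ) • (Pi.single 0 1 : Fin (2 * n + 1) → A) := by
  obtain ⟨m, hm⟩ : ∃ m, 2 * n = m + 1 := ⟨2 * n - 1, by omega⟩
  have h := cyc_pow_mulVec (n := n) (A := A) (2 * n - 1) (by omega)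
  rw [← cyc_mulVec_penultimate hn, ← h, Matrix.mulVec_mulVec, ← pow_succ']
  congr 2
  omega

/-- Counting from 0, `L` moves `e_0, e_1, …` up to `e_{2n-1}`, then `L e_{2n-1} = e_{2n} + e_0/2`
and `L e_{2n} = e_1/2`. So `L^{2n+1} e_0 = e_1/2 + e_1/2 = L e_0`, and the vectors `L^k e_0` span.
-/
lemma cyc_pow (hn : 1 ≤ n) : cyc n A ^ (2 * n + 1) = cyc n A := by
  have h0 : cyc n A ^ (2 * n + 1) *ᵥ Pi.single 0 1 = cyc n A *ᵥ Pi.single 0 1 := by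
    have h1 := cyc_pow_mulVec (n := n) (A := A) 1 (by omega)
    rw [pow_one] at h1
    rw [pow_succ', ← Matrix.mulVec_mulVec, cyc_pow_two_mul_mulVec hn, Matrix.mulVec_add,
      cyc_mulVec_last hn, Matrix.mulVec_smul, h1, ← add_smul]
    norm_num
  have hk (k : ℕ) : cyc n A ^ (2 * n + 1) *ᵥ (cyc n A ^ k *ᵥ Pi.single 0 1)
      = cyc n A *ᵥ (cyc n A ^ k *ᵥ Pi.single 0 1) := by
    rw [Matrix.mulVec_mulVec, ← pow_add, add_comm _ k, pow_add, ← Matrix.mulVec_mulVec, h0,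
      Matrix.mulVec_mulVec, Matrix.mulVec_mulVec, ← pow_succ, ← pow_succ']
  have hcol (j : Fin (2 * n + 1)) :
      cyc n A ^ (2 * n + 1) *ᵥ Pi.single j 1 = cyc n A *ᵥ Pi.single j 1 := by
    obtain ⟨j, hj⟩ := j
    by_cases hj' : j < 2 * n
    · rw [← cyc_pow_mulVec j hj', hk]
    · obtain rfl : j = 2 * n := by omega
      have e : (Pi.single ⟨2 * n, by omega⟩ 1 : Fin (2 * n + 1) → A)
          = cyc n A ^ (2 * n) *ᵥ Pi.single 0 1 - (1 / 2 : ℝ) • (Pi.single 0 1 : Fin (2 * n + 1) → A) := by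
        rw [cyc_pow_two_mul_mulVec hn, add_sub_cancel_right]
      rw [e, Matrix.mulVec_sub, Matrix.mulVec_sub, hk, Matrix.mulVec_smul, Matrix.mulVec_smul, h0]
  ext r s
  have := congrFun (hcol s) r
  rwa [Matrix.mulVec_single_one, Matrix.mulVec_single_one] at this

/-- A strictly lower triangular matrix that commutes with the cyclic element vanishes. -/
lemma eq_zero_of_commute_cyc (hn : 1 ≤ n) {W : Mat n A}
    (hW : ∀ r s : Fin (2 * n + 1), r ≤ s → W r s = 0) (hc : cyc n A * W = W * cyc n A) : W = 0 := by
  have hβ (r s : Fin (2 * n + 1)) (hr : 2 ≤ (r : ℕ)) : (beta n A * W) r s = 0 := by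
    rw [Matrix.mul_apply]
    refine Finset.sum_eq_zero fun k _ => ?_
    rw [beta_apply, if_neg (by omega), zero_mul]
  have hβ0 (s : Fin (2 * n + 1)) : (beta n A * W) 0 s
      = algebraMap ℝ A (1 / 2) * W ⟨2 * n - 1, by omega⟩ s := by
    rw [Matrix.mul_apply, Finset.sum_eq_single ⟨2 * n - 1, by omega⟩]
    · rw [beta_apply, if_pos (by simp; omega)]
    · intro k _ hk
      rw [beta_apply, if_neg, zero_mul]
      intro h
      rw [Ne, Fin.ext_iff] at hk
      simp at h hk
      omega
    · simp
  have hβ1 (s : Fin (2 * n + 1)) : (beta n A * W) ⟨1, by omega⟩ s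
      = algebraMap ℝ A (1 / 2) * W (Fin.last _) s := by
    rw [Matrix.mul_apply, Finset.sum_eq_single (Fin.last _)]
    · rw [beta_apply, if_pos (by simp)]
    · intro k _ hk
      rw [beta_apply, if_neg, zero_mul]
      intro h
      rw [Ne, Fin.ext_iff] at hk
      simp at h hk
      omega
    · simp
  have half {x : A} (h : algebraMap ℝ A (1 / 2) * x = 0) : x = 0 := by
    rw [← Algebra.smul_def] at h
    simpa using congrArg ((2 : ℝ) • ·) h
  have hrow {r : Fin (2 * n + 1)} (h : ∀ s, W r s = 0) (s : Fin (2 * n + 1)) :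
      (W * cyc n A) r s = 0 := by
    rw [Matrix.mul_apply]
    exact Finset.sum_eq_zero fun k _ => by rw [h, zero_mul]
  -- Row 0 controls all others: comparing `L W` with `W L` in row 0 kills row `2n-1`, in row `i+1 ≥
  -- 2` it kills row `i`, and in row 1 finally the last row.
  have h0 : ∀ s, W 0 s = 0 := fun s => hW 0 s (Fin.zero_le _)
  have hpen : ∀ s, W ⟨2 * n - 1, by omega⟩ s = 0 := by
    intro s
    apply half
    rw [← hβ0, ← hrow h0 s, ← hc, cyc, add_mul, Matrix.add_apply, b_mul_zero, zero_add]
  have hmid (m : ℕ) : ∀ i : ℕ, ∀ hi : i < 2 * n, 1 ≤ i → 2 * n - 1 - m ≤ i →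
      ∀ s, W ⟨i, by omega⟩ s = 0 := by
    induction m with
    | zero =>
      intro i hi _ him s
      obtain rfl : i = 2 * n - 1 := by omega
      exact hpen s
    | succ m ih =>
      intro i hi h1 him s
      by_cases h : i = 2 * n - 1
      · subst h; exact hpen s
      · have hr := hrow (ih (i + 1) (by omega) (by omega) (by omega)) s
        rw [← hc, cyc, add_mul, Matrix.add_apply, b_mul_succ, hβ _ _ (by simp; omega),
          add_zero] at hr
        exact hr
  have hlast : ∀ s, W (Fin.last _) s = 0 := by
    intro s
    apply half
    have h1 := hmid (2 * n) 1 (by omega) le_rfl (by omega)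
    rw [← hβ1, ← hrow h1 s, ← hc, cyc, add_mul, Matrix.add_apply, b_mul_succ _ 0 (by omega)]
    rw [show W ⟨0, by omega⟩ s = 0 from h0 s, zero_add]
  ext ⟨i, hi⟩ s
  by_cases hi0 : i = 0
  · subst hi0; exact h0 s
  · by_cases hil : i = 2 * n
    · subst hil; exact hlast s
    · exact hmid (2 * n) i (by omega) (by omega) (by omega) s

/-! ### Homogeneous matrices -/

/-- All entries `X_{rs}` with `r - s ≢ c` modulo `2n` vanish. -/
def Homog {n : ℕ} {A : Type*} [CommRing A] (c : ℤ) (X : Mat n A) : Prop :=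
  ∀ r s : Fin (2 * n + 1), ¬ (2 * n : ℤ) ∣ (r : ℤ) - s - c → X r s = 0

section Homog

omit [Algebra ℝ A]

variable {c d : ℤ} {X Y : Mat n A}

lemma Homog.add (hX : Homog c X) (hY : Homog c Y) : Homog c (X + Y) := fun r s h => by
  rw [Matrix.add_apply, hX r s h, hY r s h, add_zero]

lemma Homog.neg (hX : Homog c X) : Homog c (-X) := fun r s h => by
  rw [Matrix.neg_apply, hX r s h, neg_zero]

lemma Homog.sub (hX : Homog c X) (hY : Homog c Y) : Homog c (X - Y) := fun r s h => by
  rw [Matrix.sub_apply, hX r s h, hY r s h, sub_zero]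

lemma Homog.smul {R : Type*} [Monoid R] [DistribMulAction R A] (a : R) (hX : Homog c X) :
    Homog c (a • X) := fun r s h => by
  rw [Matrix.smul_apply, hX r s h, smul_zero]

lemma Homog.sum {ι : Type*} (s : Finset ι) {X : ι → Mat n A} (hX : ∀ i ∈ s, Homog c (X i)) :
    Homog c (∑ i ∈ s, X i) := fun r t h => by
  rw [Matrix.sum_apply]
  exact Finset.sum_eq_zero fun i hi => hX i hi r t h

lemma Homog.mul (hX : Homog c X) (hY : Homog d Y) : Homog (c + d) (X * Y) := fun r s h => by
  rw [Matrix.mul_apply]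
  refine Finset.sum_eq_zero fun k _ => ?_
  by_cases h1 : (2 * n : ℤ) ∣ (r : ℤ) - k - c
  · rw [hY k s fun h2 => h ?_, mul_zero]
    rw [show (r : ℤ) - s - (c + d) = ((r : ℤ) - k - c) + ((k : ℤ) - s - d) by ring]
    exact dvd_add h1 h2
  · rw [hX r k h1, zero_mul]

lemma Homog.congr (hX : Homog c X) (h : (2 * n : ℤ) ∣ d - c) : Homog d X := fun r s h1 =>
  hX r s fun h2 => h1 (by
    rw [show (r : ℤ) - s - d = ((r : ℤ) - s - c) - (d - c) by ring]
    exact dvd_sub h2 h)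

lemma Homog.of_eq (hX : Homog c X) (h : c = d) : Homog d X := h ▸ hX

lemma homog_one : Homog 0 (1 : Mat n A) := fun r s h => by
  rw [Matrix.one_apply, if_neg]
  rintro rfl
  simp at h

lemma Homog.pow (hX : Homog c X) (k : ℕ) : Homog (k * c) (X ^ k) := by
  induction k with
  | zero => simpa using homog_one
  | succ k ih => rw [pow_succ]; exact (ih.mul hX).of_eq (by push_cast; ring)

end Homog

lemma homog_cyc : Homog 1 (cyc n A) := fun r s h => by
  rw [cyc, Matrix.add_apply, b_apply, beta_apply, if_neg, if_neg, zero_add]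
  · intro h'
    exact h ⟨-1, by omega⟩
  · intro h'
    exact h ⟨0, by omega⟩

/-- `gl = im (ad (b + β)) ⊕ ker (ad (b + β))`, compatibly with the grading. -/
lemma exists_split (hn : 1 ≤ n) (c : ℤ) (Y : Mat n A) (hY : Homog c Y) :
    ∃ p : Mat n A × Mat n A, Homog (c - 1) p.1 ∧ Homog c p.2 ∧
      Y = cyc n A * p.1 - p.1 * cyc n A + p.2 ∧ cyc n A * p.2 = p.2 * cyc n A := by
  set L := cyc n A with hL
  have hLc : Homog 1 L := homog_cyc
  have hLp : L ^ (2 * n + 1) = L := cyc_pow hn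
  -- `E` is idempotent and `K` inverts `L` on its range. The blocks `E Y (1-E)` and `(1-E) Y E` are
  -- commutators with `L`, the block `(1-E) Y (1-E)` is annihilated by `L` on both sides, and `Z = E
  -- Y E` differs by a commutator from its average over conjugation by `L`, which has period `2n`
  -- there.
  set E := L ^ (2 * n) with hE
  set K := L ^ (2 * n - 1) with hK
  have hEc : Homog 0 E := (hLc.pow (2 * n)).congr ⟨-1, by push_cast; ring⟩
  have hKc : Homog (-1) K := (hLc.pow (2 * n - 1)).congr ⟨-1, by
    rw [Nat.cast_sub (by omega)]; push_cast; ring⟩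
  have hEL : E * L = L := by rw [hE, ← pow_succ, hLp]
  have hLE : L * E = L := by rw [hE, ← pow_succ', hLp]
  have hLK : L * K = E := by rw [hE, hK, ← pow_succ']; congr 1; omega
  have hKL : K * L = E := by rw [hE, hK, ← pow_succ]; congr 1; omega
  have hEE : E * E = E := by
    nth_rewrite 2 [← hLK]
    rw [← mul_assoc, hEL, hLK]
  set Z := E * Y * E with hZ
  have hZc : Homog c Z := ((hEc.mul hY).mul hEc).of_eq (by ring)
  set H : ℕ → Mat n A := fun a => L ^ a * Z * L ^ (2 * n - a) with hH
  have h1E : Homog 0 (1 - E) := homog_one.sub hEc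
  refine ⟨(K * Y * (1 - E) - (1 - E) * Y * K - (1 / (2 * n) : ℝ) •
    ∑ a ∈ Finset.range (2 * n), ∑ k ∈ Finset.range a, L ^ k * Z * L ^ (2 * n - 1 - k),
    (1 - E) * Y * (1 - E) + (1 / (2 * n) : ℝ) • ∑ a ∈ Finset.range (2 * n), H a), ?_, ?_, ?_, ?_⟩
  · refine Homog.sub (Homog.sub ?_ ?_) (Homog.smul _ (Homog.sum _ fun a ha => Homog.sum _
      fun k hk => ?_))
    · exact ((hKc.mul hY).mul h1E).of_eq (by ring)
    · exact ((h1E.mul hY).mul hKc).of_eq (by ring)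
    · rw [Finset.mem_range] at ha hk
      refine (((hLc.pow k).mul hZc).mul (hLc.pow (2 * n - 1 - k))).congr ⟨-1, ?_⟩
      rw [Nat.cast_sub (by omega), Nat.cast_sub (by omega)]
      push_cast; ring
  · refine Homog.add ?_ (Homog.smul _ (Homog.sum _ fun a ha => ?_))
    · exact ((h1E.mul hY).mul h1E).of_eq (by ring)
    · rw [Finset.mem_range] at ha
      refine (((hLc.pow a).mul hZc).mul (hLc.pow (2 * n - a))).congr ⟨-1, ?_⟩
      rw [Nat.cast_sub (by omega)]
      push_cast; ring
  -- `H a - Z` telescopes, each difference `H (k+1) - H k` being a commutator with `L`.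
  · have hin (a : ℕ) (ha : a ∈ Finset.range (2 * n)) :
        L * (∑ k ∈ Finset.range a, L ^ k * Z * L ^ (2 * n - 1 - k))
          - (∑ k ∈ Finset.range a, L ^ k * Z * L ^ (2 * n - 1 - k)) * L = H a - Z := by
      rw [Finset.mem_range] at ha
      have h0 : H 0 = Z := by
        simp only [hH, pow_zero, one_mul, Nat.sub_zero, hZ]
        rw [← hE, mul_assoc, hEE]
      have hs : H a - Z = ∑ k ∈ Finset.range a, (H (k + 1) - H k) := by
        rw [Finset.sum_range_sub, h0]
      rw [hs, Finset.mul_sum, Finset.sum_mul, ← Finset.sum_sub_distrib]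
      refine Finset.sum_congr rfl fun k hk => ?_
      rw [Finset.mem_range] at hk
      simp only [hH]
      rw [mul_assoc _ (L ^ (2 * n - 1 - k)), ← pow_succ, ← mul_assoc, ← mul_assoc, ← pow_succ',
        show 2 * n - 1 - k + 1 = 2 * n - k by omega, show 2 * n - 1 - k = 2 * n - (k + 1) by omega]
    have hsum : L * (∑ a ∈ Finset.range (2 * n), ∑ k ∈ Finset.range a,
        L ^ k * Z * L ^ (2 * n - 1 - k)) - (∑ a ∈ Finset.range (2 * n), ∑ k ∈ Finset.range a,
        L ^ k * Z * L ^ (2 * n - 1 - k)) * L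
        = ∑ a ∈ Finset.range (2 * n), H a - (2 * n : ℝ) • Z := by
      rw [Finset.mul_sum, Finset.sum_mul, ← Finset.sum_sub_distrib, Finset.sum_congr rfl hin,
        Finset.sum_sub_distrib, Finset.sum_const, Finset.card_range, ← Nat.cast_smul_eq_nsmul ℝ]
      push_cast
      rfl
    have hn0 : (2 * n : ℝ) ≠ 0 := by positivity
    set S := ∑ a ∈ Finset.range (2 * n), ∑ k ∈ Finset.range a, L ^ k * Z * L ^ (2 * n - 1 - k)
    simp only
    have hA1 : L * (K * Y * (1 - E)) - K * Y * (1 - E) * L = E * Y * (1 - E) := by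
      have : (1 - E) * L = 0 := by rw [sub_mul, hEL, one_mul, sub_self]
      rw [mul_assoc _ (1 - E) L, this, mul_zero, sub_zero, ← mul_assoc, ← mul_assoc, hLK]
    have hA2 : L * ((1 - E) * Y * K) - (1 - E) * Y * K * L = -((1 - E) * Y * E) := by
      have : L * (1 - E) = 0 := by rw [mul_sub, hLE, mul_one, sub_self]
      rw [mul_assoc _ K L, hKL, ← mul_assoc, ← mul_assoc, this, zero_mul, zero_mul, zero_sub]
    have hA3 : L * ((1 / (2 * n) : ℝ) • S) - ((1 / (2 * n) : ℝ) • S) * L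
        = (1 / (2 * n) : ℝ) • ∑ a ∈ Finset.range (2 * n), H a - Z := by
      rw [mul_smul_comm, smul_mul_assoc, ← smul_sub, hsum, smul_sub, smul_smul,
        one_div_mul_cancel hn0, one_smul]
    calc Y = E * Y * (1 - E) - -((1 - E) * Y * E) + (E * Y * E) + (1 - E) * Y * (1 - E) := by
          noncomm_ring
      _ = _ := by
        rw [← hA1, ← hA2, ← hZ]
        have : Z = (1 / (2 * n) : ℝ) • ∑ a ∈ Finset.range (2 * n), H a
          - (L * ((1 / (2 * n) : ℝ) • S) - ((1 / (2 * n) : ℝ) • S) * L) := by rw [hA3]; abel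
        nth_rewrite 1 [this]
        simp only [mul_sub, sub_mul]
        abel
  · simp only
    have hB1 : L * ((1 - E) * Y * (1 - E)) = 0 := by
      have : L * (1 - E) = 0 := by rw [mul_sub, hLE, mul_one, sub_self]
      rw [← mul_assoc, ← mul_assoc, this, zero_mul, zero_mul]
    have hB2 : (1 - E) * Y * (1 - E) * L = 0 := by
      have : (1 - E) * L = 0 := by rw [sub_mul, hEL, one_mul, sub_self]
      rw [mul_assoc, this, mul_zero]
    rw [mul_add, add_mul, hB1, hB2, mul_smul_comm, smul_mul_assoc, Finset.mul_sum, Finset.sum_mul]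
    congr 2
    have h1 := Finset.sum_range_succ (fun a => L ^ a * Z * L ^ (2 * n + 1 - a)) (2 * n)
    rw [Finset.sum_range_succ'] at h1
    have hEZ : E * Z = Z := by rw [hZ, ← mul_assoc, ← mul_assoc, hEE]
    have hend : L ^ (2 * n) * Z * L ^ (2 * n + 1 - 2 * n)
        = L ^ 0 * Z * L ^ (2 * n + 1 - 0) := by
      rw [Nat.sub_zero, hLp, ← hE, hEZ, pow_zero, one_mul, Nat.add_sub_cancel_left, pow_one]
    rw [hend] at h1
    have h2 := add_right_cancel h1
    calc ∑ a ∈ Finset.range (2 * n), L * H a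
        = ∑ a ∈ Finset.range (2 * n), L ^ (a + 1) * Z * L ^ (2 * n + 1 - (a + 1)) := by
          refine Finset.sum_congr rfl fun a _ => ?_
          simp only [hH]
          rw [← mul_assoc, ← mul_assoc, ← pow_succ', Nat.add_sub_add_right]
      _ = ∑ a ∈ Finset.range (2 * n), H a * L := by
          rw [h2]
          refine Finset.sum_congr rfl fun a ha => ?_
          rw [Finset.mem_range] at ha
          simp only [hH]
          rw [mul_assoc _ _ L, ← pow_succ, show 2 * n - a + 1 = 2 * n + 1 - a by omega]

/-! ### The dressing recursion -/

lemma exists_strong_rec {R : Type*} (G : ℕ → (ℕ → R) → R)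
    (hG : ∀ d g g', (∀ m < d, g m = g' m) → G d g = G d g') [Zero R] :
    ∃ g : ℕ → R, ∀ d, g d = G d g := by
  let Φ : ∀ d : ℕ, (∀ m : ℕ, m < d → R) → R := fun d rec =>
    G d fun m => if h : m < d then rec m h else 0
  refine ⟨Nat.lt_wfRel.wf.fix Φ, fun d => ?_⟩
  rw [WellFounded.fix_eq]
  exact hG _ _ _ fun m hm => dif_pos hm

/-- The part of `u` of degree `-a`. -/
def uPart (u : Fin n → A) (a : ℕ) : Mat n A :=
  Matrix.of fun r s => if (s : ℕ) = r + a then toV u r s else 0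

omit [Algebra ℝ A] in
lemma homog_uPart (u : Fin n → A) (a : ℕ) : Homog (-a : ℤ) (uPart u a) := fun r s h => by
  rw [uPart, Matrix.of_apply, if_neg]
  intro h'
  exact h ⟨0, by omega⟩

/-- The coefficients of `(∂ + zL + u) w = w (∂ + zL + f)` with `w = ∑ w_d z^{-d}` and `f = ∑ f_d
z^{-d}`. In degree `-d` the equation reads `[L, -w_{d+1}] + f_d =` terms already known, which
`exists_split` solves. -/
lemma exists_dressing (hn : 1 ≤ n) (D : Derivation ℝ A A) (u : Fin n → A) :
    ∃ w f : ℕ → Mat n A, w 0 = 1 ∧ (∀ d : ℕ, Homog (-d : ℤ) (w d)) ∧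
      (∀ d, cyc n A * f d = f d * cyc n A) ∧
      ∀ d, (w d).map D + cyc n A * w (d + 1) + ∑ x ∈ Finset.HasAntidiagonal.antidiagonal d, uPart u x.1 * w x.2
        = w (d + 1) * cyc n A + ∑ x ∈ Finset.HasAntidiagonal.antidiagonal d, w x.1 * f x.2 := by
  choose! S hS1 hS2 hS3 hS4 using fun (c : ℤ) (Y : Mat n A) => exists_split hn c Y
  -- `g d` is the known term in degree `-d`; its two components give `-w_{d+1}` and `f_d`. Thus
  -- `w_d` uses `g` only below `d`, and the recursion is well founded.
  let W : (ℕ → Mat n A) → ℕ → Mat n A := fun g m => Nat.casesOn m 1 fun k => -(S (-k) (g k)).1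
  let F : (ℕ → Mat n A) → ℕ → Mat n A := fun g k => (S (-k) (g k)).2
  have hWc (d : ℕ) (g g' : ℕ → Mat n A) (h : ∀ m < d, g m = g' m) (m : ℕ) (hm : m ≤ d) :
      W g m = W g' m := by
    cases m with
    | zero => rfl
    | succ m => simp only [W]; rw [h m (by omega)]
  obtain ⟨g, hg⟩ := exists_strong_rec (R := Mat n A)
    (fun d g => (W g d).map D + ∑ x ∈ Finset.HasAntidiagonal.antidiagonal d, uPart u x.1 * W g x.2
      - ∑ k ∈ Finset.range d, W g (d - k) * F g k) (by
    intro d g g' h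
    rw [hWc d g g' h d le_rfl]
    congr 1
    · congr 1
      refine Finset.sum_congr rfl fun x hx => ?_
      rw [hWc d g g' h x.2 (by have := Finset.HasAntidiagonal.mem_antidiagonal.1 hx; omega)]
    · refine Finset.sum_congr rfl fun k hk => ?_
      rw [hWc d g g' h (d - k) (by omega)]
      simp only [F]
      rw [h k (Finset.mem_range.1 hk)])
  have hgc (d : ℕ) : Homog (-d : ℤ) (g d) := by
    induction d using Nat.strong_induction_on with
    | _ d ih =>
      have hW (m : ℕ) (hm : m ≤ d) : Homog (-m : ℤ) (W g m) := by
        cases m with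
        | zero => exact homog_one.of_eq (by simp)
        | succ k => exact (hS1 _ _ (ih k (by omega))).neg.of_eq (by push_cast; ring)
      rw [hg d]
      refine Homog.sub (Homog.add (fun r s h => ?_) (Homog.sum _ fun x hx => ?_))
        (Homog.sum _ fun k hk => ?_)
      · rw [Matrix.map_apply, hW d le_rfl r s h, map_zero]
      · have := Finset.HasAntidiagonal.mem_antidiagonal.1 hx
        exact ((homog_uPart u x.1).mul (hW x.2 (by omega))).of_eq (by omega)
      · have := Finset.mem_range.1 hk
        exact ((hW (d - k) (by omega)).mul (hS2 _ _ (ih k this))).of_eq (by omega)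
  refine ⟨W g, F g, rfl, fun d => ?_, fun d => hS4 _ _ (hgc d), fun d => ?_⟩
  · cases d with
    | zero => exact homog_one.of_eq (by simp)
    | succ k => exact (hS1 _ _ (hgc k)).neg.of_eq (by push_cast; ring)
  · have h3 := hS3 _ _ (hgc d)
    have hlast : ∑ x ∈ Finset.HasAntidiagonal.antidiagonal d, W g x.1 * F g x.2
        = ∑ k ∈ Finset.range d, W g (d - k) * F g k + F g d := by
      rw [← Finset.Nat.sum_antidiagonal_swap, Finset.Nat.sum_antidiagonal_eq_sum_range_succ_mk,
        Finset.sum_range_succ]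
      simp [W]
    rw [hlast]
    have e1 : W g (d + 1) = -(S (-d) (g d)).1 := rfl
    have e2 : F g d = (S (-d) (g d)).2 := rfl
    have h4 := hg d
    rw [h3] at h4
    rw [e1, e2]
    generalize (S (-d) (g d)).1 = T at *
    generalize (S (-d) (g d)).2 = f at *
    rw [← sub_eq_zero] at h4 ⊢
    rw [← neg_eq_zero, ← h4]
    noncomm_ring

end

/-! ### The principal grading of loops and rigidity of the resolvent equation -/

section

variable {n : ℕ} {A : Type*} [CommRing A]

/-! ### Regrading: `λ = z^{2n}` and conjugation by `z^ρ` -/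

/-- The substitution `λ = z^{2n}`. -/
def scaleHom (A : Type*) [CommRing A] (hn : 1 ≤ n) : LaurentSeries A →+* LaurentSeries A :=
  HahnSeries.embDomainRingHom (AddMonoidHom.mulLeft (2 * n : ℤ))
    (fun x y h => by
      have h2 : (2 * n : ℤ) ≠ 0 := by omega
      exact mul_left_cancel₀ h2 h)
    (fun x y => by
      have h2 : (0 : ℤ) < 2 * n := by omega
      exact mul_le_mul_iff_right₀ h2)

lemma scaleHom_coeff (hn : 1 ≤ n) (f : LaurentSeries A) (k : ℤ) :
    (scaleHom A hn f).coeff (2 * n * k) = f.coeff k :=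
  HahnSeries.embDomain_mk_coeff (f := fun k : ℤ => (2 * n : ℤ) * k) _ _

lemma scaleHom_coeff_of_not_dvd (hn : 1 ≤ n) (f : LaurentSeries A) {k : ℤ}
    (hk : ¬ (2 * n : ℤ) ∣ k) : (scaleHom A hn f).coeff k = 0 :=
  HahnSeries.embDomain_of_notMem_range fun ⟨j, hj⟩ => hk ⟨j, hj.symm⟩

lemma scaleHom_C (hn : 1 ≤ n) (a : A) : scaleHom A hn (HahnSeries.C a) = HahnSeries.C a :=
  HahnSeries.embDomainRingHom_C

lemma scaleHom_lam (hn : 1 ≤ n) : scaleHom A hn (lam A) = HahnSeries.single (-(2 * n : ℤ)) 1 := by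
  refine (HahnSeries.embDomain_single).trans ?_
  congr 1
  simp

lemma scaleHom_laurentD [Algebra ℝ A] (hn : 1 ≤ n) (D : Derivation ℝ A A) (f : LaurentSeries A) :
    scaleHom A hn (laurentD D f) = laurentD D (scaleHom A hn f) := by
  ext k
  rw [laurentD_coeff]
  by_cases hk : (2 * n : ℤ) ∣ k
  · obtain ⟨j, rfl⟩ := hk
    rw [scaleHom_coeff, scaleHom_coeff, laurentD_coeff]
  · rw [scaleHom_coeff_of_not_dvd hn _ hk, scaleHom_coeff_of_not_dvd hn _ hk, map_zero]

lemma single_mul_single_neg (i : ℤ) :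
    (HahnSeries.single i (1 : A) : LaurentSeries A) * HahnSeries.single (-i) 1 = 1 := by
  rw [HahnSeries.single_mul_single, add_neg_cancel, mul_one]; rfl

/-- The entries `z^{r-s} p_{rs}(z^{2n})`, where `t = z⁻¹` is the variable of the Laurent series. -/
def regrade (hn : 1 ≤ n) : Mat n (LaurentSeries A) →+* Mat n (LaurentSeries A) where
  toFun P := Matrix.of fun r s => HahnSeries.single ((s : ℤ) - r) 1 * scaleHom A hn (P r s)
  map_one' := by
    refine Matrix.ext fun r s => ?_
    rw [Matrix.of_apply, Matrix.one_apply]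
    split_ifs with h
    · rw [h, sub_self, map_one (scaleHom A hn), mul_one]; rfl
    · rw [map_zero, mul_zero]
  map_mul' P Q := by
    refine Matrix.ext fun r s => ?_
    simp only [Matrix.of_apply, Matrix.mul_apply, map_sum, map_mul, Finset.mul_sum]
    refine Finset.sum_congr rfl fun k _ => ?_
    have : (HahnSeries.single ((s : ℤ) - r) (1 : A) : LaurentSeries A)
        = HahnSeries.single ((k : ℤ) - r) 1 * HahnSeries.single ((s : ℤ) - k) 1 := by
      rw [HahnSeries.single_mul_single, mul_one, show (k : ℤ) - r + ((s : ℤ) - k) = s - r by ring]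
    rw [this, mul_mul_mul_comm]
  map_zero' := by
    refine Matrix.ext fun r s => ?_
    simp
  map_add' P Q := by
    refine Matrix.ext fun r s => ?_
    simp [mul_add]

lemma regrade_apply (hn : 1 ≤ n) (P : Mat n (LaurentSeries A)) (r s : Fin (2 * n + 1)) :
    regrade hn P r s = HahnSeries.single ((s : ℤ) - r) 1 * scaleHom A hn (P r s) := rfl

lemma regrade_coeff (hn : 1 ≤ n) (P : Mat n (LaurentSeries A)) (r s : Fin (2 * n + 1)) (k : ℤ) :
    (regrade hn P r s).coeff (2 * n * k + s - r) = (P r s).coeff k := by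
  rw [regrade_apply, HahnSeries.coeff_single_mul, one_mul,
    show (2 * n * k + s - r : ℤ) - (s - r) = 2 * n * k by ring, scaleHom_coeff]

lemma regrade_coeff_of_not_dvd (hn : 1 ≤ n) (P : Mat n (LaurentSeries A))
    (r s : Fin (2 * n + 1)) {e : ℤ} (he : ¬ (2 * n : ℤ) ∣ e + r - s) :
    (regrade hn P r s).coeff e = 0 := by
  rw [regrade_apply, HahnSeries.coeff_single_mul, one_mul]
  apply scaleHom_coeff_of_not_dvd
  rwa [show e - ((s : ℤ) - r) = e + r - s by ring]

lemma regrade_injective (hn : 1 ≤ n) :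
    Function.Injective (regrade hn : Mat n (LaurentSeries A) → _) := by
  intro P Q h
  ext r s k
  rw [← regrade_coeff hn, h, regrade_coeff]

lemma regrade_constLoop (hn : 1 ≤ n) (X : Mat n A) (r s : Fin (2 * n + 1)) :
    regrade hn (constLoop X) r s = HahnSeries.single ((s : ℤ) - r) (X r s) := by
  rw [regrade_apply, constLoop, Matrix.map_apply, scaleHom_C, HahnSeries.C_apply,
    HahnSeries.single_mul_single, add_zero, one_mul]

lemma regrade_lam_smul (hn : 1 ≤ n) (P : Mat n (LaurentSeries A)) :
    regrade hn (lam A • P) = (HahnSeries.single (-(2 * n : ℤ)) 1 : LaurentSeries A) •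
      regrade hn P := by
  refine Matrix.ext fun r s => ?_
  rw [regrade_apply, Matrix.smul_apply, Matrix.smul_apply, smul_eq_mul, map_mul, scaleHom_lam,
    regrade_apply, smul_eq_mul]
  ring

lemma soAdj_regrade (hn : 1 ≤ n) (P : Mat n (LaurentSeries A)) :
    regrade hn (soAdj P) = soAdj (regrade hn P) := by
  refine Matrix.ext fun r s => ?_
  have hsc (k : ℕ) (f : LaurentSeries A) :
      scaleHom A hn ((-1) ^ k * f) = (-1) ^ k * scaleHom A hn f := by simp
  rw [regrade_apply, soAdj_apply, soAdj_apply, regrade_apply, hsc]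
  have : ((r.rev : Fin (2 * n + 1)) : ℤ) - (s.rev : Fin (2 * n + 1)) = (s : ℤ) - r := by
    have h1 := r.val_rev
    have h2 := s.val_rev
    omega
  rw [this, mul_left_comm]

variable [Algebra ℝ A]

lemma regrade_map_laurentD (hn : 1 ≤ n) (D : Derivation ℝ A A) (P : Mat n (LaurentSeries A)) :
    regrade hn (P.map (laurentD D)) = (regrade hn P).map (laurentD D) := by
  ext r s k
  rw [regrade_apply, Matrix.map_apply, Matrix.map_apply, scaleHom_laurentD, laurentD_coeff,
    regrade_apply, HahnSeries.coeff_single_mul, HahnSeries.coeff_single_mul, laurentD_coeff,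
    one_mul, one_mul]

/-- `z`. -/
def zed (A : Type*) [CommRing A] : LaurentSeries A := HahnSeries.single (-1) 1

/-- The purpose of the regrading: `b` has degree 1, and `λ β` has degree `2n + (1 - 2n) = 1`. -/
lemma regrade_JB (hn : 1 ≤ n) : regrade hn (JB n A) = zed A • constLoop (cyc n A) := by
  refine Matrix.ext fun r s => ?_
  have hb : (HahnSeries.single ((s : ℤ) - r) (b n A r s) : LaurentSeries A)
      = HahnSeries.single (-1) (b n A r s) := by
    rw [b_apply]
    split_ifs with h
    · rw [show (s : ℤ) - r = -1 by omega]
    · simp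
  have hβ : (HahnSeries.single (-(2 * n : ℤ) + (s - r)) (beta n A r s) : LaurentSeries A)
      = HahnSeries.single (-1) (beta n A r s) := by
    rw [beta_apply]
    split_ifs with h
    · rw [show -(2 * n : ℤ) + (s - r) = -1 by omega]
    · simp
  rw [JB, map_add, regrade_lam_smul, Matrix.add_apply, Matrix.smul_apply, Matrix.smul_apply,
    regrade_constLoop, regrade_constLoop, constLoop, Matrix.map_apply, cyc, Matrix.add_apply,
    smul_eq_mul, smul_eq_mul, zed, HahnSeries.C_apply,
    HahnSeries.single_mul_single, HahnSeries.single_mul_single, one_mul, one_mul, hb, hβ, add_zero,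
    HahnSeries.single_add]

/-- The matrix of coefficients of `t^e`. -/
def lcoeff (e : ℤ) (X : Mat n (LaurentSeries A)) : Mat n A := X.map fun f => f.coeff e

omit [Algebra ℝ A] in
lemma lcoeff_apply (e : ℤ) (X : Mat n (LaurentSeries A)) (r s : Fin (2 * n + 1)) :
    lcoeff e X r s = (X r s).coeff e := rfl

omit [Algebra ℝ A] in
lemma lcoeff_constLoop_mul (X : Mat n A) (P : Mat n (LaurentSeries A)) (e : ℤ) :
    lcoeff e (constLoop X * P) = X * lcoeff e P := by
  have := lamCoeff_constLoop_mul X P (-e)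
  simpa [lamCoeff, lcoeff] using this

omit [Algebra ℝ A] in
lemma lcoeff_mul_constLoop (X : Mat n A) (P : Mat n (LaurentSeries A)) (e : ℤ) :
    lcoeff e (P * constLoop X) = lcoeff e P * X := by
  have := lamCoeff_mul_constLoop X P (-e)
  simpa [lamCoeff, lcoeff] using this

omit [Algebra ℝ A] in
lemma lcoeff_zed_smul (P : Mat n (LaurentSeries A)) (e : ℤ) :
    lcoeff e (zed A • P) = lcoeff (e + 1) P := by
  ext r s
  rw [lcoeff_apply, Matrix.smul_apply, smul_eq_mul, zed, HahnSeries.coeff_single_mul, one_mul,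
    lcoeff_apply, sub_neg_eq_add]

/-- If `[∂ + J_B + u, P] = 0` then the leading coefficient of `P` in the principal grading commutes
with the cyclic element. -/
lemma commute_cyc_of_leading (hn : 1 ≤ n) {D : Derivation ℝ A A} {u : Fin n → A}
    {P : Mat n (LaurentSeries A)}
    (hP : loopD D P + ((JB n A + constLoop (toV u)) * P - P * (JB n A + constLoop (toV u))) = 0)
    (e : ℤ) (he : ∀ k ≤ e, lcoeff k (regrade hn P) = 0) :
    cyc n A * lcoeff (e + 1) (regrade hn P) = lcoeff (e + 1) (regrade hn P) * cyc n A := by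
  have h := congrArg (fun X => lcoeff e (regrade hn X)) hP
  set X := regrade hn P with hX
  have he' (k : ℤ) (hk : k ≤ e) (r s : Fin (2 * n + 1)) : (X r s).coeff k = 0 :=
    congrFun (congrFun (he k hk) r) s
  -- `u` is strictly upper triangular and raises the exponent, so it meets only coefficients of `X`
  -- below `e`.
  have hl : lcoeff e (regrade hn (constLoop (toV u)) * X) = 0 := by
    ext r s
    rw [lcoeff_apply, Matrix.mul_apply, HahnSeries.coeff_sum]
    refine Finset.sum_eq_zero fun k _ => ?_
    rw [regrade_constLoop, HahnSeries.coeff_single_mul]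
    rcases le_or_gt k r with hk | hk
    · rw [toV_strictUpper u r k hk, zero_mul]
    · rw [he' _ (by rw [Fin.lt_def] at hk; omega), mul_zero]
  have hr : lcoeff e (X * regrade hn (constLoop (toV u))) = 0 := by
    ext r s
    rw [lcoeff_apply, Matrix.mul_apply, HahnSeries.coeff_sum]
    refine Finset.sum_eq_zero fun k _ => ?_
    rw [regrade_constLoop, HahnSeries.coeff_mul_single]
    rcases le_or_gt s k with hk | hk
    · rw [toV_strictUpper u k s hk, mul_zero]
    · rw [he' _ (by rw [Fin.lt_def] at hk; omega), zero_mul]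
  have hd : lcoeff e (X.map (laurentD D)) = 0 := by
    ext r s
    rw [lcoeff_apply, Matrix.map_apply, laurentD_coeff, he' e le_rfl, map_zero]
    rfl
  have hadd (Y Z : Mat n (LaurentSeries A)) : lcoeff e (Y + Z) = lcoeff e Y + lcoeff e Z := by
    ext; simp [lcoeff]
  have hsub (Y Z : Mat n (LaurentSeries A)) : lcoeff e (Y - Z) = lcoeff e Y - lcoeff e Z := by
    ext; simp [lcoeff]
  have h0 : lcoeff e (0 : Mat n (LaurentSeries A)) = 0 := by ext; simp [lcoeff]
  simp only [loopD_eq, map_add, map_sub, map_mul, map_zero, regrade_map_laurentD, regrade_JB,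
    ← hX, add_mul, mul_add, smul_mul_assoc, mul_smul_comm, hadd, hsub, hl, hr, hd,
    lcoeff_zed_smul, lcoeff_constLoop_mul, lcoeff_mul_constLoop, h0, add_zero, zero_add] at h
  exact sub_eq_zero.1 h

/-! ### Power series in the regraded variable -/

/-- A matrix of power series in `t`, as a matrix of Laurent series. -/
def ofPS (n : ℕ) (A : Type*) [CommRing A] : Mat n (PowerSeries A) →+* Mat n (LaurentSeries A) :=
  (HahnSeries.ofPowerSeries ℤ A).mapMatrix

/-- The matrix of constant coefficients. -/
def constPS (n : ℕ) (A : Type*) [CommRing A] : Mat n (PowerSeries A) →+* Mat n A :=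
  (PowerSeries.constantCoeff (R := A)).mapMatrix

omit [Algebra ℝ A] in
lemma ofPS_injective : Function.Injective (ofPS n A) := by
  intro p q h
  refine Matrix.ext fun r s => ?_
  exact HahnSeries.ofPowerSeries_injective (congrFun (congrFun h r) s)

omit [Algebra ℝ A] in
lemma ofPS_coeff (p : Mat n (PowerSeries A)) (r s : Fin (2 * n + 1)) (e : ℤ) :
    (ofPS n A p r s).coeff e = if e < 0 then 0 else PowerSeries.coeff e.natAbs (p r s) :=
  PowerSeries.coeff_coe (p r s) e

/-- `P = z p` after regrading, with `p` a power series in `z⁻¹` with constant coefficient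
`b + β`. -/
def HasLeading (hn : 1 ≤ n) (P : Mat n (LaurentSeries A)) (p : Mat n (PowerSeries A)) : Prop :=
  regrade hn P = zed A • ofPS n A p ∧ constPS n A p = cyc n A

omit [Algebra ℝ A] in
lemma zed_pow (k : ℕ) : zed A ^ k = HahnSeries.single (-(k : ℤ)) 1 := by
  rw [zed, HahnSeries.single_pow, one_pow]
  congr 1
  simp

omit [Algebra ℝ A] in
lemma isUnit_zed : IsUnit (zed A) :=
  IsUnit.of_mul_eq_one _ ((mul_comm _ _).trans (single_mul_single_neg 1))

/-- After regrading both sides carry the factor `z^{2n+1}`, a unit. -/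
lemma HasLeading.pow_eq {hn : 1 ≤ n} {P : Mat n (LaurentSeries A)} {p : Mat n (PowerSeries A)}
    (hp : HasLeading hn P p) (hP : P ^ (2 * n + 1) = lam A • P) : p ^ (2 * n + 1) = p := by
  apply ofPS_injective
  have h := congrArg (regrade hn) hP
  have hz : (HahnSeries.single (-(2 * n : ℤ)) 1 : LaurentSeries A) = zed A ^ (2 * n) := by
    rw [zed_pow]; push_cast; rfl
  rw [map_pow, regrade_lam_smul, hp.1, smul_pow, hz, smul_smul, ← pow_succ] at h
  have hu := (isUnit_zed (A := A)).pow (2 * n + 1)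
  rw [map_pow]
  exact hu.smul_left_cancel.1 h

/-- Let `Δ` be the coefficient of `p - q` in the first order where they might differ. The equation
makes it commute with `L`, and `p^{2n+1} = p` linearises to `Δ = (2n+1) L^{2n} Δ`. Multiplying by
the idempotent `L^{2n}` gives `L^{2n} Δ = 0`, hence `Δ = 0`. -/
lemma resolvent_unique_aux (hn : 1 ≤ n) {D : Derivation ℝ A A} {u : Fin n → A}
    {P Q : Mat n (LaurentSeries A)} {p q : Mat n (PowerSeries A)}
    (hP : loopD D P + ((JB n A + constLoop (toV u)) * P - P * (JB n A + constLoop (toV u))) = 0)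
    (hQ : loopD D Q + ((JB n A + constLoop (toV u)) * Q - Q * (JB n A + constLoop (toV u))) = 0)
    (hp : HasLeading hn P p) (hq : HasLeading hn Q q)
    (hPN : P ^ (2 * n + 1) = lam A • P) (hQN : Q ^ (2 * n + 1) = lam A • Q) : P = Q := by
  have hpN := hp.pow_eq hPN
  have hqN := hq.pow_eq hQN
  set L := cyc n A with hL
  have hLN : L ^ (2 * n + 1) = L := cyc_pow hn
  have hsub : loopD D (P - Q) + ((JB n A + constLoop (toV u)) * (P - Q)
      - (P - Q) * (JB n A + constLoop (toV u))) = 0 := by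
    have : loopD D (P - Q) = loopD D P - loopD D Q := by
      rw [loopD_eq, loopD_eq, loopD_eq, Matrix.map_sub _ (map_sub _)]
    rw [this, ← sub_zero (0 : Mat n (LaurentSeries A))]
    nth_rewrite 1 [← hP]
    rw [← hQ]
    noncomm_ring
  have hreg : regrade hn (P - Q) = zed A • ofPS n A (p - q) := by
    rw [map_sub, hp.1, hq.1, map_sub, smul_sub]
  have key (d : ℕ) : ∀ r s, PowerSeries.coeff d ((p - q) r s) = 0 := by
    induction d using Nat.strong_induction_on with
    | _ d ih =>
      have hdvd (r s : Fin (2 * n + 1)) : PowerSeries.X ^ d ∣ (p - q) r s :=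
        PowerSeries.X_pow_dvd_iff.2 fun m hm => ih m hm r s
      choose δ hδ using hdvd
      set Δ : Mat n (PowerSeries A) := Matrix.of δ with hΔ
      have hpq : p = q + (PowerSeries.X ^ d : PowerSeries A) • Δ := by
        rw [← sub_eq_iff_eq_add']
        refine Matrix.ext fun r s => ?_
        exact hδ r s
      have hΔd (r s : Fin (2 * n + 1)) : constPS n A Δ r s = PowerSeries.coeff d ((p - q) r s) := by
        rw [hδ r s, PowerSeries.coeff_X_pow_mul', if_pos le_rfl, Nat.sub_self,
          PowerSeries.coeff_zero_eq_constantCoeff]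
        rfl
      have hcomm : L * constPS n A Δ = constPS n A Δ * L := by
        -- The factor `z` puts the `d`-th coefficient of `p - q` at exponent `d - 1`; the lemma is
        -- given the exponent just before.
        have h := commute_cyc_of_leading hn hsub ((d : ℤ) - 2) (fun k hk => ?_)
        · have e : lcoeff ((d : ℤ) - 2 + 1) (regrade hn (P - Q)) = constPS n A Δ := by
            ext r s
            rw [hreg, lcoeff_zed_smul, lcoeff_apply, ofPS_coeff, hΔd, if_neg (by omega)]
            congr 2
            omega
          rwa [e] at h
        · ext r s
          rw [hreg, lcoeff_zed_smul, lcoeff_apply, ofPS_coeff]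
          split_ifs with hk'
          · rfl
          · exact ih _ (by omega) r s
      have hE (m : ℕ) : ∃ E : Mat n (PowerSeries A),
          p ^ (m + 1) = q ^ (m + 1) + (PowerSeries.X ^ d : PowerSeries A) • E ∧
            constPS n A E = (m + 1 : ℝ) • (L ^ m * constPS n A Δ) := by
        induction m with
        | zero => exact ⟨Δ, by simpa using hpq, by simp⟩
        | succ m ihm =>
          obtain ⟨E, hE, hE'⟩ := ihm
          refine ⟨p ^ (m + 1) * Δ + E * q, ?_, ?_⟩
          · rw [pow_succ p (m + 1)]
            nth_rewrite 2 [hpq]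
            rw [mul_add, hE, mul_smul_comm, add_mul, ← pow_succ, smul_mul_assoc, smul_add, ← hE]
            abel
          · rw [map_add, map_mul, map_mul, map_pow, hp.2, hq.2, hE', smul_mul_assoc, mul_assoc,
              ← hcomm, ← mul_assoc, ← pow_succ]
            push_cast
            module
      obtain ⟨E, hE, hE'⟩ := hE (2 * n)
      rw [hpN, hqN] at hE
      have hEΔ : constPS n A E = constPS n A Δ := by
        have h1 : (PowerSeries.X ^ d : PowerSeries A) • E = (PowerSeries.X ^ d : PowerSeries A) • Δ :=
          add_left_cancel (hE.symm.trans hpq)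
        ext r s
        have h2 := congrArg (PowerSeries.coeff d) (congrFun (congrFun h1 r) s)
        rw [Matrix.smul_apply, Matrix.smul_apply, smul_eq_mul, smul_eq_mul,
          PowerSeries.coeff_X_pow_mul', PowerSeries.coeff_X_pow_mul', if_pos le_rfl,
          if_pos le_rfl, Nat.sub_self, PowerSeries.coeff_zero_eq_constantCoeff] at h2
        exact h2
      rw [hEΔ] at hE'
      have hLL : L ^ (2 * n) * L ^ (2 * n) = L ^ (2 * n) := by
        obtain ⟨m, hm⟩ : ∃ m, 2 * n = m + 1 := ⟨2 * n - 1, by omega⟩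
        calc L ^ (2 * n) * L ^ (2 * n) = L ^ (2 * n + 1) * L ^ (2 * n - 1) := by
              rw [← pow_add, ← pow_add]; congr 1; omega
          _ = L ^ (2 * n) := by rw [hLN, ← pow_succ']; congr 1; omega
      have h3 : L ^ (2 * n) * constPS n A Δ
          = L ^ (2 * n) * (((2 * n : ℕ) + 1 : ℝ) • (L ^ (2 * n) * constPS n A Δ)) :=
        congrArg (L ^ (2 * n) * ·) hE'
      rw [mul_smul_comm, ← mul_assoc, hLL] at h3
      have h4 : (2 * n : ℝ) • (L ^ (2 * n) * constPS n A Δ) = 0 := by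
        have : ((2 * n : ℕ) + 1 : ℝ) • (L ^ (2 * n) * constPS n A Δ)
            = (2 * n : ℝ) • (L ^ (2 * n) * constPS n A Δ) + L ^ (2 * n) * constPS n A Δ := by
          push_cast; module
        rw [this] at h3
        exact right_eq_add.1 h3
      have hn0 : (2 * n : ℝ) ≠ 0 := by positivity
      have h5 : L ^ (2 * n) * constPS n A Δ = 0 := (smul_eq_zero_iff_right hn0).1 h4
      rw [h5, smul_zero] at hE'
      intro r s
      rw [← hΔd, hE']
      rfl
  have hpq : p = q := by
    ext r s d
    have := key d r s
    rwa [Matrix.sub_apply, map_sub, sub_eq_zero] at this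
  apply regrade_injective hn
  rw [hp.1, hq.1, hpq]

end

/-! ### Uniqueness and existence of the resolvent -/

section

variable {n : ℕ} {A : Type*} [CommRing A] [Algebra ℝ A]

/-! ### Uniqueness of the resolvent -/

omit [Algebra ℝ A] in
lemma constPS_apply (p : Mat n (PowerSeries A)) (r s : Fin (2 * n + 1)) :
    constPS n A p r s = PowerSeries.coeff 0 (p r s) :=
  (PowerSeries.coeff_zero_eq_constantCoeff_apply _).symm

lemma JB_pow (hn : 1 ≤ n) : JB n A ^ (2 * n + 1) = lam A • JB n A := by
  apply regrade_injective hn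
  have hc : constLoop (cyc n A) ^ (2 * n + 1) = constLoop (cyc n A) := by
    have h := congrArg (RingHom.mapMatrix (HahnSeries.C : A →+* LaurentSeries A)) (cyc_pow (A := A) hn)
    rwa [map_pow] at h
  have hz : (HahnSeries.single (-(2 * n : ℤ)) 1 : LaurentSeries A) = zed A ^ (2 * n) := by
    rw [zed_pow]; push_cast; rfl
  rw [map_pow, regrade_lam_smul, regrade_JB, smul_pow, hc, hz, smul_smul, ← pow_succ]

lemma pow_of_isConj (hn : 1 ≤ n) {P : Mat n (LaurentSeries A)} (h : IsConj (JB n A) P) :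
    P ^ (2 * n + 1) = lam A • P := by
  obtain ⟨M, hM⟩ := h
  have h1 : (M : Mat n (LaurentSeries A)) * JB n A ^ (2 * n + 1) = P ^ (2 * n + 1) * M :=
    hM.pow_right _
  have h2 : (M : Mat n (LaurentSeries A)) * JB n A = P * M := hM
  rw [JB_pow hn, mul_smul_comm, h2, ← smul_mul_assoc] at h1
  exact (M.isUnit.mul_right_cancel h1).symm

variable {D : Derivation ℝ A A} {u : Fin n → A} {P : Mat n (LaurentSeries A)}

lemma IsResolvent.coeff_eq_zero (hP : IsResolvent D u P) {k : ℤ} (hk : k < -1)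
    (r s : Fin (2 * n + 1)) : (P r s).coeff k = 0 := by
  have := congrFun (congrFun (hP.coeff_gt (-k) (by omega)) r) s
  simpa [lamCoeff] using this

lemma IsResolvent.coeff_neg_one (hP : IsResolvent D u P) (r s : Fin (2 * n + 1)) :
    (P r s).coeff (-1) = beta n A r s := by
  rw [← hP.coeff_one]; rfl

/-- After regrading, `λ β` sits at exponent `-1`, and coefficients of `λ^i` with `i ≤ 0` reach lower
exponents only below the diagonal. The lowest coefficient also commutes with `L`, so
`eq_zero_of_commute_cyc` removes it; the induction climbs from exponent `-(2n+1)`, where every entry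
is zero. -/
lemma IsResolvent.lcoeff_eq_zero (hn : 1 ≤ n) (hP : IsResolvent D u P) (m : ℕ) :
    ∀ e : ℤ, e < -1 → e ≤ m - (2 * n + 1) → lcoeff e (regrade hn P) = 0 := by
  have hlow (e : ℤ) (he : e < -1) (r s : Fin (2 * n + 1)) (h : r ≤ s ∨ e < -(2 * n)) :
      lcoeff e (regrade hn P) r s = 0 := by
    rw [lcoeff_apply]
    have hr := r.2
    have hs := s.2
    rw [Fin.le_def] at h
    by_cases hd : (2 * n : ℤ) ∣ e + r - s
    · obtain ⟨k, hk⟩ := hd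
      rw [show e = 2 * n * k + s - r by omega, regrade_coeff]
      rcases lt_trichotomy k (-1) with h1 | h1 | h1
      · exact hP.coeff_eq_zero h1 r s
      · subst h1
        rw [hP.coeff_neg_one, beta_apply, if_neg]
        rintro (h2 | h2) <;> omega
      · exfalso
        have : 0 ≤ 2 * (n : ℤ) * k := by
          have : (0 : ℤ) ≤ k := by omega
          positivity
        omega
    · exact regrade_coeff_of_not_dvd hn P r s hd
  induction m with
  | zero => exact fun e he hem => Matrix.ext fun r s => hlow e he r s (Or.inr (by omega))
  | succ m ih =>
    intro e he hem
    refine eq_zero_of_commute_cyc hn (fun r s hrs => hlow e he r s (Or.inl hrs)) ?_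
    have := commute_cyc_of_leading hn hP.comm (e - 1)
      (fun k hk => ih k (by omega) (by push_cast at hem; omega))
    rwa [sub_add_cancel] at this

/-- On and above the diagonal this coefficient comes from `λ β` alone, so its difference from `L` is
strictly lower triangular and commutes with `L`. -/
lemma IsResolvent.lcoeff_neg_one (hn : 1 ≤ n) (hP : IsResolvent D u P) :
    lcoeff (-1) (regrade hn P) = cyc n A := by
  rw [← sub_eq_zero]
  refine eq_zero_of_commute_cyc hn (fun r s hrs => ?_) ?_
  · have hr := r.2
    have hs := s.2
    rw [Fin.le_def] at hrs
    rw [Matrix.sub_apply, cyc, Matrix.add_apply, b_apply, if_neg (by omega), zero_add, lcoeff_apply]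
    by_cases hd : (2 * n : ℤ) ∣ -1 + r - s
    · obtain ⟨k, hk⟩ := hd
      rw [show (-1 : ℤ) = 2 * n * k + s - r by omega, regrade_coeff]
      rcases lt_trichotomy k (-1) with h1 | h1 | h1
      · exfalso
        have : 2 * (n : ℤ) * k ≤ 2 * n * (-2) := by
          apply mul_le_mul_of_nonneg_left <;> omega
        omega
      · rw [h1, hP.coeff_neg_one, sub_self]
      · exfalso
        have : 0 ≤ 2 * (n : ℤ) * k := by
          have : (0 : ℤ) ≤ k := by omega
          positivity
        omega
    · rw [regrade_coeff_of_not_dvd hn P r s hd, beta_apply, if_neg, sub_zero]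
      intro h
      exact hd ⟨-1, by omega⟩
  · have := commute_cyc_of_leading hn hP.comm (-2)
      (fun k hk => hP.lcoeff_eq_zero hn (2 * n + 1) k (by omega) (by push_cast; omega))
    rw [mul_sub, sub_mul]
    rw [show (-2 : ℤ) + 1 = -1 by norm_num] at this
    rw [this]

lemma IsResolvent.hasLeading (hn : 1 ≤ n) (hP : IsResolvent D u P) :
    ∃ p, HasLeading hn P p := by
  refine ⟨Matrix.of fun r s => PowerSeries.mk fun d => (regrade hn P r s).coeff ((d : ℤ) - 1),
    ?_, ?_⟩
  · refine Matrix.ext fun r s => ?_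
    ext e
    rw [Matrix.smul_apply, smul_eq_mul, zed, HahnSeries.coeff_single_mul, one_mul, ofPS_coeff]
    split_ifs with h
    · exact congrFun (congrFun (hP.lcoeff_eq_zero hn (e + (2 * n + 1)).toNat e (by omega)
        (by omega)) r) s
    · rw [Matrix.of_apply, PowerSeries.coeff_mk]
      congr 1
      omega
  · rw [← hP.lcoeff_neg_one hn]
    ext r s
    rw [constPS_apply, Matrix.of_apply, PowerSeries.coeff_mk, lcoeff_apply]
    rfl

lemma IsResolvent.unique (hn : 1 ≤ n) {Q : Mat n (LaurentSeries A)} (hP : IsResolvent D u P)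
    (hQ : IsResolvent D u Q) : P = Q := by
  obtain ⟨p, hp⟩ := hP.hasLeading hn
  obtain ⟨q, hq⟩ := hQ.hasLeading hn
  exact resolvent_unique_aux hn hP.comm hQ.comm hp hq (pow_of_isConj hn hP.conj)
    (pow_of_isConj hn hQ.conj)

/-! ### Existence of the resolvent -/

/-- The loop whose regrading is `∑ w_d z^{-d}`. -/
def ungrade (w : ℕ → Mat n A) : Mat n (PowerSeries A) :=
  Matrix.of fun r s => PowerSeries.mk fun k =>
    if (r : ℕ) ≤ 2 * n * k + s then w (2 * n * k + s - r) r s else 0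

/-- `∑ w_d t^d`. -/
def seriesPS (w : ℕ → Mat n A) : Mat n (PowerSeries A) :=
  Matrix.of fun r s => PowerSeries.mk fun d => w d r s

omit [Algebra ℝ A] in
-- Homogeneity confines the entry `(r, s)` to exponents congruent to `s - r` modulo `2n`, exactly
-- what `regrade` produces. A positive power of `λ` could come only from the upper right corner of
-- `w 0`, which is zero.
lemma regrade_ungrade (hn : 1 ≤ n) (w : ℕ → Mat n A) (h0 : w 0 = 1)
    (hw : ∀ d : ℕ, Homog (-d : ℤ) (w d)) :
    regrade hn (ofPS n A (ungrade w)) = ofPS n A (seriesPS w) := by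
  refine Matrix.ext fun r s => ?_
  ext e
  have hr := r.2
  have hs := s.2
  rw [ofPS_coeff]
  by_cases hd : (2 * n : ℤ) ∣ e + r - s
  · obtain ⟨k, hk⟩ := hd
    obtain rfl : e = 2 * n * k + s - r := by omega
    rw [regrade_coeff, ofPS_coeff]
    rcases lt_or_ge k 0 with h | h
    · rw [if_pos h]
      have h1 : 2 * (n : ℤ) * k ≤ 2 * n * (-1) := by
        apply mul_le_mul_of_nonneg_left <;> omega
      split_ifs with h2
      · rfl
      · have h3 : (2 * (n : ℤ) * k + s - r).natAbs = 0 := by omega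
        rw [h3, seriesPS, Matrix.of_apply, PowerSeries.coeff_mk, h0, Matrix.one_apply_ne]
        rintro rfl
        omega
    · rw [if_neg (by omega)]
      obtain ⟨m, rfl⟩ := Int.eq_ofNat_of_zero_le h
      rw [Int.natAbs_natCast, ungrade, Matrix.of_apply, PowerSeries.coeff_mk]
      have hc : (2 * (n : ℤ) * m + s - r) = ((2 * n * m + s : ℕ) : ℤ) - r := by push_cast; ring
      rw [hc]
      split_ifs with h1 h2 h2
      · omega
      · rw [seriesPS, Matrix.of_apply, PowerSeries.coeff_mk]
        congr 1
        omega
      · rfl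
      · omega
  · rw [regrade_coeff_of_not_dvd hn _ r s hd]
    split_ifs with h
    · rfl
    · rw [seriesPS, Matrix.of_apply, PowerSeries.coeff_mk, hw]
      intro h1
      apply hd
      convert h1 using 1
      omega

omit [Algebra ℝ A] in
-- The constant term in `λ⁻¹` is upper triangular with diagonal taken from `w 0 = 1`.
lemma isUnit_ungrade (w : ℕ → Mat n A) (h0 : w 0 = 1) : IsUnit (ungrade w) := by
  rw [Matrix.isUnit_iff_isUnit_det, PowerSeries.isUnit_iff_constantCoeff, RingHom.map_det,
    Matrix.det_of_isUpperTriangular]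
  · rw [Finset.prod_eq_one]
    · exact isUnit_one
    · intro i _
      change constPS n A (ungrade w) i i = 1
      rw [constPS_apply, ungrade, Matrix.of_apply, PowerSeries.coeff_mk]
      simp [h0]
  · intro r s hrs
    change constPS n A (ungrade w) r s = 0
    rw [constPS_apply, ungrade, Matrix.of_apply, PowerSeries.coeff_mk, if_neg]
    have : (s : ℕ) < r := hrs
    omega

omit [Algebra ℝ A] in
/-- `∑_d (∑_{a + c = d} x_a y_c) t^d`. -/
lemma seriesPS_mul (x y : ℕ → Mat n A) : seriesPS x * seriesPS y
    = seriesPS fun d => ∑ p ∈ Finset.HasAntidiagonal.antidiagonal d, x p.1 * y p.2 := by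
  refine Matrix.ext fun r s => ?_
  ext d
  simp only [seriesPS, Matrix.mul_apply, Matrix.of_apply, map_sum, PowerSeries.coeff_mul,
    PowerSeries.coeff_mk, Matrix.sum_apply]
  rw [Finset.sum_comm]

omit [Algebra ℝ A] in
lemma regrade_toV (hn : 1 ≤ n) (u : Fin n → A) :
    regrade hn (constLoop (toV u)) = ofPS n A (seriesPS (uPart u)) := by
  refine Matrix.ext fun r s => ?_
  ext e
  rw [regrade_constLoop, ofPS_coeff, HahnSeries.coeff_single]
  split_ifs with h1 h2 h2
  · exact toV_strictUpper u r s (by rw [Fin.le_def]; omega)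
  · rw [seriesPS, Matrix.of_apply, PowerSeries.coeff_mk, uPart, Matrix.of_apply, if_pos (by omega)]
  · rfl
  · rw [seriesPS, Matrix.of_apply, PowerSeries.coeff_mk, uPart, Matrix.of_apply, if_neg (by omega)]

lemma ofPS_map_laurentD (D : Derivation ℝ A A) (w : ℕ → Mat n A) :
    (ofPS n A (seriesPS w)).map (laurentD D) = ofPS n A (seriesPS fun d => (w d).map D) := by
  refine Matrix.ext fun r s => ?_
  ext e
  rw [Matrix.map_apply, laurentD_coeff, ofPS_coeff, ofPS_coeff]
  split_ifs with h
  · exact map_zero D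
  · simp [seriesPS]

omit [Algebra ℝ A] in
lemma ofPS_eq_iff_coeff {X Y : Mat n (PowerSeries A)} (h : ∀ d r s, PowerSeries.coeff d (X r s)
    = PowerSeries.coeff d (Y r s)) : X = Y :=
  Matrix.ext fun r s => by ext d; exact h d r s

omit [Algebra ℝ A] in
lemma constLoop_eq_ofPS (X : Mat n A) :
    constLoop X = ofPS n A (X.map (PowerSeries.C (R := A))) := by
  refine Matrix.ext fun r s => ?_
  exact (HahnSeries.ofPowerSeries_C (X r s)).symm

omit [Algebra ℝ A] in
lemma X_smul_ofPS (p : Mat n (PowerSeries A)) :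
    zed A • ofPS n A ((PowerSeries.X : PowerSeries A) • p) = ofPS n A p := by
  refine Matrix.ext fun r s => ?_
  ext e
  rw [Matrix.smul_apply, smul_eq_mul, zed, HahnSeries.coeff_single_mul, one_mul, ofPS_coeff,
    ofPS_coeff, Matrix.smul_apply, smul_eq_mul]
  rcases lt_or_ge e 0 with h | h
  · rw [if_pos h]
    split_ifs with h1
    · rfl
    · have : (e - -1).natAbs = 0 := by omega
      rw [this, PowerSeries.coeff_zero_X_mul]
  · rw [if_neg (by omega), if_neg (by omega), show (e - -1).natAbs = e.natAbs + 1 by omega,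
      PowerSeries.coeff_succ_X_mul]

/-- The dressing matrix. -/
lemma exists_dressing_loop (hn : 1 ≤ n) (D : Derivation ℝ A A) (u : Fin n → A) :
    ∃ (M : (Mat n (LaurentSeries A))ˣ) (Q : Mat n (LaurentSeries A)) (W : (Mat n (PowerSeries A))ˣ),
      (M : Mat n (LaurentSeries A)).map (laurentD D) + (JB n A + constLoop (toV u)) * M = M * Q ∧
      JB n A * Q = Q * JB n A ∧ regrade hn M = ofPS n A W ∧ constPS n A W = 1 := by
  obtain ⟨w, f, h0, hw, hf, h⟩ := exists_dressing hn D u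
  have hM := (isUnit_ungrade w h0).map (ofPS n A)
  have hWc : constPS n A (seriesPS w) = 1 := by
    ext r s
    rw [constPS_apply, seriesPS, Matrix.of_apply, PowerSeries.coeff_mk, h0]
  have hW : IsUnit (seriesPS w) := by
    rw [Matrix.isUnit_iff_isUnit_det, PowerSeries.isUnit_iff_constantCoeff, RingHom.map_det]
    change IsUnit (constPS n A (seriesPS w)).det
    rw [hWc, Matrix.det_one]
    exact isUnit_one
  obtain ⟨M, hMeq⟩ := hM
  obtain ⟨W, hWeq⟩ := hW
  have hreg : regrade hn (M : Mat n (LaurentSeries A)) = ofPS n A (seriesPS w) := by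
    rw [hMeq, regrade_ungrade hn w h0 hw]
  set Q : Mat n (LaurentSeries A) := ((M⁻¹ : (Mat n (LaurentSeries A))ˣ) : Mat n (LaurentSeries A)) *
    ((M : Mat n (LaurentSeries A)).map (laurentD D) + (JB n A + constLoop (toV u)) * M) with hQdef
  have hQ : (M : Mat n (LaurentSeries A)).map (laurentD D) + (JB n A + constLoop (toV u)) * M
      = M * Q := by
    rw [hQdef, ← mul_assoc, M.mul_inv, one_mul]
  clear_value Q
  clear hQdef
  refine ⟨M, Q, W, hQ, ?_, by rw [hreg, hWeq], by rw [hWeq, hWc]⟩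
  set F := seriesPS f with hF
  set L : Mat n (PowerSeries A) := (cyc n A).map (PowerSeries.C (R := A)) with hL
  have hLs (x : ℕ → Mat n A) : L * seriesPS x = seriesPS fun d => cyc n A * x d := by
    refine ofPS_eq_iff_coeff fun d r s => ?_
    simp [hL, seriesPS, Matrix.mul_apply, PowerSeries.coeff_C_mul]
  have hsL (x : ℕ → Mat n A) : seriesPS x * L = seriesPS fun d => x d * cyc n A := by
    refine ofPS_eq_iff_coeff fun d r s => ?_
    simp [hL, seriesPS, Matrix.mul_apply, PowerSeries.coeff_mul_C]
  -- The recursion multiplied by `X = z⁻¹`, which keeps `zL` among power series.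
  have hPS : (PowerSeries.X : PowerSeries A) • (seriesPS fun d => (w d).map D) + L * seriesPS w
      + (PowerSeries.X : PowerSeries A) • (seriesPS (uPart u) * seriesPS w)
      = seriesPS w * L + (PowerSeries.X : PowerSeries A) • (seriesPS w * F) := by
    rw [hLs, hsL, hF, seriesPS_mul, seriesPS_mul]
    refine ofPS_eq_iff_coeff fun d r s => ?_
    cases d with
    | zero => simp [seriesPS, h0]
    | succ d =>
      have := congrFun (congrFun (h d) r) s
      simpa [seriesPS, PowerSeries.coeff_succ_X_mul] using this
  have hreg2 : regrade hn (M : Mat n (LaurentSeries A)) * regrade hn Q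
      = regrade hn (M : Mat n (LaurentSeries A)) * (zed A • ofPS n A L + ofPS n A F) := by
    rw [← map_mul, ← hQ, map_add, regrade_map_laurentD, map_mul, map_add, regrade_JB, regrade_toV,
      hreg, ofPS_map_laurentD, constLoop_eq_ofPS]
    have h1 := congrArg (fun X => zed A • ofPS n A X) hPS
    simp only [map_add, smul_add, X_smul_ofPS, map_mul] at h1
    rw [add_mul, mul_add, smul_mul_assoc, mul_smul_comm, ← add_assoc]
    exact h1
  have hMu : IsUnit (regrade hn (M : Mat n (LaurentSeries A))) := M.isUnit.map (regrade hn)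
  have hQreg := hMu.mul_left_cancel hreg2
  have hLF : L * F = F * L := by
    rw [hF, hLs, hsL]
    congr 1
    ext1 d
    exact hf d
  apply regrade_injective hn
  rw [map_mul, map_mul, hQreg, regrade_JB, constLoop_eq_ofPS, ← hL, mul_add, add_mul,
    smul_mul_assoc (zed A) (ofPS n A L) (ofPS n A F), mul_smul_comm (zed A) (ofPS n A F), ← map_mul,
    hLF, map_mul]

lemma soAdj_cyc : soAdj (cyc n A) = -cyc n A := by
  rw [cyc, soAdj_add, (inSo_iff _).1 inSo_b, (inSo_iff _).1 inSo_beta]; abel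

lemma soAdj_JB : soAdj (JB n A) = -JB n A := by
  rw [JB_eq, soAdj_add, soAdj_smul, (inSo_iff _).1 inSo_b, (inSo_iff _).1 inSo_beta]
  simp [add_comm]

theorem exists_isResolvent (hn : 1 ≤ n) (D : Derivation ℝ A A) (u : Fin n → A) :
    ∃ P, IsResolvent D u P := by
  obtain ⟨M, Q, W, hQ, hJQ, hreg, hW⟩ := exists_dressing_loop hn D u
  set P : Mat n (LaurentSeries A) := M * JB n A * ((M⁻¹ : (Mat n (LaurentSeries A))ˣ) :
    Mat n (LaurentSeries A)) with hPdef
  have hPM : P * M = M * JB n A := by rw [hPdef, mul_assoc, M.inv_mul, mul_one]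
  have hconj : IsConj (JB n A) P := ⟨M, hPM.symm⟩
  clear_value P
  clear hPdef
  set U := JB n A + constLoop (toV u) with hU
  have hcomm : loopD D P + (U * P - P * U) = 0 := by
    rw [loopD_eq]
    have h := congrArg (fun X : Mat n (LaurentSeries A) => X.map (laurentD D)) hPM
    simp only [matrix_map_mul, laurentD_JB, mul_zero, add_zero] at h
    have h1 : (M : Mat n (LaurentSeries A)).map (laurentD D) = M * Q - U * M := by
      rw [← hQ]; abel
    rw [h1] at h
    have h2 : (P.map (laurentD D) + (U * P - P * U)) * M = 0 * M := by
      calc (P.map (laurentD D) + (U * P - P * U)) * M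
          = (P.map (laurentD D) * M + P * (M * Q - U * M)) + U * (P * M) - P * M * Q := by
            noncomm_ring
        _ = M * (Q * JB n A - JB n A * Q) := by rw [h, hPM]; noncomm_ring
        _ = 0 * M := by rw [hJQ, sub_self, mul_zero, zero_mul]
    exact M.isUnit.mul_right_cancel h2
  set p : Mat n (PowerSeries A) := W * (cyc n A).map (PowerSeries.C (R := A)) *
    ((W⁻¹ : (Mat n (PowerSeries A))ˣ) : Mat n (PowerSeries A)) with hp
  have hlead : HasLeading hn P p := by
    constructor
    · have hMu : IsUnit (regrade hn (M : Mat n (LaurentSeries A))) := M.isUnit.map (regrade hn)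
      apply hMu.mul_right_cancel
      rw [← map_mul, hPM, map_mul, regrade_JB, constLoop_eq_ofPS, hreg, mul_smul_comm,
        smul_mul_assoc, ← map_mul, ← map_mul, hp, mul_assoc _ _ (W : Mat n (PowerSeries A)),
        W.inv_mul, mul_one]
    · have h1 : constPS n A ((cyc n A).map (PowerSeries.C (R := A))) = cyc n A := by
        ext r s
        simp [constPS]
      have h2 : constPS n A ((W⁻¹ : (Mat n (PowerSeries A))ˣ) : Mat n (PowerSeries A)) = 1 := by
        have := congrArg (constPS n A) W.mul_inv
        rwa [map_mul, hW, one_mul, map_one] at this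
      rw [hp, map_mul, map_mul, hW, h1, h2, one_mul, mul_one]
  have hpow := pow_of_isConj hn hconj
  -- `M` need not be orthogonal. Since `-soAdj P` has the same leading term and satisfies the same
  -- equation and the same identity `P^{2n+1} = λ P`, uniqueness identifies it with `P`.
  have hso : -soAdj P = P := by
    have hUso : soAdj U = -U := by
      have : soAdj (constLoop (toV u)) = -constLoop (toV u) := by
        have h := soAdj_map (HahnSeries.C : A →+* LaurentSeries A) (toV u)
        rw [(inSo_iff _).1 (inSo_toV u)] at h
        refine h.trans (Matrix.ext fun r s => ?_)
        exact map_neg (HahnSeries.C : A →+* LaurentSeries A) _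
      rw [hU, soAdj_add, soAdj_JB, this]; abel
    refine resolvent_unique_aux hn (D := D) (u := u) (p := -soAdj p) (q := p) ?_ hcomm ?_ hlead ?_
      hpow
    · have h := congrArg soAdj hcomm
      have h1 : loopD D (-soAdj P) = -soAdj (loopD D P) := by
        rw [loopD_eq, loopD_eq, soAdj_map]
        exact Matrix.ext fun r s => map_neg (laurentD D) _
      have h0 : soAdj (0 : Mat n (LaurentSeries A)) = 0 := by
        have := soAdj_sub (0 : Mat n (LaurentSeries A)) 0
        simpa using this
      rw [soAdj_add, soAdj_sub, soAdj_mul, soAdj_mul, hUso, h0] at h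
      rw [h1, ← hU, ← neg_eq_zero, ← h]
      noncomm_ring
    · constructor
      · have h1 : soAdj (zed A • ofPS n A p) = zed A • ofPS n A (soAdj p) := by
          rw [soAdj_smul]
          congr 1
          exact soAdj_map (HahnSeries.ofPowerSeries ℤ A) p
        rw [map_neg, soAdj_regrade, hlead.1, h1, map_neg, smul_neg]
      · have h1 : constPS n A (soAdj p) = soAdj (constPS n A p) :=
          (soAdj_map (PowerSeries.constantCoeff (R := A)) p).symm
        rw [map_neg, h1, hlead.2, soAdj_cyc, neg_neg]
    · have hodd : Odd (2 * n + 1) := ⟨n, rfl⟩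
      rw [hodd.neg_pow, ← soAdj_pow, hpow, soAdj_smul, smul_neg]
  have hmem (i : ℤ) : InSo (lamCoeff P i) := by
    rw [inSo_iff]
    have h1 : soAdj (lamCoeff P i) = lamCoeff (soAdj P) i :=
      soAdj_map (HahnSeries.coeff.addMonoidHom (-i)) P
    have h2 : soAdj P = -P := by rw [← neg_eq_iff_eq_neg, hso]
    rw [h1, h2]
    ext r s
    exact HahnSeries.coeff_neg
  have hentry (i : ℤ) (r s : Fin (2 * n + 1)) : lamCoeff P i r s
      = if -(2 * n * i) + s - r + 1 < 0 then 0
        else PowerSeries.coeff (-(2 * n * i) + s - r + 1 : ℤ).natAbs (p r s) := by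
    have h1 := congrArg (fun X : Mat n (LaurentSeries A) => (X r s).coeff (2 * n * (-i) + s - r))
      hlead.1
    simp only [regrade_coeff, Matrix.smul_apply, smul_eq_mul, zed, HahnSeries.coeff_single_mul,
      one_mul, ofPS_coeff] at h1
    rw [show (2 * n * (-i) + s - r : ℤ) - -1 = -(2 * n * i) + s - r + 1 by ring] at h1
    exact h1
  refine ⟨P, hmem, hconj, fun i hi => ?_, ?_, hcomm⟩
  · ext r s
    rw [hentry, if_pos]
    · rfl
    · have : 2 * (n : ℤ) * 2 ≤ 2 * n * i := by
        apply mul_le_mul_of_nonneg_left <;> omega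
      have := s.2
      omega
  · ext r s
    have hr := r.2
    have hs := s.2
    -- The upper right corner is the only entry of the `λ^1` coefficient that involves `p` beyond
    -- its constant term; it vanishes by the symmetry of `o(n+1, n)`.
    by_cases hcor : (r : ℕ) = 0 ∧ (s : ℕ) = 2 * n
    · have h1 := (hmem 1).apply_eq_neg (r := r) (s := s) (by omega)
      have e1 : s.rev = r := by ext; simp only [Fin.val_rev]; omega
      have e2 : r.rev = s := by ext; simp only [Fin.val_rev]; omega
      rw [e1, e2] at h1
      rw [eq_zero_of_eq_neg h1, beta_apply, if_neg (by omega)]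
    · rw [hentry]
      split_ifs with h
      · rw [beta_apply, if_neg (by omega)]
      · have h2 : (-(2 * n * 1) + s - r + 1 : ℤ).natAbs = 0 := by omega
        rw [h2, ← constPS_apply, hlead.2, cyc, Matrix.add_apply, b_apply, if_neg (by omega),
          zero_add]

theorem existsUnique_isResolvent (hn : 1 ≤ n) (D : Derivation ℝ A A) (u : Fin n → A) :
    ∃! P, IsResolvent D u P := by
  obtain ⟨P, hP⟩ := exists_isResolvent hn D u
  exact ⟨P, hP, fun Q hQ => hQ.unique hn hP⟩

end

/-! ### The pairing on the circle, gradients, lifts and flows -/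

section

variable {n : ℕ}

/-! ### Integration over the circle and the pairing -/

lemma CircleFn.continuous (f : CircleFn) : Continuous (f : ℝ → ℝ) := f.2.1.continuous

/-- Integration over the circle as a linear form. -/
def circleIntₗ : CircleFn →ₗ[ℝ] ℝ where
  toFun := circleInt
  map_add' f g := intervalIntegral.integral_add (f.continuous.intervalIntegrable _ _)
    (g.continuous.intervalIntegrable _ _)
  map_smul' c f := intervalIntegral.integral_smul c (f : ℝ → ℝ)

lemma circleInt_add (f g : CircleFn) : circleInt (f + g) = circleInt f + circleInt g :=
  map_add circleIntₗ f g

lemma circleInt_sub (f g : CircleFn) : circleInt (f - g) = circleInt f - circleInt g :=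
  map_sub circleIntₗ f g

lemma circleInt_zero : circleInt 0 = 0 := map_zero circleIntₗ

lemma circleInt_circleD (f : CircleFn) : circleInt (circleD f) = 0 := by
  have h := intervalIntegral.integral_deriv_eq_sub (f := (f : ℝ → ℝ)) (a := 0) (b := 2 * Real.pi)
    (fun x _ => f.differentiable x) ((circleD f).continuous.intervalIntegrable _ _)
  have hper := f.2.2 0
  rw [zero_add] at hper
  exact h.trans (by rw [hper, sub_self])

lemma eq_zero_of_circleInt_mul_self {f : CircleFn} (h : circleInt (f * f) = 0) : f = 0 := by
  by_contra hf
  obtain ⟨x, hx⟩ : ∃ x, (f : ℝ → ℝ) x ≠ 0 := by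
    by_contra! hx
    exact hf (Subtype.ext (funext hx))
  obtain ⟨y, hy, hxy⟩ := f.2.2.exists_mem_Ico₀ Real.two_pi_pos x
  have hpos : 0 < ∫ x in (0 : ℝ)..(2 * Real.pi), ((f : ℝ → ℝ) x) * (f : ℝ → ℝ) x :=
    intervalIntegral.integral_pos Real.two_pi_pos (f.continuous.mul f.continuous).continuousOn
      (fun z _ => mul_self_nonneg _) ⟨y, Set.Ico_subset_Icc_self hy,
        mul_self_pos.2 (by rw [← hxy]; exact hx)⟩
  exact hpos.ne' h

lemma circleInt_mul_self_nonneg (f : CircleFn) : 0 ≤ circleInt (f * f) :=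
  intervalIntegral.integral_nonneg Real.two_pi_pos.le fun _ _ => mul_self_nonneg _

lemma eq_zero_of_circleInt_sum {ι : Type*} (s : Finset ι) (f : ι → CircleFn)
    (h : circleInt (∑ i ∈ s, f i * f i) = 0) : ∀ i ∈ s, f i = 0 := by
  have h1 : ∑ i ∈ s, circleInt (f i * f i) = 0 := by rw [← h]; exact (map_sum circleIntₗ _ _).symm
  rw [Finset.sum_eq_zero_iff_of_nonneg fun i _ => circleInt_mul_self_nonneg _] at h1
  exact fun i hi => eq_zero_of_circleInt_mul_self (h1 i hi)

lemma pairing_add_left (X Y Z : Mat n CircleFn) :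
    pairing (X + Y) Z = pairing X Z + pairing Y Z := by
  rw [pairing, add_mul, Matrix.trace_add, circleInt_add]; rfl

lemma pairing_sub_left (X Y Z : Mat n CircleFn) :
    pairing (X - Y) Z = pairing X Z - pairing Y Z := by
  rw [pairing, sub_mul, Matrix.trace_sub, circleInt_sub]; rfl

lemma pairing_comm (X Y : Mat n CircleFn) : pairing X Y = pairing Y X := by
  rw [pairing, Matrix.trace_mul_comm]; rfl

lemma pairing_sub_right (X Y Z : Mat n CircleFn) :
    pairing X (Y - Z) = pairing X Y - pairing X Z := by
  rw [pairing_comm, pairing_sub_left, pairing_comm Y, pairing_comm Z]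

lemma pairing_zero_left (X : Mat n CircleFn) : pairing 0 X = 0 := by
  rw [pairing, zero_mul, Matrix.trace_zero, circleInt_zero]

lemma pairing_zero_right (X : Mat n CircleFn) : pairing X 0 = 0 := by
  rw [pairing_comm, pairing_zero_left]

lemma pairing_covD (u : Fin n → CircleFn) (X Y : Mat n CircleFn) :
    pairing (covD circleD u X) Y = -pairing X (covD circleD u Y) := by
  rw [pairing, trace_covD_mul, circleInt_sub, circleInt_circleD, zero_sub]; rfl

lemma pairing_lie (X Y Z : Mat n CircleFn) :
    pairing (X * Y - Y * X) Z = -pairing X (Z * Y - Y * Z) := by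
  rw [pairing, pairing, ← neg_inj, neg_neg, sub_mul, mul_sub, Matrix.trace_sub, Matrix.trace_sub,
    circleInt_sub, circleInt_sub, neg_sub]
  congr 2
  · rw [mul_assoc, Matrix.trace_mul_comm, mul_assoc]
  · rw [mul_assoc]

lemma pairing_strictUpper {X Y : Mat n CircleFn} (hX : StrictUpper X) (hY : StrictUpper Y) :
    pairing X Y = 0 := by
  rw [pairing, hX.trace_mul hY, circleInt_zero]

/-- Allows `P_u(∇H)` to be replaced by `∇H` as soon as the other factor lies in `V_n`. -/
lemma pairing_toV (w : Fin n → CircleFn) {X : Mat n CircleFn} (hX : InSo X) :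
    pairing (toV w) X = pairing (toV w) (toVt (piZero X)) := by
  rw [pairing, pairing, trace_toV_mul_of_inSo w hX, trace_toV_mul_of_inSo w (inSo_toVt _),
    piZero_toVt]

lemma pairing_toV_toVt (v g : Fin n → CircleFn) :
    pairing (toV v) (toVt g) = 2 * circleInt (∑ i, v i * g i) := by
  rw [pairing, trace_toV_mul_of_inSo v (inSo_toVt g), piZero_toVt, two_mul, circleInt_add, two_mul]

lemma toVt_sub {A : Type*} [CommRing A] (g h : Fin n → A) :
    toVt (g - h) = toVt g - toVt h := by
  simp [toVt, sub_smul]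

lemma eq_of_pairing_left {g h : Fin n → CircleFn}
    (H : ∀ v, pairing (toV v) (toVt g) = pairing (toV v) (toVt h)) : g = h := by
  have h1 := H (g - h)
  rw [← sub_eq_zero, ← pairing_sub_right, ← toVt_sub, pairing_toV_toVt] at h1
  have h2 := eq_zero_of_circleInt_sum Finset.univ (g - h) (by linarith)
  exact sub_eq_zero.1 (funext fun i => h2 i (Finset.mem_univ i))

lemma eq_of_pairing_right {v w : Fin n → CircleFn}
    (H : ∀ g, pairing (toV v) (toVt g) = pairing (toV w) (toVt g)) : v = w := by
  have h1 := H (v - w)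
  rw [← sub_eq_zero, ← pairing_sub_left, ← toV_sub, pairing_toV_toVt] at h1
  have h2 := eq_zero_of_circleInt_sum Finset.univ (v - w) (by linarith)
  exact sub_eq_zero.1 (funext fun i => h2 i (Finset.mem_univ i))

/-! ### Gradients -/

lemma HasGrad.unique {F : (Fin n → CircleFn) → ℝ} {u g h : Fin n → CircleFn}
    (hg : HasGrad F u g) (hh : HasGrad F u h) : g = h :=
  eq_of_pairing_left fun v => (hg v).unique (hh v)

lemma HasGrad.grad_eq {F : (Fin n → CircleFn) → ℝ} {u g : Fin n → CircleFn}
    (hg : HasGrad F u g) : grad F u = g := by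
  have h : ∃ g, HasGrad F u g := ⟨g, hg⟩
  rw [grad, dif_pos h]
  exact h.choose_spec.unique hg

/-- Linear functionals realise every `g` as a gradient, which forces Hamiltonian vector fields to be
unique. -/
lemma hasGrad_pairing (g u : Fin n → CircleFn) :
    HasGrad (fun u => pairing (toV u) (toVt g)) u g := by
  intro v
  have h (ε : ℝ) : pairing (toV (u + ε • v)) (toVt g)
      = pairing (toV u) (toVt g) + ε * pairing (toV v) (toVt g) := by
    rw [toV_add, pairing_add_left]
    congr 1
    have h1 : toV (ε • v) = ε • toV v := by
      simp [toV, Finset.smul_sum, smul_assoc]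
    rw [h1, pairing, smul_mul_assoc, Matrix.trace_smul]
    exact map_smul circleIntₗ ε _
  simp only [h]
  simpa using ((hasDerivAt_id (0 : ℝ)).mul_const (pairing (toV v) (toVt g))).const_add
    (pairing (toV u) (toVt g))

/-! ### Lifts and the flows -/

variable {u v : Fin n → CircleFn}

/-- Duality: solve `[∂ + b + u, Y] + Xᵗ = y ∈ V_n` with `π_0(Y) = 0`. The covariant derivative is
skew and `V_n` is orthogonal to the kernel of `π_0`, so `⟨X, Xᵗ⟩ = 0`, an integral of a sum of
squares. -/
lemma eq_zero_of_covD_mem {X : Mat n CircleFn} (hX : InSo X) (hpi : piZero X = 0)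
    {w : Fin n → CircleFn} (hw : covD circleD u X = toV w) : X = 0 := by
  obtain ⟨Y, y, hY, hYpi, hYw⟩ := exists_lift_inhomogeneous circleD u X.transpose hX.transpose
  have h1 : pairing X (X.transpose) = 0 := by
    have h2 : X.transpose = toV y - covD circleD u Y := by rw [← hYw]; abel
    have h3 : pairing X (covD circleD u Y) = 0 := by
      rw [← neg_eq_zero, ← pairing_covD, hw, pairing_toV _ hY, hYpi, pairing_toV_toVt]
      simp [circleInt_zero]
    have h4 : pairing X (toV y) = 0 := by
      rw [pairing_comm, pairing_toV _ hX, hpi, pairing_toV_toVt]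
      simp [circleInt_zero]
    rw [h2, pairing_sub_right, h3, h4, sub_zero]
  have h2 : (X * X.transpose).trace
      = ∑ p : Fin (2 * n + 1) × Fin (2 * n + 1), X p.1 p.2 * X p.1 p.2 := by
    rw [Fintype.sum_prod_type]
    simp [Matrix.trace, Matrix.mul_apply]
  rw [pairing, h2] at h1
  ext1 r s
  exact eq_zero_of_circleInt_sum Finset.univ _ h1 (r, s) (Finset.mem_univ _)

lemma IsLift.unique {X Y : Mat n CircleFn} (hX : IsLift u v X) (hY : IsLift u v Y) : X = Y := by
  obtain ⟨x, hx⟩ := hX.cov_mem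
  obtain ⟨y, hy⟩ := hY.cov_mem
  refine sub_eq_zero.1 (eq_zero_of_covD_mem (u := u) (w := x - y) (hX.mem_so.sub hY.mem_so) ?_ ?_)
  · rw [piZero_sub, hX.proj, hY.proj, sub_self]
  · rw [covD_sub, hx, hy, toV_sub]

theorem existsUnique_isLift (u v : Fin n → CircleFn) : ∃! X, IsLift u v X := by
  obtain ⟨X, w, hX, hpi, hw⟩ := exists_lift circleD u v
  have h : IsLift u v X := ⟨hX, ⟨w, hw⟩, hpi⟩
  exact ⟨X, h, fun Y hY => hY.unique h⟩

lemma isLift_Pu (u v : Fin n → CircleFn) : IsLift u v (Pu u v) := by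
  have h := (existsUnique_isLift u v).exists
  rw [Pu, dif_pos h]
  exact h.choose_spec

lemma isResolvent_resolvent (hn : 1 ≤ n) (u : Fin n → CircleFn) :
    IsResolvent circleD u (resolvent u) := by
  have h := exists_isResolvent hn circleD u
  rw [resolvent, dif_pos h]
  exact h.choose_spec

lemma covD_Pcoeff (hn : 1 ≤ n) (k : ℕ) (i : ℤ) (u : Fin n → CircleFn) :
    covD circleD u (Pcoeff k i u)
      = Pcoeff k (i - 1) u * beta n CircleFn - beta n CircleFn * Pcoeff k (i - 1) u :=
  (isResolvent_resolvent hn u).covD_lamCoeff k i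

lemma inSo_Pcoeff (hn : 1 ≤ n) {k : ℕ} (hk : Odd k) (i : ℤ) (u : Fin n → CircleFn) :
    InSo (Pcoeff k i u) :=
  (isResolvent_resolvent hn u).inSo_lamCoeff hk i

lemma odd_two_mul_sub_one {j : ℕ} (hj : 1 ≤ j) : Odd (2 * j - 1) := ⟨j - 1, by omega⟩

variable {j : ℕ}

lemma IsEta.isLift (hn : 1 ≤ n) (hj : 1 ≤ j) {η : Mat n CircleFn} (h : IsEta j u η) :
    IsLift u (piZero (Pcoeff (2 * j - 1) 0 u)) (Pcoeff (2 * j - 1) 0 u - η) :=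
  ⟨(inSo_Pcoeff hn (odd_two_mul_sub_one hj) 0 u).sub h.mem_so, h.cov_mem, by
    rw [piZero_sub, piZero_eq_zero_of_strictUpper h.upper, sub_zero]⟩

/-- The difference has `π_0 = 0`, and its covariant derivative is `[P_{2j-1,-1}, β]` minus an
element of `V_n`, without positive degree. `strictUpper_of_covD` then applies. -/
lemma isEta_sub_Pu (hn : 1 ≤ n) (hj : 1 ≤ j) (u : Fin n → CircleFn) :
    IsEta j u (Pcoeff (2 * j - 1) 0 u - Pu u (piZero (Pcoeff (2 * j - 1) 0 u))) := by
  have hL := isLift_Pu u (piZero (Pcoeff (2 * j - 1) 0 u))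
  have hodd := odd_two_mul_sub_one hj
  have hso := (inSo_Pcoeff hn hodd 0 u).sub hL.mem_so
  obtain ⟨w, hw⟩ := hL.cov_mem
  refine ⟨hso, strictUpper_of_covD circleD u hso ?_ ?_, w, ?_⟩
  · rw [piZero_sub, hL.proj, sub_self]
  · rw [covD_sub, covD_Pcoeff hn, hw]
    exact (degLE_zero_lie_beta (inSo_Pcoeff hn hodd _ u)).sub ((degLE_toV w).mono (by norm_num))
  · rw [sub_sub_cancel, hw]

theorem existsUnique_isEta (hn : 1 ≤ n) (hj : 1 ≤ j) (u : Fin n → CircleFn) :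
    ∃! η, IsEta j u η :=
  ⟨_, isEta_sub_Pu hn hj u, fun η hη => by
    rw [← (hη.isLift hn hj).unique (isLift_Pu _ _), sub_sub_cancel]⟩

lemma covD_Pu_eq_kdvField (hn : 1 ≤ n) (hj : 1 ≤ j) (u : Fin n → CircleFn) :
    covD circleD u (Pu u (piZero (Pcoeff (2 * j - 1) 0 u))) = toV (kdvField j u) := by
  have h : ∃ w, ∃ η, IsEta j u η ∧ covD circleD u (Pcoeff (2 * j - 1) 0 u - η) = toV w := by
    obtain ⟨w, hw⟩ := (isEta_sub_Pu hn hj u).cov_mem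
    exact ⟨w, _, isEta_sub_Pu hn hj u, hw⟩
  rw [kdvField, dif_pos h]
  obtain ⟨η, hη, h1⟩ := h.choose_spec
  rw [← h1, (hη.isLift hn hj).unique (isLift_Pu _ _)]

lemma exists_eta (hn : 1 ≤ n) (hj : 1 ≤ j) (u : Fin n → CircleFn) :
    ∃ η, InSo η ∧ StrictUpper η ∧
      Pu u (piZero (Pcoeff (2 * j - 1) 0 u)) = Pcoeff (2 * j - 1) 0 u - η :=
  ⟨_, (isEta_sub_Pu hn hj u).mem_so, (isEta_sub_Pu hn hj u).upper, (sub_sub_cancel _ _).symm⟩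

/-- The commutator of `P_u(π₀ P_{2j-1,0})` with `β`. -/
lemma Pu_lie_beta (hn : 1 ≤ n) (hj : 1 ≤ j) (u : Fin n → CircleFn) :
    Pu u (piZero (Pcoeff (2 * j - 1) 0 u)) * beta n CircleFn
        - beta n CircleFn * Pu u (piZero (Pcoeff (2 * j - 1) 0 u))
      = covD circleD u (Pcoeff (2 * j - 1) 1 u) := by
  obtain ⟨η, hη, hup, h⟩ := exists_eta hn hj u
  have h1 := StrictUpper.lie_beta hη hup
  rw [h, covD_Pcoeff hn, sub_self, sub_mul, mul_sub, ← add_zero (_ - _), ← h1]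
  abel

end

/-! ### Naturality of the resolvent and polynomial families -/

section

variable {n : ℕ}

/-! ### Naturality of the resolvent -/

section Naturality

variable {A B : Type*} [CommRing A] [Algebra ℝ A] [CommRing B] [Algebra ℝ B]

/-- A ring homomorphism, applied to every coefficient of a Laurent series. -/
def laurentMap (φ : A →+* B) : LaurentSeries A →+* LaurentSeries B where
  toFun f := f.map φ
  map_one' := by
    ext k
    rw [HahnSeries.map_coeff, HahnSeries.coeff_one, HahnSeries.coeff_one]
    split_ifs <;> simp
  map_mul' f g := HahnSeries.map_mul (φ : A →ₙ+* B)
  map_zero' := by ext; simp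
  map_add' f g := by ext; simp

omit [Algebra ℝ A] [Algebra ℝ B] in
lemma laurentMap_coeff (φ : A →+* B) (f : LaurentSeries A) (k : ℤ) :
    (laurentMap φ f).coeff k = φ (f.coeff k) := rfl

omit [Algebra ℝ A] [Algebra ℝ B] in
lemma lamCoeff_laurentMap (φ : A →+* B) (P : Mat n (LaurentSeries A)) (i : ℤ) :
    lamCoeff (P.map (laurentMap φ)) i = (lamCoeff P i).map φ := rfl

omit [Algebra ℝ A] [Algebra ℝ B] in
lemma laurentMap_constLoop (φ : A →+* B) (X : Mat n A) :
    (constLoop X).map (laurentMap φ) = constLoop (X.map φ) := by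
  ext r s k
  simp only [constLoop, Matrix.map_apply, laurentMap_coeff, HahnSeries.C_apply,
    HahnSeries.coeff_single]
  split_ifs <;> simp

omit [Algebra ℝ A] [Algebra ℝ B] in
lemma laurentMap_lam (φ : A →+* B) : laurentMap φ (lam A) = lam B := by
  ext k
  rw [laurentMap_coeff, lam, lam, HahnSeries.coeff_single, HahnSeries.coeff_single]
  split_ifs <;> simp

omit [Algebra ℝ A] [Algebra ℝ B] in
lemma lamCoeff_laurentMap_pow (φ : A →+* B) (P : Mat n (LaurentSeries A)) (k : ℕ) (i : ℤ) :
    lamCoeff (P.map (laurentMap φ) ^ k) i = (lamCoeff (P ^ k) i).map φ := by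
  rw [← lamCoeff_laurentMap]
  congr 1
  exact (map_pow (RingHom.mapMatrix (laurentMap φ)) P k).symm

lemma laurentMap_JB (φ : A →ₐ[ℝ] B) : (JB n A).map (laurentMap (φ : A →+* B)) = JB n B := by
  rw [JB, JB, Matrix.map_add _ (map_add _), laurentMap_constLoop, b_map]
  congr 1
  ext1 r s
  rw [Matrix.map_apply, Matrix.smul_apply, smul_eq_mul, map_mul, laurentMap_lam, ← beta_map φ,
    Matrix.smul_apply, smul_eq_mul]
  congr 1
  exact congrFun (congrFun (laurentMap_constLoop (φ : A →+* B) (beta n A)) r) s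

/-- Together with uniqueness, this computes the resolvents of a whole family from one resolvent over
a larger algebra. -/
lemma IsResolvent.map {D : Derivation ℝ A A} {u : Fin n → A} {P : Mat n (LaurentSeries A)}
    (hP : IsResolvent D u P) (φ : A →ₐ[ℝ] B) {D' : Derivation ℝ B B}
    (hφ : ∀ x, φ (D x) = D' (φ x)) :
    IsResolvent D' (fun i => φ (u i)) (P.map (laurentMap (φ : A →+* B))) := by
  have hU : (JB n A + constLoop (toV u)).map (laurentMap (φ : A →+* B))
      = JB n B + constLoop (toV fun i => φ (u i)) := by
    rw [Matrix.map_add _ (map_add _), laurentMap_JB, laurentMap_constLoop, toV_map]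
    rfl
  refine ⟨fun i => (hP.mem_so i).map (φ : A →+* B), ?_, fun i hi => ?_, ?_, ?_⟩
  · rw [← laurentMap_JB φ]
    exact (RingHom.mapMatrix (m := Fin (2 * n + 1))
      (laurentMap (φ : A →+* B))).toMonoidHom.map_isConj hP.conj
  · rw [lamCoeff_laurentMap, hP.coeff_gt i hi]
    exact Matrix.map_zero _ (map_zero _)
  · rw [lamCoeff_laurentMap, hP.coeff_one]
    exact beta_map φ
  · have h := congrArg (fun X : Mat n (LaurentSeries A) => X.map (laurentMap (φ : A →+* B))) hP.comm
    rw [Matrix.map_add _ (map_add _), Matrix.map_sub _ (map_sub _), Matrix.map_mul, Matrix.map_mul,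
      hU, Matrix.map_zero _ (map_zero _)] at h
    rw [← h]
    congr 1
    ext r s k
    exact (hφ _).symm

end Naturality

lemma Pcoeff_eq_map {A : Type*} [CommRing A] [Algebra ℝ A] (hn : 1 ≤ n) {D : Derivation ℝ A A}
    {w : Fin n → A} {P : Mat n (LaurentSeries A)} (hP : IsResolvent D w P) (φ : A →ₐ[ℝ] CircleFn)
    (hφ : ∀ x, φ (D x) = circleD (φ x)) (k : ℕ) (i : ℤ) :
    Pcoeff k i (fun m => φ (w m)) = (lamCoeff (P ^ k) i).map φ := by
  rw [Pcoeff, (isResolvent_resolvent hn _).unique hn (hP.map φ hφ)]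
  exact lamCoeff_laurentMap_pow (φ : A →+* CircleFn) P k i

/-! ### The gradients of the Hamiltonians -/

open Polynomial

/-- A derivation, applied to every coefficient of a polynomial. -/
def polyD (D : Derivation ℝ CircleFn CircleFn) : Derivation ℝ CircleFn[X] CircleFn[X] :=
  (PolynomialModule.equivPolynomialSelf (R := CircleFn)).toLinearMap.compDer D.mapCoeffs

lemma polyD_coeff (D : Derivation ℝ CircleFn CircleFn) (p : CircleFn[X]) (k : ℕ) :
    (polyD D p).coeff k = D (p.coeff k) := rfl

lemma polyD_derivative (D : Derivation ℝ CircleFn CircleFn) (p : CircleFn[X]) :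
    polyD D (derivative p) = derivative (polyD D p) := by
  ext1 k
  rw [polyD_coeff, coeff_derivative, coeff_derivative, polyD_coeff, Derivation.leibniz]
  have : D ((k : CircleFn) + 1) = 0 := by rw [map_add, D.map_natCast, D.map_one_eq_zero, add_zero]
  rw [this, smul_zero, zero_add, smul_eq_mul, mul_comm]

/-- Evaluation at a real number. -/
def evalReal (ε : ℝ) : CircleFn[X] →ₐ[ℝ] CircleFn :=
  (aeval (algebraMap ℝ CircleFn ε)).restrictScalars ℝ

lemma evalReal_monomial (ε : ℝ) (k : ℕ) (a : CircleFn) :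
    evalReal ε (monomial k a) = ε ^ k • a := by
  change aeval (algebraMap ℝ CircleFn ε) (monomial k a) = _
  rw [aeval_monomial, ← map_pow, Algebra.smul_def, mul_comm]
  rfl

lemma evalReal_polyD (D : Derivation ℝ CircleFn CircleFn) (ε : ℝ) (p : CircleFn[X]) :
    evalReal ε (polyD D p) = D (evalReal ε p) := by
  induction p using Polynomial.induction_on' with
  | add p q hp hq => simp only [map_add, hp, hq]
  | monomial k a =>
    have : polyD D (monomial k a) = monomial k (D a) := by
      ext1 l
      rw [polyD_coeff, coeff_monomial, coeff_monomial]
      split_ifs <;> simp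
    rw [this, evalReal_monomial, evalReal_monomial, D.map_smul]

lemma hasDerivAt_circleInt_evalReal (p : CircleFn[X]) (ε : ℝ) :
    HasDerivAt (fun ε => circleInt (evalReal ε p)) (circleInt (evalReal ε (derivative p))) ε := by
  induction p using Polynomial.induction_on' with
  | add p q hp hq => simpa only [map_add, circleInt_add] using hp.fun_add hq
  | monomial k a =>
    have h (c : ℝ) (f : CircleFn) : circleInt (c • f) = c * circleInt f := map_smul circleIntₗ c f
    have h1 : a * (k : CircleFn) = (k : ℝ) • a := by
      rw [mul_comm, Algebra.smul_def, map_natCast]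
    simp only [derivative_monomial, evalReal_monomial, h, h1]
    exact ((hasDerivAt_pow k ε).mul_const (circleInt a)).congr_deriv (by ring)

/-- The polynomial family `u + ε v`. -/
lemma evalReal_line (u v : Fin n → CircleFn) (ε : ℝ) :
    (fun i => evalReal ε (C (u i) + X * C (v i))) = u + ε • v := by
  ext1 i
  have h1 (a : CircleFn) : evalReal ε (C a) = a := aeval_C _ a
  have h2 : evalReal ε X = algebraMap ℝ CircleFn ε := aeval_X _
  simp only [map_add, map_mul, h1, h2, Pi.add_apply, Pi.smul_apply]
  rw [Algebra.smul_def]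

/-- One resolvent over `CircleFn[X]` specialises at `X = ε` to all `P(u + ε v)`. Every coefficient
is thus polynomial in `ε`, and differentiating a functional along the line becomes algebra. -/
lemma exists_Pcoeff_line (hn : 1 ≤ n) (u v : Fin n → CircleFn) :
    ∃ P, IsResolvent (polyD circleD) (fun i => C (u i) + X * C (v i)) P ∧
      ∀ (ε : ℝ) (k : ℕ) (i : ℤ), Pcoeff k i (u + ε • v) = (lamCoeff (P ^ k) i).map (evalReal ε) := by
  obtain ⟨P, hP⟩ := exists_isResolvent hn (polyD circleD) fun i => C (u i) + X * C (v i)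
  refine ⟨P, hP, fun ε k i => ?_⟩
  have h := Pcoeff_eq_map hn hP (evalReal ε) (evalReal_polyD circleD ε) k i
  rwa [evalReal_line] at h

end

/-! ### Gradients of the Hamiltonians, their vector fields and involution -/

section

open Polynomial

variable {n : ℕ}

lemma trace_map_mul {A B : Type*} [CommRing A] [CommRing B] (φ : A →+* B) (X Y : Mat n A) :
    φ (X * Y).trace = (X.map φ * Y.map φ).trace := by
  rw [← Matrix.map_mul, AddMonoidHom.map_trace]

lemma circleInt_smul (c : ℝ) (f : CircleFn) : circleInt (c • f) = c * circleInt f :=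
  map_smul circleIntₗ c f

/-- The variation of `∮ tr(P_{k,-1} β)` along the line `u + ε v`. -/
lemma hasDerivAt_trace_Pcoeff (hn : 1 ≤ n) (u v : Fin n → CircleFn) (k : ℕ) (hk : Odd (k + 1)) :
    HasDerivAt (fun ε : ℝ => circleInt (Pcoeff (k + 1) (-1) (u + ε • v) * beta n CircleFn).trace)
      (-((k + 1) / (2 * n)) * pairing (toV v) (toVt (piZero (Pcoeff (k + 1) 0 u)))) 0 := by
  obtain ⟨P, hP, hco⟩ := exists_Pcoeff_line hn u v
  -- The variation `δ` is `d/dX`, which sends `u + X v` to `v` and commutes with `∂_x`.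
  obtain ⟨r, hr⟩ := hP.variation (derivative'.restrictScalars ℝ) (polyD_derivative circleD) k
  have hF (ε : ℝ) : (Pcoeff (k + 1) (-1) (u + ε • v) * beta n CircleFn).trace
      = evalReal ε (lamCoeff (P ^ (k + 1)) (-1) * beta n CircleFn[X]).trace := by
    have := trace_map_mul (evalReal ε : CircleFn[X] →+* CircleFn) (lamCoeff (P ^ (k + 1)) (-1))
      (beta n CircleFn[X])
    have hb : (beta n CircleFn[X]).map (evalReal ε) = beta n CircleFn :=
      beta_map (A := CircleFn[X]) (evalReal ε)
    rw [hco, ← hb]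
    exact this.symm
  simp only [hF]
  generalize (lamCoeff (P ^ (k + 1)) (-1) * beta n CircleFn[X]).trace = T at hr
  refine (hasDerivAt_circleInt_evalReal T 0).congr_deriv ?_
  have hwd : (fun i => (derivative'.restrictScalars ℝ : Derivation ℝ CircleFn[X] CircleFn[X])
      (C (u i) + X * C (v i))) = fun i => C (v i) := by
    ext1 i
    change derivative (C (u i) + X * C (v i)) = C (v i)
    simp
  have hdT : (derivative'.restrictScalars ℝ : Derivation ℝ CircleFn[X] CircleFn[X]) T
      = derivative T := rfl
  rw [hwd, hdT] at hr
  have e1 : pairing (toV v) (Pcoeff (k + 1) 0 u)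
      = circleInt (evalReal 0 (toV (fun i => C (v i)) * lamCoeff (P ^ (k + 1)) 0).trace) := by
    have h0 := hco 0 (k + 1) 0
    rw [zero_smul, add_zero] at h0
    have h3 : (toV (fun i => C (v i))).map (evalReal 0) = toV v := by
      refine (toV_map (evalReal 0 : CircleFn[X] →+* CircleFn) fun i => C (v i)).trans ?_
      congr 1
      ext1 i
      exact aeval_C _ (v i)
    have h4 := trace_map_mul (evalReal 0 : CircleFn[X] →+* CircleFn) (toV fun i => C (v i))
      (lamCoeff (P ^ (k + 1)) 0)
    rw [pairing, h0, ← h3]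
    exact congrArg circleInt h4.symm
  generalize (toV (fun i => C (v i)) * lamCoeff (P ^ (k + 1)) 0).trace = S at hr e1
  have h1 := congrArg (evalReal 0) hr
  have hc (a : ℝ) (p : CircleFn[X]) : circleInt (evalReal 0 (algebraMap ℝ CircleFn[X] a * p))
      = a * circleInt (evalReal 0 p) := by
    rw [← Algebra.smul_def, map_smul, circleInt_smul]
  have c1 : (2 * n : CircleFn[X]) = algebraMap ℝ CircleFn[X] (2 * n) := by
    rw [map_mul, map_ofNat, map_natCast]
  have c2 : (k + 1 : CircleFn[X]) = algebraMap ℝ CircleFn[X] (k + 1) := by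
    rw [map_add, map_one, map_natCast]
  rw [c1, c2, map_add, evalReal_polyD] at h1
  have h2 := congrArg circleInt h1
  rw [circleInt_circleD, circleInt_add, hc, hc, ← e1, pairing_toV _ (inSo_Pcoeff hn hk 0 u)] at h2
  have hn0 : (2 * n : ℝ) ≠ 0 := by positivity
  field_simp
  linarith

theorem hasGrad_hamF (hn : 1 ≤ n) {j : ℕ} (hj : 1 ≤ j) (u : Fin n → CircleFn) :
    HasGrad (hamF n j) u (piZero (Pcoeff (2 * j - 1) 0 u)) := by
  intro v
  obtain ⟨k, rfl⟩ : ∃ k, j = k + 1 := ⟨j - 1, by omega⟩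
  have h := (hasDerivAt_trace_Pcoeff hn u v (2 * k) ⟨k, rfl⟩).const_mul
    (-((2 * n : ℝ) / (2 * (k + 1 : ℕ) - 1)))
  refine h.congr_deriv ?_
  have hn0 : (2 * n : ℝ) ≠ 0 := by positivity
  have hk0 : (2 * (k : ℝ) + 1) ≠ 0 := by positivity
  have e2 : (2 * ((k + 1 : ℕ) : ℝ) - 1) = 2 * k + 1 := by push_cast; ring
  rw [e2, ← mul_assoc, show 2 * (k + 1) - 1 = 2 * k + 1 from rfl]
  push_cast
  field_simp

lemma grad_hamF (hn : 1 ≤ n) {j : ℕ} (hj : 1 ≤ j) (u : Fin n → CircleFn) :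
    grad (hamF n j) u = piZero (Pcoeff (2 * j - 1) 0 u) :=
  (hasGrad_hamF hn hj u).grad_eq

/-! ### The Hamiltonian vector fields -/

lemma isHamiltonianField_iff
    {br : ((Fin n → CircleFn) → ℝ) → ((Fin n → CircleFn) → ℝ) → (Fin n → CircleFn) → ℝ}
    {F : (Fin n → CircleFn) → ℝ} {Y : (Fin n → CircleFn) → (Fin n → CircleFn)}
    (h : IsHamiltonianField br F Y) (X : (Fin n → CircleFn) → (Fin n → CircleFn)) :
    IsHamiltonianField br F X ↔ X = Y := by
  refine ⟨fun hX => funext fun u => eq_of_pairing_right fun g => ?_, fun hX => hX ▸ h⟩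
  have hg : IsFunctional fun u : Fin n → CircleFn => pairing (toV u) (toVt g) :=
    fun u => ⟨g, hasGrad_pairing g u⟩
  have h1 := hX _ hg u
  rw [h _ hg u, (hasGrad_pairing g u).grad_eq] at h1
  exact h1.symm

theorem isHamiltonianField_kdvField (hn : 1 ≤ n) {j : ℕ} (hj : 1 ≤ j) :
    IsHamiltonianField bracket₂ (hamF n j) (kdvField j) := by
  intro H _ u
  have hL := isLift_Pu u (grad H u)
  rw [bracket₂, grad_hamF hn hj, covD_Pu_eq_kdvField hn hj, pairing_toV _ hL.mem_so, hL.proj]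

/-- From `P^{2n+1} = λ P`. At `k = 0` it would claim `P^{2n} = λ`, which fails because `J_B` is
singular. -/
lemma lamCoeff_pow_add {A : Type*} [CommRing A] [Algebra ℝ A] (hn : 1 ≤ n)
    {P : Mat n (LaurentSeries A)} (h : IsConj (JB n A) P) {k : ℕ} (hk : 1 ≤ k) (i : ℤ) :
    lamCoeff (P ^ (k + 2 * n)) i = lamCoeff (P ^ k) (i - 1) := by
  obtain ⟨l, rfl⟩ : ∃ l, k = l + 1 := ⟨k - 1, by omega⟩
  rw [show l + 1 + 2 * n = l + (2 * n + 1) by ring, pow_add, pow_of_isConj hn h, mul_smul_comm,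
    ← pow_succ, lamCoeff_lam_smul]

lemma Pcoeff_add (hn : 1 ≤ n) {k : ℕ} (hk : 1 ≤ k) (i : ℤ) (u : Fin n → CircleFn) :
    Pcoeff (k + 2 * n) i u = Pcoeff k (i - 1) u :=
  lamCoeff_pow_add hn (isResolvent_resolvent hn u).conj hk i

/-- The covariant derivative of a strictly upper triangular matrix is orthogonal to all lifts. -/
lemma pairing_covD_strictUpper {u v : Fin n → CircleFn} {η : Mat n CircleFn}
    (hup : StrictUpper η) : pairing (covD circleD u η) (Pu u v) = 0 := by
  obtain ⟨w, hw⟩ := (isLift_Pu u v).cov_mem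
  rw [pairing_covD, hw, pairing_strictUpper hup (toV_strictUpper w), neg_zero]

/-- The commutator with `β` is the covariant derivative of `P_{2j-1,1}`, which equals
`P_{2(j-n)-1,0}` by `Pcoeff_add`. Replacing the latter by its `η`-corrected form costs only the
derivative of a strictly upper triangular matrix, orthogonal to every lift. -/
theorem isHamiltonianField_kdvField_sub (hn : 1 ≤ n) {j : ℕ} (hj : n + 1 ≤ j) :
    IsHamiltonianField bracket₁ (hamF n j) (kdvField (j - n)) := by
  intro H _ u
  obtain ⟨m, hm, rfl⟩ : ∃ m, 1 ≤ m ∧ j = m + n := ⟨j - n, by omega, by omega⟩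
  have hL := isLift_Pu u (grad H u)
  obtain ⟨η, -, hup, h⟩ := exists_eta hn hm u
  rw [bracket₁, grad_hamF hn (by omega), Pu_lie_beta hn (by omega), Nat.add_sub_cancel,
    show 2 * (m + n) - 1 = 2 * m - 1 + 2 * n by omega, Pcoeff_add hn (by omega), sub_self,
    ← hL.proj, ← pairing_toV _ hL.mem_so, ← covD_Pu_eq_kdvField hn hm, h, covD_sub,
    pairing_sub_left, hL.proj, pairing_covD_strictUpper hup, sub_zero]

/-! ### Involution -/

/-- Skewness of the covariant derivative and of the bracket with `β` moves one power of `λ` from the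
second factor to the first. After enough moves the first index exceeds every power of `λ` in `P^k`.
-/
lemma pairing_covD_Pcoeff (hn : 1 ≤ n) (k l : ℕ) (i m : ℤ) (u : Fin n → CircleFn) :
    pairing (covD circleD u (Pcoeff k i u)) (Pcoeff l m u) = 0 := by
  have step (i m : ℤ) : pairing (covD circleD u (Pcoeff k i u)) (Pcoeff l m u)
      = pairing (covD circleD u (Pcoeff k (i + 1) u)) (Pcoeff l (m - 1) u) := by
    rw [pairing_covD, covD_Pcoeff hn l, covD_Pcoeff hn k, pairing_lie, add_sub_cancel_right]
  have steps (d : ℕ) : ∀ i m : ℤ, pairing (covD circleD u (Pcoeff k i u)) (Pcoeff l m u)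
      = pairing (covD circleD u (Pcoeff k (i + d) u)) (Pcoeff l (m - d) u) := by
    induction d with
    | zero => simp
    | succ d ih =>
      intro i m
      rw [ih, step, Nat.cast_succ, add_assoc, sub_sub]
  obtain ⟨B, hB⟩ := exists_lamCoeff_eq_zero (resolvent u ^ k)
  have h : Pcoeff k (i + ((B + 1 - i).toNat : ℕ)) u = 0 := hB _ (by omega)
  rw [steps (B + 1 - i).toNat, h, covD_zero, pairing_zero_left]

/-- Both triangular corrections drop out: the first is orthogonal to lifts, the second commutes with
`β` and meets only `[P_{2i-1,-1}, β]`. What remains is `pairing_covD_Pcoeff`. -/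
theorem bracket₂_hamF (hn : 1 ≤ n) {i j : ℕ} (hi : 1 ≤ i) (hj : 1 ≤ j) (u : Fin n → CircleFn) :
    bracket₂ (hamF n i) (hamF n j) u = 0 := by
  obtain ⟨η, -, hup, h⟩ := exists_eta hn hi u
  obtain ⟨θ, hθ, hup', h'⟩ := exists_eta hn hj u
  have h0 : θ * beta n CircleFn - beta n CircleFn * θ = 0 := StrictUpper.lie_beta hθ hup'
  rw [bracket₂, grad_hamF hn hi, grad_hamF hn hj, h, covD_sub, pairing_sub_left,
    pairing_covD_strictUpper hup, sub_zero, h', pairing_sub_right, pairing_covD_Pcoeff hn,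
    covD_Pcoeff hn, pairing_lie, h0, pairing_zero_right, neg_zero, sub_zero]

theorem bracket₁_hamF (hn : 1 ≤ n) {i j : ℕ} (hi : 1 ≤ i) (hj : 1 ≤ j) (u : Fin n → CircleFn) :
    bracket₁ (hamF n i) (hamF n j) u = 0 := by
  obtain ⟨θ, hθ, hup, h⟩ := exists_eta hn hj u
  have h0 : θ * beta n CircleFn - beta n CircleFn * θ = 0 := StrictUpper.lie_beta hθ hup
  rw [bracket₁, grad_hamF hn hi, grad_hamF hn hj, Pu_lie_beta hn hi, h, pairing_sub_right,
    pairing_covD_Pcoeff hn, covD_Pcoeff hn, pairing_lie, h0, pairing_zero_right, neg_zero, sub_zero]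

end

end BKdV

end

theorem mainTheorem7 (n : ℕ) (hn : 1 ≤ n) :
    -- the objects are well defined: `P(u, λ)`, `P_u(v)`, `η_j(u)`
    (∀ u : Fin n → BKdV.CircleFn, ∃! P, BKdV.IsResolvent BKdV.circleD u P) ∧
    (∀ u v : Fin n → BKdV.CircleFn, ∃! X, BKdV.IsLift u v X) ∧
    (∀ j : ℕ, 1 ≤ j → ∀ u : Fin n → BKdV.CircleFn, ∃! η, BKdV.IsEta j u η) ∧
    -- the gradient of `F_{2j-1}`
    (∀ j : ℕ, 1 ≤ j → ∀ u g : Fin n → BKdV.CircleFn,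
      BKdV.HasGrad (BKdV.hamF n j) u g ↔ g = BKdV.piZero (BKdV.Pcoeff (2 * j - 1) 0 u)) ∧
    -- the Hamiltonian vector field of `F_{2j-1}` for the second bracket
    (∀ j : ℕ, 1 ≤ j → ∀ X : (Fin n → BKdV.CircleFn) → (Fin n → BKdV.CircleFn),
      BKdV.IsHamiltonianField BKdV.bracket₂ (BKdV.hamF n j) X ↔ X = BKdV.kdvField j) ∧
    -- the Hamiltonian vector field of `F_{2j-1}` for the first bracket
    (∀ j : ℕ, n + 1 ≤ j → ∀ X : (Fin n → BKdV.CircleFn) → (Fin n → BKdV.CircleFn),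
      BKdV.IsHamiltonianField BKdV.bracket₁ (BKdV.hamF n j) X ↔ X = BKdV.kdvField (j - n)) ∧
    -- the `F_{2j-1}` are conservation laws in involution for both brackets
    (∀ i j : ℕ, 1 ≤ i → 1 ≤ j → ∀ u : Fin n → BKdV.CircleFn,
      BKdV.bracket₁ (BKdV.hamF n i) (BKdV.hamF n j) u = 0 ∧
      BKdV.bracket₂ (BKdV.hamF n i) (BKdV.hamF n j) u = 0) := by
  refine ⟨fun u => BKdV.existsUnique_isResolvent hn _ u, fun u v => BKdV.existsUnique_isLift u v,
    fun j hj u => BKdV.existsUnique_isEta hn hj u, fun j hj u g => ⟨fun h => ?_, fun h => ?_⟩,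
    fun j hj X => ?_, fun j hj X => ?_, fun i j hi hj u => ⟨?_, ?_⟩⟩
  · exact h.unique (BKdV.hasGrad_hamF hn hj u)
  · exact h ▸ BKdV.hasGrad_hamF hn hj u
  · exact BKdV.isHamiltonianField_iff (BKdV.isHamiltonianField_kdvField hn hj) X
  · exact BKdV.isHamiltonianField_iff (BKdV.isHamiltonianField_kdvField_sub hn hj) X
  · exact BKdV.bracket₁_hamF hn hi hj u
  · exact BKdV.bracket₂_hamF hn hi hj u
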